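/- Let $S$ be a finite set with $n=|S|\ge 7$ and let $d\in(0,1)$. For each integer $L\ge 0$ let $R$ be a tuple of $\lfloor (2n-1)^{dL}\rfloor$ words chosen uniformly at random (independently, repetitions allowed) from the reduced words of length $L$ in the letters $S\cup S^{-1}$, and let $G=\langle S\mid R\rangle$ be the resulting random group at density $d$ and length $L$. Then with probability tending to $1$ as $L\to\infty$ the group $G$ has property $F\mathcal C_2$: for every $\mathrm{CAT}(0)$ cube complex $X$ of dimension at most $2$ and every action of $G$ on $X$ by cubical isometries, there is a point of $X$ fixed by all of $G$. Here a cube complex is a union of embedded Euclidean unit cubes, any two of which are disjoint or glued along a common face; it is $\mathrm{CAT}(0)$ if it is (nonempty and) simply connected and the link of every vertex is a flag simplicial complex; a cubical isometry is an isometry of $X$ that maps cubes to cubes (equivalently, an automorphism of the cube complex). No local finiteness of $X$ is assumed. -/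

import Mathlib

universe u v

/-! ## Cube complexes -/

/-- A face of the combinatorial cube `{0,1}^k`: some coordinates are prescribed (`p i = some b`),
the other ones are free (`p i = none`). -/
def IsCubeFace {k : ℕ} (F : Set (Fin k → Bool)) : Prop :=
  ∃ p : Fin k → Option Bool, F = {x | ∀ i b, p i = some b → x i = b}

/-- `φ` identifies the vertices of the standard `k`-cube with vertices in `V`, in such a way that
the members of `cubes` inside the image are exactly the images of the faces of the cube. -/
def IsCubeChart {V : Type u} (cubes : Set (Set V)) {k : ℕ} (φ : (Fin k → Bool) → V) : Prop :=
  Function.Injective φ ∧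
    ∀ s ⊆ Set.range φ, s ∈ cubes ↔ ∃ F : Set (Fin k → Bool), IsCubeFace F ∧ s = φ '' F

/-- A cube complex with vertex set `V`: a union of Euclidean unit cubes, each of them embedded, any
two of which are disjoint or meet in a common face along which they are glued by an isometry.
A cube is recorded as the set of its vertices. No bound on the dimension and no local finiteness
is imposed. -/
structure CubeComplex (V : Type u) where
  /-- The vertex sets of the (closed) cubes. -/
  cubes : Set (Set V)
  singleton_mem : ∀ x : V, {x} ∈ cubes
  /-- Every cube is a copy of a standard cube `[0,1]^k`, with its faces. -/
  exists_chart : ∀ c ∈ cubes, ∃ (k : ℕ) (φ : (Fin k → Bool) → V),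
    IsCubeChart cubes φ ∧ Set.range φ = c
  /-- Two cubes which meet, meet in a cube (hence in a common face). -/
  inter_mem : ∀ c ∈ cubes, ∀ c' ∈ cubes, (c ∩ c').Nonempty → c ∩ c' ∈ cubes

namespace CubeComplex

variable {V : Type u} (X : CubeComplex V)

/-- All cubes have dimension at most `n`. -/
def DimLE (n : ℕ) : Prop :=
  ∀ (k : ℕ) (φ : (Fin k → Bool) → V), IsCubeChart X.cubes φ → k ≤ n

/-- The 1-skeleton. -/
def graph : SimpleGraph V where
  Adj x y := x ≠ y ∧ {x, y} ∈ X.cubes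
  symm := ⟨fun x y h => ⟨h.1.symm, by rw [Set.pair_comm]; exact h.2⟩⟩
  loopless := ⟨fun _ h => h.1 rfl⟩

/-- The link of the vertex `x`. Its vertices are the edges at `x`, recorded through their other
endpoints, and each cube `c` containing `x` contributes the simplex spanned by the edges of `c`
at `x` (the vertex `x` itself contributes the empty simplex). -/
def link (x : V) : Set (Set V) :=
  {N | ∃ c ∈ X.cubes, x ∈ c ∧ N = {a | a ∈ c ∧ X.graph.Adj x a}}

/-- Every link is a flag complex: finitely many vertices of the link which are pairwise joined by
an edge of the link span a simplex of the link. -/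
def LinksFlag : Prop :=
  ∀ (x : V) (N : Set V), N.Finite → (∀ a ∈ N, X.graph.Adj x a) →
    (∀ a ∈ N, ∀ b ∈ N, a ≠ b → {a, b} ∈ X.link x) → N ∈ X.link x

/-- Homotopy of edge paths relative to the endpoints: the congruence generated by inserting or
deleting backtracks and by pushing a path across a square. -/
inductive Homotopic : ∀ {x y : V}, X.graph.Walk x y → X.graph.Walk x y → Prop
  | refl {x y : V} (p : X.graph.Walk x y) : Homotopic p p
  | symm {x y : V} {p q : X.graph.Walk x y} : Homotopic p q → Homotopic q p
  | trans {x y : V} {p q r : X.graph.Walk x y} : Homotopic p q → Homotopic q r → Homotopic p r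
  | cons {x y z : V} (h : X.graph.Adj x y) {p q : X.graph.Walk y z} :
      Homotopic p q → Homotopic (SimpleGraph.Walk.cons h p) (SimpleGraph.Walk.cons h q)
  | backtrack {x y z : V} (h : X.graph.Adj x y) (p : X.graph.Walk x z) :
      Homotopic (SimpleGraph.Walk.cons h (SimpleGraph.Walk.cons h.symm p)) p
  | square {a b c d z : V} (hab : X.graph.Adj a b) (hbc : X.graph.Adj b c)
      (had : X.graph.Adj a d) (hdc : X.graph.Adj d c) (hsq : {a, b, c, d} ∈ X.cubes)
      (p : X.graph.Walk c z) :
      Homotopic (SimpleGraph.Walk.cons hab (SimpleGraph.Walk.cons hbc p))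
        (SimpleGraph.Walk.cons had (SimpleGraph.Walk.cons hdc p))

/-- Nonempty, connected, and with trivial (edge path) fundamental group. -/
def SimplyConnected : Prop :=
  X.graph.Connected ∧
    ∀ (x : V) (p : X.graph.Walk x x), X.Homotopic p SimpleGraph.Walk.nil

/-- A `CAT(0)` cube complex: simply connected, with flag links. -/
structure IsCAT0 : Prop where
  simplyConnected : X.SimplyConnected
  linksFlag : X.LinksFlag

/-! ### Geometric realization and automorphisms -/

open Classical in
/-- The point with coordinates `t ∈ [0,1]^k` of the cube with vertices `φ`, as a formal convex
combination of the vertices of that cube: the vertex `φ ε` has weight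
`∏ i, (t i if ε i = 1, and 1 - t i if ε i = 0)`. The coordinates are recovered from the weights
(`t i` is the total weight of the vertices with `ε i = 1`), and the points of a face of
the cube have the same weights whether computed in the face or in the cube. -/
noncomputable def point {k : ℕ} (φ : (Fin k → Bool) → V) (t : Fin k → ℝ) : V → ℝ :=
  fun x => ∑ ε : Fin k → Bool, if φ ε = x then ∏ i, (if ε i then t i else 1 - t i) else 0

/-- The geometric realization of `X`: the set of all points of all cubes of `X`. -/
def Realization : Type u :=
  {w : V → ℝ // ∃ (k : ℕ) (φ : (Fin k → Bool) → V) (t : Fin k → ℝ),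
    IsCubeChart X.cubes φ ∧ (∀ i, t i ∈ Set.Icc (0 : ℝ) 1) ∧ w = point φ t}

/-- Cubical isometries (automorphisms) of `X`, as permutations of the vertices which map cubes to
cubes, and whose inverses do so as well. -/
def Aut : Subgroup (Equiv.Perm V) where
  carrier := {g | ∀ c : Set V, g '' c ∈ X.cubes ↔ c ∈ X.cubes}
  one_mem' := fun c => by simp
  mul_mem' := by
    intro g h hg hh c
    have : (g * h : Equiv.Perm V) '' c = g '' (h '' c) := by
      rw [Set.image_image]; rfl
    rw [this]
    exact (hg _).trans (hh c)
  inv_mem' := by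
    intro g hg c
    have : g '' ((g⁻¹ : Equiv.Perm V) '' c) = c := by
      rw [Set.image_image]; simp
    rw [← hg, this]

theorem isCubeChart_comp {X : CubeComplex V} (g : X.Aut) {k : ℕ} {φ : (Fin k → Bool) → V}
    (h : IsCubeChart X.cubes φ) : IsCubeChart X.cubes (fun ε => (g : Equiv.Perm V) (φ ε)) := by
  refine ⟨(g : Equiv.Perm V).injective.comp h.1, fun s hs => ?_⟩
  have hs' : s = (g : Equiv.Perm V) '' ((g : Equiv.Perm V) ⁻¹' s) :=
    (Set.image_preimage_eq s (g : Equiv.Perm V).surjective).symm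
  have hsub : (g : Equiv.Perm V) ⁻¹' s ⊆ Set.range φ := by
    intro x hx
    obtain ⟨ε, hε⟩ := hs hx
    exact ⟨ε, (g : Equiv.Perm V).injective hε⟩
  have h1 : s ∈ X.cubes ↔ (g : Equiv.Perm V) ⁻¹' s ∈ X.cubes := by
    conv_lhs => rw [hs']
    exact g.2 _
  rw [h1, h.2 _ hsub]
  refine exists_congr fun F => and_congr_right fun _ => ?_
  have h2 : (fun ε => (g : Equiv.Perm V) (φ ε)) '' F = (g : Equiv.Perm V) '' (φ '' F) := by
    rw [Set.image_image]
  rw [h2]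
  constructor
  · intro e
    rw [← e]
    exact hs'
  · intro e
    rw [e]
    exact Set.preimage_image_eq _ (g : Equiv.Perm V).injective

theorem point_comp (g : Equiv.Perm V) {k : ℕ} (φ : (Fin k → Bool) → V) (t : Fin k → ℝ) :
    (fun x => point φ t (g⁻¹ x)) = point (fun ε => g (φ ε)) t := by
  funext x
  refine Finset.sum_congr rfl fun ε _ => ?_
  have key : φ ε = g⁻¹ x ↔ g (φ ε) = x := Equiv.Perm.eq_inv_iff_eq
  by_cases h : g (φ ε) = x
  · rw [if_pos h, if_pos (key.2 h)]
  · rw [if_neg h, if_neg (fun h' => h (key.1 h'))]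

/-- An automorphism moves the point with coordinates `t` of a cube to the point with the same
coordinates of the image cube. -/
instance : MulAction X.Aut X.Realization where
  smul g w := ⟨fun x => w.1 ((g : Equiv.Perm V)⁻¹ x), by
    obtain ⟨k, φ, t, hφ, ht, hw⟩ := w.2
    exact ⟨k, fun ε => (g : Equiv.Perm V) (φ ε), t, isCubeChart_comp g hφ, ht, by
      rw [hw, point_comp]⟩⟩
  one_smul w := Subtype.ext (funext fun x => rfl)
  mul_smul g h w := Subtype.ext (funext fun x => by
    change w.1 (((g * h : X.Aut) : Equiv.Perm V)⁻¹ x) =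
      w.1 ((h : Equiv.Perm V)⁻¹ ((g : Equiv.Perm V)⁻¹ x))
    rw [Subgroup.coe_mul, mul_inv_rev, Equiv.Perm.mul_apply])

end CubeComplex

/-- Property `FC_n`: every action by cubical isometries on a `CAT(0)` cube complex of dimension at
most `n` fixes a point of the complex. -/
def PropertyFC (n : ℕ) (G : Type v) [Group G] : Prop :=
  ∀ (V : Type u) (X : CubeComplex V), X.IsCAT0 → X.DimLE n →
    ∀ ρ : G →* X.Aut, ∃ p : X.Realization, ∀ g : G, ρ g • p = p

/-! ## Random groups -/

/-- Reduced words of length `L` in the letters `S ∪ S⁻¹`, where `(s, true)` is `s` and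
`(s, false)` is `s⁻¹`. -/
def ReducedWord (S : Type v) (L : ℕ) : Type v :=
  {w : List (S × Bool) // w.length = L ∧ FreeGroup.IsReduced w}

/-- The number `⌊(2n-1)^{dL}⌋` of relators at density `d` and length `L`, where `n = |S|`. -/
noncomputable def numRelators (S : Type v) [Fintype S] (d : ℝ) (L : ℕ) : ℕ :=
  ⌊(2 * (Fintype.card S : ℝ) - 1) ^ (d * (L : ℝ))⌋₊

/-- The possible tuples of relators at density `d` and length `L`. -/
abbrev Relators (S : Type v) [Fintype S] (d : ℝ) (L : ℕ) : Type v :=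
  Fin (numRelators S d L) → ReducedWord S L

/-- The group `⟨S ∣ R⟩` given by a tuple of words. -/
abbrev groupOfRelators {S : Type v} [Fintype S] {d : ℝ} {L : ℕ} (R : Relators S d L) : Type v :=
  PresentedGroup (Set.range fun i => FreeGroup.mk (R i).1)

/-- The probability that the group `⟨S ∣ R⟩` satisfies `Q`, for a uniformly random tuple `R` of
relators at density `d` and length `L`. -/
noncomputable def randomGroupProb (S : Type v) [Fintype S] (d : ℝ) (L : ℕ)
    (Q : ∀ (G : Type v) [Group G], Prop) : ℝ :=
  (Nat.card {R : Relators S d L // Q (groupOfRelators R)} : ℝ) / Nat.card (Relators S d L)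

/-- A random group on the generating set `S` at density `d` satisfies `Q` with overwhelming
probability. -/
def WithOverwhelmingProbability (S : Type v) [Fintype S] (d : ℝ)
    (Q : ∀ (G : Type v) [Group G], Prop) : Prop :=
  Filter.Tendsto (fun L : ℕ => randomGroupProb S d L Q) Filter.atTop (nhds 1)

/-!
Let `n = |S|` and `q = 2n - 1`, fix `0 < δ < min d 1`, and put `τ = q ^ (1 - δ)`. A set of at least
`τ ^ ℓ` words of length `ℓ` which can be concatenated freely produces about `τ ^ L` words of
length `L`, so among `q ^ (d L)` random relators one expects `q ^ ((d - δ) L)` from it. Hence, with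
probability tending to `1`, each of the finitely many such sets with `ℓ` bounded supplies a relator.
If all words of the set moved a halfspace `h` of `X` properly into itself, then so would the
relator, which acts trivially; so fewer than `τ ^ ℓ` words of each bounded length shrink `h`.

Let `H` be the wall of `h`. A word moves `H` to itself, to a wall crossing it, or to a wall on one
side of it, and in the last case it either shrinks `h` or `hᶜ`, or maps one of them into the other.
In dimension `2` no three walls cross pairwise. Therefore, if the last case is rare, almost all
words of a certain length send `H` to one of two walls, and this forces the orbit of `H` to be
finite. So a halfspace with infinite orbit, or its complement, is mapped by many words into its
complement. Two halfspaces of this kind never cover `X` together, since otherwise alternating their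
words would shrink one of them too often. By the Helly property some vertex `y` lies outside all of
them. As they form an invariant family, every wall separating `y` from a translate has a finite
orbit, hence so does `y`. A finite orbit yields an invariant cube, whose barycenter is fixed.
-/

/-! ## Edge paths modulo squares -/

/-- An abstract square complex with 1-skeleton `Γ`: `Sq a b c d` says that `a, b, c, d` are the
consecutive vertices of a square. A square is determined by two consecutive edges (`unique`), and
no three squares are arranged cyclically around a vertex (`not_triangle`). -/
structure SquareSystem {V : Type u} (Γ : SimpleGraph V) (Sq : V → V → V → V → Prop) : Prop where
  rotate : ∀ {a b c d}, Sq a b c d → Sq b c d a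
  reflect : ∀ {a b c d}, Sq a b c d → Sq a d c b
  adj : ∀ {a b c d}, Sq a b c d → Γ.Adj a b
  ne : ∀ {a b c d}, Sq a b c d → a ≠ c
  unique : ∀ {a b c c' d}, Sq a b c d → Sq a b c' d → c = c'
  not_triangle : ∀ {a b c d x y z}, Sq a b x c → Sq a c y d → Sq a b z d → False

/-- Equivalence of edge paths of the same length under pushes across squares. A path is the list
of its vertices, starting from its terminal vertex. The relation is generated so that the last
edges of the two paths either agree or span a square with a common continuation; that it is
transitive is then a theorem, `PathEquiv.trans`. -/
inductive PathEquiv {V : Type u} (Sq : V → V → V → V → Prop) : List V → List V → Prop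
  | single (v : V) : PathEquiv Sq [v] [v]
  | cons (y : V) {p q : List V} : PathEquiv Sq p q → PathEquiv Sq (y :: p) (y :: q)
  | flip {y a u b : V} {p q r : List V} : Sq y a u b → PathEquiv Sq p (a :: u :: r) →
      PathEquiv Sq q (b :: u :: r) → PathEquiv Sq (y :: p) (y :: q)

/-- Up to pushes across squares, the path `y :: l` arrives at `y` through `z`. -/
def Descends {V : Type u} (Sq : V → V → V → V → Prop) (y : V) (l : List V) (z : V) : Prop :=
  ∃ r, PathEquiv Sq (y :: l) (y :: z :: r)

/-- No initial segment of the path is equivalent to a path which backtracks along the next edge. -/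
inductive ReducedPath {V : Type u} (Γ : SimpleGraph V) (Sq : V → V → V → V → Prop) :
    List V → Prop
  | single (v : V) : ReducedPath Γ Sq [v]
  | cons {y a : V} {l : List V} : ReducedPath Γ Sq (a :: l) → Γ.Adj y a →
      ¬ Descends Sq a l y → ReducedPath Γ Sq (y :: a :: l)

open Classical in
/-- The path `y :: l` continued to the vertex `z` is the path `z :: extendPath Sq y l z`: the new
edge is appended, unless it cancels against the last edge of a path equivalent to `y :: l`. -/
noncomputable def extendPath {V : Type u} (Sq : V → V → V → V → Prop) (y : V) (l : List V) (z : V) :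
    List V :=
  if h : Descends Sq y l z then h.choose else y :: l

/-- The path `x :: l` continued along a walk from `x` to `y` is the path
`y :: extendWalk Sq p l`. -/
noncomputable def extendWalk {V : Type u} {Γ : SimpleGraph V} (Sq : V → V → V → V → Prop) :
    ∀ {x y : V}, Γ.Walk x y → List V → List V
  | _, _, .nil, l => l
  | x, _, .cons (v := z) _ p, l => extendWalk Sq p (extendPath Sq x l z)

section Paths

variable {V : Type u} {Γ : SimpleGraph V} {Sq : V → V → V → V → Prop}

namespace PathEquiv

theorem refl : ∀ (y : V) (l : List V), PathEquiv Sq (y :: l) (y :: l)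
  | y, [] => single y
  | y, z :: l => cons y (refl z l)

theorem ne_nil {p q : List V} (h : PathEquiv Sq p q) : p ≠ [] ∧ q ≠ [] := by
  cases h <;> simp

theorem length_eq {p q : List V} (h : PathEquiv Sq p q) : p.length = q.length := by
  induction h with
  | single v => rfl
  | cons y _ ih => rw [List.length_cons, List.length_cons, ih]
  | flip _ _ _ ih₁ ih₂ => simp_all only [List.length_cons]

theorem head_eq {x y : V} {p q : List V} (h : PathEquiv Sq (x :: p) (y :: q)) : x = y := by
  cases h <;> rfl

theorem exists_cons_of_cons {y : V} {p q : List V} (h : PathEquiv Sq (y :: p) q) :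
    ∃ q', q = y :: q' := by
  cases h <;> exact ⟨_, rfl⟩

theorem getLast?_eq {p q : List V} (h : PathEquiv Sq p q) : p.getLast? = q.getLast? := by
  induction h with
  | single v => rfl
  | cons y h ih =>
    rw [List.getLast?_cons_of_ne_nil h.ne_nil.1, List.getLast?_cons_of_ne_nil h.ne_nil.2, ih]
  | flip _ h₁ h₂ ih₁ ih₂ =>
    rw [List.getLast?_cons_of_ne_nil h₁.ne_nil.1, List.getLast?_cons_of_ne_nil h₂.ne_nil.1, ih₁,
      ih₂, List.getLast?_cons_cons, List.getLast?_cons_cons]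

theorem exists_square {y a b : V} {r r' : List V} (hab : a ≠ b)
    (h : PathEquiv Sq (y :: a :: r) (y :: b :: r')) :
    ∃ u s, Sq y a u b ∧ PathEquiv Sq (a :: r) (a :: u :: s) ∧
      PathEquiv Sq (b :: r') (b :: u :: s) := by
  cases h with
  | cons _ h => exact absurd h.head_eq hab
  | flip hs h₁ h₂ =>
    obtain rfl := h₁.head_eq
    obtain rfl := h₂.head_eq
    exact ⟨_, _, hs, h₁, h₂⟩

end PathEquiv

namespace SquareSystem

variable (hS : SquareSystem Γ Sq)
include hS

theorem rotate_back {a b c d : V} (h : Sq a b c d) : Sq d a b c :=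
  hS.rotate (hS.rotate (hS.rotate h))

theorem swap {a b c d : V} (h : Sq a b c d) : Sq c b a d :=
  hS.rotate (hS.rotate (hS.reflect h))

end SquareSystem

namespace PathEquiv

variable (hS : SquareSystem Γ Sq)
include hS

theorem symm {p q : List V} (h : PathEquiv Sq p q) : PathEquiv Sq q p := by
  induction h with
  | single v => exact single v
  | cons y _ ih => exact cons y ih
  | flip hs h₁ h₂ _ _ => exact flip (hS.reflect hs) h₂ h₁

theorem cancel {y a : V} {r r' : List V} (h : PathEquiv Sq (y :: a :: r) (y :: a :: r')) :
    PathEquiv Sq (a :: r) (a :: r') := by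
  cases h with
  | cons _ h => exact h
  | flip hs h₁ h₂ => exact absurd (h₁.head_eq.symm.trans h₂.head_eq) (hS.ne (hS.rotate hs))

/-- Two flips at `y` compose if transitivity is known for shorter paths: the second and third edge
would otherwise belong to three squares arranged cyclically around a vertex. -/
theorem flip_trans_flip {y a u b u' b' : V} {p q s r r' : List V}
    (ih : ∀ {p' q' s' : List V}, p'.length = p.length → PathEquiv Sq p' q' →
      PathEquiv Sq q' s' → PathEquiv Sq p' s')
    (hs : Sq y a u b) (hp : PathEquiv Sq p (a :: u :: r)) (hq : PathEquiv Sq q (b :: u :: r))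
    (hs' : Sq y b u' b') (hq' : PathEquiv Sq q (b :: u' :: r'))
    (hs'' : PathEquiv Sq s (b' :: u' :: r')) : PathEquiv Sq (y :: p) (y :: s) := by
  have hlen : p.length = r.length + 2 := hp.length_eq
  have huu' : PathEquiv Sq (b :: u :: r) (b :: u' :: r') := ih hlen.symm (hq.symm hS) hq'
  by_cases hab : a = b'
  · subst hab
    obtain rfl : u = u' := hS.unique hs (hS.reflect hs')
    have hps : PathEquiv Sq p (a :: u :: r') := ih rfl hp (cons a (huu'.cancel hS))
    exact cons y (ih rfl hps (hs''.symm hS))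
  · have hu : u ≠ u' := by
      rintro rfl
      exact hab (hS.unique (hS.rotate_back hs) (hS.reflect (hS.rotate hs')))
    obtain ⟨_, _, hbu, -, -⟩ := huu'.exists_square hu
    exact (hS.not_triangle hbu (hS.rotate hs') (hS.reflect (hS.rotate_back hs))).elim

theorem trans {p q s : List V} (h₁ : PathEquiv Sq p q) (h₂ : PathEquiv Sq q s) :
    PathEquiv Sq p s := by
  induction hn : p.length generalizing p q s with
  | zero => exact absurd (List.length_eq_zero_iff.1 hn) h₁.ne_nil.1
  | succ n ih =>
  cases h₁ with
  | single v => exact h₂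
  | cons y hpq =>
    rw [List.length_cons, Nat.add_right_cancel_iff] at hn
    cases h₂ with
    | single v => exact absurd rfl hpq.ne_nil.2
    | cons _ hqs => exact cons y (ih hpq hqs hn)
    | flip hs hq hs' => exact flip hs (ih hpq hq hn) hs'
  | flip hs hp hq =>
    rw [List.length_cons, Nat.add_right_cancel_iff] at hn
    cases h₂ with
    | single v => exact absurd rfl hq.ne_nil.1
    | cons _ hqs =>
      have hlen := (hqs.length_eq.symm.trans hq.length_eq).trans hp.length_eq.symm
      exact flip hs hp (ih (hqs.symm hS) hq (hlen.trans hn))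
    | flip hs' hq' hs'' =>
      obtain ⟨_, e⟩ := exists_cons_of_cons (hq.symm hS)
      obtain rfl := (e ▸ hq').head_eq
      subst e
      exact flip_trans_flip hS (fun hl h₁ h₂ => ih h₁ h₂ (hl.trans hn)) hs hp hq hs' hq' hs''

end PathEquiv

namespace SquareSystem

theorem extendPath_of_not_descends {y z : V} {l : List V} (h : ¬ Descends Sq y l z) :
    extendPath Sq y l z = y :: l :=
  dif_neg h

variable (hS : SquareSystem Γ Sq)
include hS

theorem descends_congr {y : V} {p q : List V} (h : PathEquiv Sq (y :: p) (y :: q)) (z : V) :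
    Descends Sq y p z ↔ Descends Sq y q z :=
  ⟨fun ⟨r, h'⟩ => ⟨r, (h.symm hS).trans hS h'⟩, fun ⟨r, h'⟩ => ⟨r, h.trans hS h'⟩⟩

theorem descends_of_square {y a u b : V} {l : List V} (hs : Sq y a u b)
    (h : Descends Sq u l b) : Descends Sq a (u :: l) y :=
  let ⟨r, hr⟩ := h
  ⟨b :: r, .flip (hS.rotate hs) hr (.refl y _)⟩

theorem reducedPath_of_square {y a u b : V} {l : List V} (hs : Sq y a u b)
    (h : ReducedPath Γ Sq (y :: a :: u :: l)) : ReducedPath Γ Sq (y :: b :: u :: l) := by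
  cases h with
  | cons h _ hy =>
  cases h with
  | cons hu _ ha =>
  have hbu : Γ.Adj b u := (hS.adj (hS.rotate (hS.rotate hs))).symm
  refine .cons (.cons hu hbu fun hb => hy (hS.descends_of_square hs hb))
    (hS.adj (hS.reflect hs)) ?_
  rintro ⟨r, hr⟩
  obtain ⟨a', s, ha', hua, -⟩ := hr.exists_square (hS.ne hs).symm
  obtain rfl : a' = a := hS.unique ha' (hS.reflect (hS.rotate_back hs))
  exact ha ⟨_, hua⟩

theorem reducedPath_cons_congr {y : V} {p q : List V} (h : PathEquiv Sq p q)
    (hq : ReducedPath Γ Sq p → ReducedPath Γ Sq q) (hr : ReducedPath Γ Sq (y :: p)) :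
    ReducedPath Γ Sq (y :: q) := by
  cases hr with
  | single => exact absurd rfl h.ne_nil.1
  | cons hp hadj hy =>
    obtain ⟨q, rfl⟩ := h.exists_cons_of_cons
    exact .cons (hq hp) hadj fun hd => hy ((hS.descends_congr h _).2 hd)

theorem reducedPath_congr {p q : List V} (h : PathEquiv Sq p q) :
    ReducedPath Γ Sq p ↔ ReducedPath Γ Sq q := by
  induction h with
  | single v => rfl
  | cons y h ih =>
    exact ⟨hS.reducedPath_cons_congr h ih.1, hS.reducedPath_cons_congr (h.symm hS) ih.2⟩
  | flip hs h₁ h₂ ih₁ ih₂ =>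
    exact ⟨fun hp => hS.reducedPath_cons_congr (h₂.symm hS) ih₂.2 <|
        hS.reducedPath_of_square hs <| hS.reducedPath_cons_congr h₁ ih₁.1 hp,
      fun hq => hS.reducedPath_cons_congr (h₁.symm hS) ih₁.2 <|
        hS.reducedPath_of_square (hS.reflect hs) <| hS.reducedPath_cons_congr h₂ ih₂.1 hq⟩

theorem extendPath_of_equiv {l r : List V} {y z : V} (h : PathEquiv Sq (y :: l) (y :: z :: r)) :
    PathEquiv Sq (z :: extendPath Sq y l z) (z :: r) := by
  have hd : Descends Sq y l z := ⟨r, h⟩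
  rw [extendPath, dif_pos hd]
  exact ((hd.choose_spec.symm hS).trans hS h).cancel hS

theorem extendPath_congr {p q : List V} {y : V} (h : PathEquiv Sq (y :: p) (y :: q)) (z : V) :
    PathEquiv Sq (z :: extendPath Sq y p z) (z :: extendPath Sq y q z) := by
  by_cases hd : Descends Sq y q z
  · obtain ⟨r, hr⟩ := hd
    exact (hS.extendPath_of_equiv (h.trans hS hr)).trans hS ((hS.extendPath_of_equiv hr).symm hS)
  · rw [extendPath_of_not_descends hd,
      extendPath_of_not_descends fun hp => hd ((hS.descends_congr h z).1 hp)]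
    exact .cons z h

theorem reducedPath_extendPath {l : List V} {y z : V} (hl : ReducedPath Γ Sq (y :: l))
    (hyz : Γ.Adj y z) : ReducedPath Γ Sq (z :: extendPath Sq y l z) := by
  by_cases hd : Descends Sq y l z
  · obtain ⟨r, hr⟩ := hd
    rw [hS.reducedPath_congr (hS.extendPath_of_equiv hr)]
    cases (hS.reducedPath_congr hr).1 hl with
    | cons hzr _ _ => exact hzr
  · rw [extendPath_of_not_descends hd]
    exact .cons hl hyz.symm hd

theorem extendPath_backtrack {l : List V} {y : V} (hl : ReducedPath Γ Sq (y :: l)) (z : V) :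
    PathEquiv Sq (y :: extendPath Sq z (extendPath Sq y l z) y) (y :: l) := by
  by_cases hd : Descends Sq y l z
  · obtain ⟨r, hr⟩ := hd
    cases (hS.reducedPath_congr hr).1 hl with
    | cons _ _ hy =>
      have h := hS.extendPath_congr (hS.extendPath_of_equiv hr) y
      rw [extendPath_of_not_descends hy] at h
      exact h.trans hS (hr.symm hS)
  · rw [extendPath_of_not_descends hd]
    exact hS.extendPath_of_equiv (.refl z _)

theorem extendPath_square_of_descends {l : List V} {a b c d : V} (hs : Sq a b c d)
    (hb : Descends Sq a l b) (hd : Descends Sq a l d) :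
    PathEquiv Sq (c :: extendPath Sq b (extendPath Sq a l b) c)
      (c :: extendPath Sq d (extendPath Sq a l d) c) := by
  obtain ⟨r, hb⟩ := hb
  obtain ⟨r', hd⟩ := hd
  obtain ⟨u, s, hu, hbu, hdu⟩ := ((hb.symm hS).trans hS hd).exists_square (hS.ne (hS.rotate hs))
  obtain rfl := hS.unique hu hs
  exact (hS.extendPath_of_equiv ((hS.extendPath_of_equiv hb).trans hS hbu)).trans hS
    ((hS.extendPath_of_equiv ((hS.extendPath_of_equiv hd).trans hS hdu)).symm hS)

theorem extendPath_square_of_descends_of_not {l : List V} {a b c d : V} (hs : Sq a b c d)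
    (hb : Descends Sq a l b) (hd : ¬ Descends Sq a l d) :
    PathEquiv Sq (c :: extendPath Sq b (extendPath Sq a l b) c)
      (c :: extendPath Sq d (extendPath Sq a l d) c) := by
  obtain ⟨r, hb⟩ := hb
  have hc : ¬ Descends Sq b r c := fun ⟨s, hr⟩ =>
    hd ⟨c :: s, hb.trans hS (.flip hs hr (.refl d _))⟩
  have hbc := hS.extendPath_congr (hS.extendPath_of_equiv hb) c
  rw [extendPath_of_not_descends hc] at hbc
  rw [extendPath_of_not_descends hd]
  have hdc : PathEquiv Sq (d :: a :: l) (d :: c :: b :: r) :=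
    .flip (hS.rotate_back hs) hb (.refl c _)
  exact hbc.trans hS ((hS.extendPath_of_equiv hdc).symm hS)

theorem extendPath_square_of_not_descends {l : List V} {a b c d : V} (hs : Sq a b c d)
    (hb : ¬ Descends Sq a l b) (hd : ¬ Descends Sq a l d) :
    PathEquiv Sq (c :: extendPath Sq b (extendPath Sq a l b) c)
      (c :: extendPath Sq d (extendPath Sq a l d) c) := by
  have not_descends : ∀ {b d : V}, Sq a b c d → ¬ Descends Sq a l d →
      ¬ Descends Sq b (a :: l) c := by
    rintro b d hs hd ⟨r, hr⟩
    obtain ⟨u, s, hu, hau, -⟩ := hr.exists_square (hS.ne hs)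
    obtain rfl : u = d := hS.unique hu (hS.reflect (hS.rotate hs))
    exact hd ⟨_, hau⟩
  rw [extendPath_of_not_descends hb, extendPath_of_not_descends hd,
    extendPath_of_not_descends (not_descends hs hd),
    extendPath_of_not_descends (not_descends (hS.reflect hs) hb)]
  exact .flip (hS.swap hs) (.refl b _) (.refl d _)

theorem extendPath_square (l : List V) {a b c d : V} (hs : Sq a b c d) :
    PathEquiv Sq (c :: extendPath Sq b (extendPath Sq a l b) c)
      (c :: extendPath Sq d (extendPath Sq a l d) c) := by
  by_cases hb : Descends Sq a l b <;> by_cases hd : Descends Sq a l d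
  · exact hS.extendPath_square_of_descends hs hb hd
  · exact hS.extendPath_square_of_descends_of_not hs hb hd
  · exact (hS.extendPath_square_of_descends_of_not (hS.reflect hs) hd hb).symm hS
  · exact hS.extendPath_square_of_not_descends hs hb hd

theorem length_extendPath_of_descends {l : List V} {y z : V} (h : Descends Sq y l z) :
    (extendPath Sq y l z).length + 1 = l.length := by
  obtain ⟨r, h⟩ := h
  have hr := (hS.extendPath_of_equiv h).length_eq
  have hl := h.length_eq
  simp only [List.length_cons] at hr hl
  omega

theorem length_extendPath_le (y : V) (l : List V) (z : V) :
    (extendPath Sq y l z).length ≤ l.length + 1 := by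
  by_cases h : Descends Sq y l z
  · have := hS.length_extendPath_of_descends h
    omega
  · rw [extendPath_of_not_descends h, List.length_cons]

theorem getLast?_extendPath (y : V) (l : List V) (z : V) :
    (z :: extendPath Sq y l z).getLast? = (y :: l).getLast? := by
  by_cases h : Descends Sq y l z
  · obtain ⟨r, h⟩ := h
    rw [(hS.extendPath_of_equiv h).getLast?_eq, h.getLast?_eq, List.getLast?_cons_cons]
  · rw [extendPath_of_not_descends h, List.getLast?_cons_cons]

omit hS in
theorem extendWalk_append {x y z : V} (p : Γ.Walk x y) (q : Γ.Walk y z) (l : List V) :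
    extendWalk Sq (p.append q) l = extendWalk Sq q (extendWalk Sq p l) := by
  induction p generalizing l with
  | nil => rfl
  | cons _ _ ih => exact ih q _

theorem extendWalk_congr {x y : V} (p : Γ.Walk x y) {l l' : List V}
    (h : PathEquiv Sq (x :: l) (x :: l')) :
    PathEquiv Sq (y :: extendWalk Sq p l) (y :: extendWalk Sq p l') := by
  induction p generalizing l l' with
  | nil => exact h
  | cons _ _ ih => exact ih (hS.extendPath_congr h _)

theorem reducedPath_extendWalk {x y : V} (p : Γ.Walk x y) {l : List V}
    (hl : ReducedPath Γ Sq (x :: l)) : ReducedPath Γ Sq (y :: extendWalk Sq p l) := by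
  induction p generalizing l with
  | nil => exact hl
  | cons h _ ih => exact ih (hS.reducedPath_extendPath hl h)

theorem getLast?_extendWalk {x y : V} (p : Γ.Walk x y) (l : List V) :
    (y :: extendWalk Sq p l).getLast? = (x :: l).getLast? := by
  induction p generalizing l with
  | nil => rfl
  | cons _ _ ih => exact (ih _).trans (hS.getLast?_extendPath _ _ _)

theorem length_extendWalk_le {x y : V} (p : Γ.Walk x y) (l : List V) :
    (extendWalk Sq p l).length ≤ l.length + p.length := by
  induction p generalizing l with
  | nil => rfl
  | @cons x z _ _ p ih =>
    have := ih (extendPath Sq x l z)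
    have := hS.length_extendPath_le x l z
    rw [extendWalk, SimpleGraph.Walk.length_cons]
    omega

theorem exists_walk_of_reducedPath {x y : V} {l : List V} (hl : ReducedPath Γ Sq (y :: l))
    (hx : (y :: l).getLast? = some x) :
    ∃ p : Γ.Walk x y, p.length = l.length ∧ PathEquiv Sq (y :: extendWalk Sq p []) (y :: l) := by
  induction l generalizing y with
  | nil =>
    obtain rfl : y = x := by simpa only [List.getLast?_singleton, Option.some.injEq] using hx
    exact ⟨.nil, rfl, .single y⟩
  | cons a l ih =>
    cases hl with
    | cons ha hya hy =>
    obtain ⟨w, hw, he⟩ := ih ha (by rwa [List.getLast?_cons_cons] at hx)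
    refine ⟨w.concat hya.symm, by rw [SimpleGraph.Walk.length_concat, hw, List.length_cons], ?_⟩
    rw [SimpleGraph.Walk.concat_eq_append, extendWalk_append]
    have h := hS.extendPath_congr he y
    rwa [extendPath_of_not_descends hy] at h

end SquareSystem

/-! ## The quadrangle condition -/

/-- Walks with the same endpoints develop to equivalent reduced paths. This is how simple
connectedness of the square complex enters the argument. -/
def TrivialHolonomy {V : Type u} (Γ : SimpleGraph V) (Sq : V → V → V → V → Prop) : Prop :=
  ∀ {x y : V} (p q : Γ.Walk x y), PathEquiv Sq (y :: extendWalk Sq p []) (y :: extendWalk Sq q [])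

/-- A connected bipartite graph `Γ` whose squares `Sq` satisfy the quadrangle condition: two
neighbours of `a` which are closer to `v` span a square with `a` and a vertex at distance two less
from `v`. These are the metric properties of a two-dimensional `CAT(0)` cube complex from which its
hyperplane theory is derived. -/
structure SquareComplexGraph {V : Type u} (Γ : SimpleGraph V) (Sq : V → V → V → V → Prop) : Prop
    extends SquareSystem Γ Sq where
  connected : Γ.Connected
  dist_ne : ∀ (v : V) {a b : V}, Γ.Adj a b → Γ.dist v a ≠ Γ.dist v b
  quadrangle : ∀ (v : V) {a b d : V}, Γ.Adj a b → Γ.Adj a d → b ≠ d →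
    Γ.dist v b < Γ.dist v a → Γ.dist v d < Γ.dist v a →
    ∃ c, Sq a b c d ∧ Γ.dist v c + 2 = Γ.dist v a

namespace SquareSystem

variable (hS : SquareSystem Γ Sq) (hc : Γ.Connected) (hh : TrivialHolonomy Γ Sq)
include hS hc

theorem exists_reducedPath (x y : V) :
    ∃ l, ReducedPath Γ Sq (y :: l) ∧ (y :: l).getLast? = some x := by
  obtain ⟨p⟩ := hc.preconnected x y
  exact ⟨extendWalk Sq p [], hS.reducedPath_extendWalk p (.single x), hS.getLast?_extendWalk p []⟩

include hh

theorem length_of_reducedPath {x y : V} {l : List V} (hl : ReducedPath Γ Sq (y :: l))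
    (hx : (y :: l).getLast? = some x) : l.length = Γ.dist x y := by
  obtain ⟨p, hp, hpl⟩ := hS.exists_walk_of_reducedPath hl hx
  obtain ⟨q, hq⟩ := hc.exists_walk_length_eq_dist x y
  refine le_antisymm ?_ (hp ▸ SimpleGraph.dist_le p)
  have hlq := (hpl.symm hS |>.trans hS (hh p q)).length_eq
  have hq' := hS.length_extendWalk_le q []
  simp only [List.length_cons, List.length_nil] at hlq hq'
  omega

theorem dist_of_descends {x a b : V} {l : List V} (hl : ReducedPath Γ Sq (a :: l))
    (hx : (a :: l).getLast? = some x) (hab : Γ.Adj a b) (hd : Descends Sq a l b) :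
    Γ.dist x b + 1 = Γ.dist x a := by
  rw [← hS.length_of_reducedPath hc hh hl hx, ← hS.length_of_reducedPath hc hh
    (hS.reducedPath_extendPath hl hab) ((hS.getLast?_extendPath _ _ _).trans hx)]
  exact hS.length_extendPath_of_descends hd

theorem dist_of_not_descends {x a b : V} {l : List V} (hl : ReducedPath Γ Sq (a :: l))
    (hx : (a :: l).getLast? = some x) (hab : Γ.Adj a b) (hd : ¬ Descends Sq a l b) :
    Γ.dist x b = Γ.dist x a + 1 := by
  rw [← hS.length_of_reducedPath hc hh hl hx, ← hS.length_of_reducedPath hc hh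
    (.cons hl hab.symm hd) (by rwa [List.getLast?_cons_cons]), List.length_cons]

theorem dist_ne_of_adj (v : V) {a b : V} (hab : Γ.Adj a b) : Γ.dist v a ≠ Γ.dist v b := by
  obtain ⟨l, hl, hv⟩ := hS.exists_reducedPath hc v a
  by_cases hd : Descends Sq a l b
  · have := hS.dist_of_descends hc hh hl hv hab hd
    omega
  · have := hS.dist_of_not_descends hc hh hl hv hab hd
    omega

theorem quadrangle (v : V) {a b d : V} (hab : Γ.Adj a b) (had : Γ.Adj a d) (hbd : b ≠ d)
    (hb : Γ.dist v b < Γ.dist v a) (hd : Γ.dist v d < Γ.dist v a) :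
    ∃ c, Sq a b c d ∧ Γ.dist v c + 2 = Γ.dist v a := by
  obtain ⟨l, hl, hv⟩ := hS.exists_reducedPath hc v a
  have descends : ∀ {e : V}, Γ.Adj a e → Γ.dist v e < Γ.dist v a → Descends Sq a l e := by
    intro e hae he
    by_contra hd
    have := hS.dist_of_not_descends hc hh hl hv hae hd
    omega
  obtain ⟨r, hr⟩ := descends hab hb
  obtain ⟨r', hr'⟩ := descends had hd
  obtain ⟨c, s, hsq, hbc, -⟩ := ((hr.symm hS).trans hS hr').exists_square hbd
  have habc : PathEquiv Sq (a :: l) (a :: b :: c :: s) := hr.trans hS (.cons a hbc)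
  refine ⟨c, hsq, ?_⟩
  have hcs : ReducedPath Γ Sq (c :: s) := by
    cases (hS.reducedPath_congr habc).1 hl with
    | cons h _ _ => cases h with
      | cons h _ _ => exact h
  have hv' : (c :: s).getLast? = some v := by
    rw [← hv, habc.getLast?_eq, List.getLast?_cons_cons, List.getLast?_cons_cons]
  rw [← hS.length_of_reducedPath hc hh hl hv, ← hS.length_of_reducedPath hc hh hcs hv']
  exact (Nat.succ_injective habc.length_eq).symm

theorem squareComplexGraph : SquareComplexGraph Γ Sq :=
  { hS with
    connected := hc
    dist_ne := fun v _ _ hab => hS.dist_ne_of_adj hc hh v hab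
    quadrangle := fun v _ _ _ => hS.quadrangle hc hh v }

end SquareSystem

end Paths

/-! ## Two-dimensional `CAT(0)` cube complexes -/

theorem IsCubeFace.pair_update {k : ℕ} (ε : Fin k → Bool) (i : Fin k) :
    IsCubeFace {ε, Function.update ε i (!ε i)} := by
  refine ⟨fun j => if j = i then none else some (ε j), ?_⟩
  ext δ
  have agree_off : (∀ j b, (if j = i then none else some (ε j)) = some b → δ j = b) ↔
      ∀ j, j ≠ i → δ j = ε j := by
    refine ⟨fun h j hj => h j (ε j) (if_neg hj), fun h j b hb => ?_⟩
    split_ifs at hb with hj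
    exact (h j hj).trans (Option.some_injective _ hb)
  simp only [Set.mem_insert_iff, Set.mem_singleton_iff, Set.mem_ofPred_eq, agree_off,
    Function.eq_update_iff]
  constructor
  · rintro (rfl | ⟨-, h⟩)
    · exact fun _ _ => rfl
    · exact h
  · intro h
    rcases eq_or_ne (δ i) (ε i) with hi | hi
    · exact .inl (funext fun j => (eq_or_ne j i).elim (fun hj => hj ▸ hi) (h j))
    · exact .inr ⟨by rwa [Bool.eq_not_iff], h⟩

theorem IsCubeFace.exists_eq_update {k : ℕ} {ε ε' : Fin k → Bool} (hne : ε ≠ ε')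
    (h : IsCubeFace {ε, ε'}) : ∃ i, ε' = Function.update ε i (!ε i) := by
  obtain ⟨p, hp⟩ := h
  obtain ⟨i, hi⟩ := Function.ne_iff.1 hne
  have hε : ∀ j b, p j = some b → ε j = b := hp.subset (Set.mem_insert ε {ε'})
  have hε' : ∀ j b, p j = some b → ε' j = b := hp.subset (Set.mem_insert_of_mem ε rfl)
  have hmem : Function.update ε i (!ε i) ∈ ({ε, ε'} : Set (Fin k → Bool)) := by
    rw [hp]
    intro j b hj
    rcases eq_or_ne j i with rfl | hji
    · exact absurd ((hε j b hj).trans (hε' j b hj).symm) hi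
    · rw [Function.update_of_ne hji]
      exact hε j b hj
  rcases hmem with h | h
  · exact absurd (congrFun h i) (by rw [Function.update_self]; exact Bool.not_ne_self _)
  · exact ⟨i, h.symm⟩

namespace CubeComplex

variable {V : Type u} {X : CubeComplex V}

theorem adj_chart_iff {k : ℕ} {φ : (Fin k → Bool) → V} (hφ : IsCubeChart X.cubes φ)
    (ε ε' : Fin k → Bool) :
    X.graph.Adj (φ ε) (φ ε') ↔ ∃ i, ε' = Function.update ε i (!ε i) := by
  have mem_cubes_iff : {φ ε, φ ε'} ∈ X.cubes ↔ IsCubeFace {ε, ε'} := by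
    rw [← Set.image_pair, hφ.2 _ (Set.image_subset_range _ _)]
    exact ⟨fun ⟨F, hF, h⟩ => hφ.1.image_injective h ▸ hF, fun h => ⟨_, h, rfl⟩⟩
  constructor
  · rintro ⟨hne, hc⟩
    exact (mem_cubes_iff.1 hc).exists_eq_update (ne_of_apply_ne φ hne)
  · rintro ⟨i, rfl⟩
    refine ⟨fun h => ?_, mem_cubes_iff.2 (.pair_update ε i)⟩
    have hi := congrFun (hφ.1 h) i
    rw [Function.update_self] at hi
    exact Bool.not_ne_self _ hi.symm

theorem ncard_neighbors_chart {k : ℕ} {φ : (Fin k → Bool) → V} (hφ : IsCubeChart X.cubes φ)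
    (ε : Fin k → Bool) : {x | x ∈ Set.range φ ∧ X.graph.Adj (φ ε) x}.ncard = k := by
  have neighbors_eq : {x | x ∈ Set.range φ ∧ X.graph.Adj (φ ε) x} =
      Set.range fun i => φ (Function.update ε i (!ε i)) := by
    ext x
    constructor
    · rintro ⟨⟨ε', rfl⟩, h⟩
      obtain ⟨i, rfl⟩ := (adj_chart_iff hφ _ _).1 h
      exact ⟨i, rfl⟩
    · rintro ⟨i, rfl⟩
      exact ⟨⟨_, rfl⟩, (adj_chart_iff hφ _ _).2 ⟨i, rfl⟩⟩
  have hinj : Function.Injective fun i => φ (Function.update ε i (!ε i)) := by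
    intro i j hij
    by_contra hne
    have hi := congrFun (hφ.1 hij) i
    rw [Function.update_self, Function.update_of_ne hne] at hi
    exact Bool.not_ne_self _ hi
  rw [neighbors_eq, ← Set.image_univ, Set.ncard_image_of_injective _ hinj, Set.ncard_univ,
    Nat.card_eq_fintype_card, Fintype.card_fin]

theorem ncard_range_chart {k : ℕ} {φ : (Fin k → Bool) → V} (hφ : IsCubeChart X.cubes φ) :
    (Set.range φ).ncard = 2 ^ k := by
  rw [← Set.image_univ, Set.ncard_image_of_injective _ hφ.1, Set.ncard_univ,
    Nat.card_eq_fintype_card, Fintype.card_fun, Fintype.card_bool, Fintype.card_fin]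

theorem triple_notMem_cubes {a b c : V} (hab : a ≠ b) (hac : a ≠ c) (hbc : b ≠ c) :
    {a, b, c} ∉ X.cubes := by
  intro h
  obtain ⟨k, φ, hφ, hr⟩ := X.exists_chart _ h
  have hk := ncard_range_chart hφ
  rw [hr, Set.ncard_eq_three.2 ⟨a, b, c, hab, hac, hbc, rfl⟩] at hk
  rcases k with _ | k <;> omega

theorem LinksFlag.not_pairwise_mem_link (hX : X.LinksFlag) (hd : X.DimLE 2) {a b c d : V}
    (hab : X.graph.Adj a b) (hac : X.graph.Adj a c) (had : X.graph.Adj a d)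
    (hbc : b ≠ c) (hcd : c ≠ d) (hbd : b ≠ d)
    (kbc : {b, c} ∈ X.link a) (kcd : {c, d} ∈ X.link a) (kbd : {b, d} ∈ X.link a) : False := by
  have hadj : ∀ e ∈ ({b, c, d} : Set V), X.graph.Adj a e := by
    rintro e (rfl | rfl | rfl) <;> assumption
  have hpairs : ∀ e ∈ ({b, c, d} : Set V), ∀ f ∈ ({b, c, d} : Set V), e ≠ f →
      {e, f} ∈ X.link a := by
    rintro e (rfl | rfl | rfl) f (rfl | rfl | rfl) hef <;>
      first | exact absurd rfl hef | assumption | (rw [Set.pair_comm]; assumption)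
  obtain ⟨s, hs, has, hN⟩ := hX a {b, c, d} (by simp) hadj hpairs
  obtain ⟨k, φ, hφ, rfl⟩ := X.exists_chart _ hs
  obtain ⟨ε, rfl⟩ := has
  have hk := ncard_neighbors_chart hφ ε
  rw [← hN, Set.ncard_eq_three.2 ⟨b, c, d, hbc, hbd, hcd, rfl⟩] at hk
  have := hd k φ hφ
  omega

/-- `a, b, c, d` are the consecutive vertices of a square of `X`. -/
def IsSquare (X : CubeComplex V) (a b c d : V) : Prop :=
  X.graph.Adj a b ∧ X.graph.Adj b c ∧ X.graph.Adj c d ∧ X.graph.Adj d a ∧ a ≠ c ∧ b ≠ d ∧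
    {a, b, c, d} ∈ X.cubes

namespace IsSquare

theorem rotate {a b c d : V} (h : X.IsSquare a b c d) : X.IsSquare b c d a := by
  obtain ⟨hab, hbc, hcd, hda, hac, hbd, hs⟩ := h
  refine ⟨hbc, hcd, hda, hab, hbd, hac.symm, ?_⟩
  rwa [show ({b, c, d, a} : Set V) = {a, b, c, d} by grind]

theorem reflect {a b c d : V} (h : X.IsSquare a b c d) : X.IsSquare a d c b := by
  obtain ⟨hab, hbc, hcd, hda, hac, hbd, hs⟩ := h
  refine ⟨hda.symm, hcd.symm, hbc.symm, hab.symm, hac, hbd.symm, ?_⟩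
  rwa [show ({a, d, c, b} : Set V) = {a, b, c, d} by grind]

theorem unique {a b c c' d : V} (h : X.IsSquare a b c d) (h' : X.IsSquare a b c' d) :
    c = c' := by
  obtain ⟨hab, -, -, hda, -, hbd, hs⟩ := h
  obtain ⟨-, -, -, -, -, -, hs'⟩ := h'
  by_contra hcc
  have hinter := X.inter_mem _ hs _ hs' ⟨a, by simp, by simp⟩
  rw [show ({a, b, c, d} ∩ {a, b, c', d} : Set V) = {a, b, d} by grind] at hinter
  exact triple_notMem_cubes hab.ne hda.ne.symm hbd hinter

theorem pair_mem_link {a b c d : V} (h : X.IsSquare a b c d) : {b, d} ∈ X.link a := by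
  obtain ⟨hab, hbc, hcd, hda, hac, hbd, hs⟩ := h
  refine ⟨_, hs, by simp, ?_⟩
  obtain ⟨k, φ, hφ, hr⟩ := X.exists_chart _ hs
  obtain rfl : k = 2 := by
    have hk := ncard_range_chart hφ
    rw [hr, Set.ncard_insert_of_notMem (by simp [hab.ne, hac, hda.ne.symm]),
      Set.ncard_eq_three.2 ⟨b, c, d, hbc.ne, hbd, hcd.ne, rfl⟩] at hk
    exact Nat.pow_right_injective le_rfl hk.symm
  obtain ⟨ε, rfl⟩ : a ∈ Set.range φ := by simp [hr]
  have hcard := ncard_neighbors_chart hφ ε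
  have hfin : {x | x ∈ Set.range φ ∧ X.graph.Adj (φ ε) x}.Finite :=
    (Set.finite_range φ).subset fun x hx => hx.1
  rw [hr] at hcard hfin
  refine Set.eq_of_subset_of_ncard_le ?_ (by rw [hcard, Set.ncard_pair hbd]) hfin
  rintro x (rfl | rfl)
  · exact ⟨by simp, hab⟩
  · exact ⟨by simp, hda.symm⟩

end IsSquare

theorem squareSystem (hX : X.LinksFlag) (hd : X.DimLE 2) :
    SquareSystem X.graph X.IsSquare where
  rotate := IsSquare.rotate
  reflect := IsSquare.reflect
  adj := And.left
  ne h := h.2.2.2.2.1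
  unique := IsSquare.unique
  not_triangle := fun hbc hcd hbd =>
    hX.not_pairwise_mem_link hd hbc.1 hcd.1 hcd.reflect.1 hbc.2.2.2.2.2.1 hcd.2.2.2.2.2.1
      hbd.2.2.2.2.2.1 hbc.pair_mem_link hcd.pair_mem_link hbd.pair_mem_link

theorem isSquare_of_mem_cubes {a b c d : V} (hab : X.graph.Adj a b) (hbc : X.graph.Adj b c)
    (had : X.graph.Adj a d) (hdc : X.graph.Adj d c) (hs : {a, b, c, d} ∈ X.cubes) (hbd : b ≠ d) :
    X.IsSquare a b c d := by
  refine ⟨hab, hbc, hdc.symm, had.symm, ?_, hbd, hs⟩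
  rintro rfl
  rw [show ({a, b, a, d} : Set V) = {a, b, d} by grind] at hs
  exact triple_notMem_cubes hab.ne had.ne hbd hs

variable (hS : SquareSystem X.graph X.IsSquare)
include hS

theorem Homotopic.extendWalk_equiv {x y : V} {p q : X.graph.Walk x y} (h : X.Homotopic p q)
    {l : List V} (hl : ReducedPath X.graph X.IsSquare (x :: l)) :
    PathEquiv X.IsSquare (y :: extendWalk X.IsSquare p l) (y :: extendWalk X.IsSquare q l) := by
  induction h generalizing l with
  | refl p => exact .refl _ _
  | symm _ ih => exact (ih hl).symm hS
  | trans _ _ ih₁ ih₂ => exact (ih₁ hl).trans hS (ih₂ hl)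
  | cons h _ ih => exact ih (hS.reducedPath_extendPath hl h)
  | backtrack _ p => exact hS.extendWalk_congr p (hS.extendPath_backtrack hl _)
  | @square a b c d _ hab hbc had hdc hs p =>
    refine hS.extendWalk_congr p ?_
    rcases eq_or_ne b d with rfl | hbd
    · exact .refl _ _
    · exact hS.extendPath_square l (isSquare_of_mem_cubes hab hbc had hdc hs hbd)

theorem SimplyConnected.trivialHolonomy (hX : X.SimplyConnected) :
    TrivialHolonomy X.graph X.IsSquare := by
  intro x y p q
  have hloop_x := Homotopic.extendWalk_equiv hS (hX.2 x (p.append q.reverse)) (.single x)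
  have hloop_y := Homotopic.extendWalk_equiv hS (hX.2 y (q.reverse.append q))
    (hS.reducedPath_extendWalk p (.single x))
  have hpq := hS.extendWalk_congr q hloop_x
  rw [SquareSystem.extendWalk_append] at hpq hloop_y
  exact (hloop_y.symm hS).trans hS hpq

omit hS in
theorem IsCAT0.squareComplexGraph (hX : X.IsCAT0) (hd : X.DimLE 2) :
    SquareComplexGraph X.graph X.IsSquare :=
  have hS := squareSystem hX.linksFlag hd
  hS.squareComplexGraph hX.simplyConnected.1 (hX.simplyConnected.trivialHolonomy hS)

end CubeComplex

/-! ## Halfspaces -/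

/-- The halfspace bounded by the edge from `a` to `b`: the vertices closer to `b` than to `a`. -/
def halfspace {V : Type u} (Γ : SimpleGraph V) (a b : V) : Set V :=
  {v | Γ.dist v b < Γ.dist v a}

/-- The halfspaces of a graph; each edge bounds two of them, one for each orientation. -/
def halfspaces {V : Type u} (Γ : SimpleGraph V) : Set (Set V) :=
  {h | ∃ a b, Γ.Adj a b ∧ h = halfspace Γ a b}

/-- A set of vertices which contains all geodesics between its points. -/
def GeodesicallyConvex {V : Type u} (Γ : SimpleGraph V) (C : Set V) : Prop :=
  ∀ x ∈ C, ∀ y ∈ C, ∀ e, Γ.dist x e + Γ.dist e y = Γ.dist x y → e ∈ C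

/-- Two halfspaces cross if all four intersections of their sides are nonempty. -/
def Crosses {V : Type u} (h k : Set V) : Prop :=
  (h ∩ k).Nonempty ∧ (h ∩ kᶜ).Nonempty ∧ (hᶜ ∩ k).Nonempty ∧ (hᶜ ∩ kᶜ).Nonempty

/-- The vertices outside `h` which have a neighbour in `h`. -/
def outerBoundary {V : Type u} (Γ : SimpleGraph V) (h : Set V) : Set V :=
  {p | p ∉ h ∧ ∃ q ∈ h, Γ.Adj p q}

section Halfspaces

variable {V : Type u} {Γ : SimpleGraph V}

theorem Crosses.ne {h k : Set V} (hc : Crosses h k) : h ≠ k := by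
  rintro rfl
  obtain ⟨x, hx, hx'⟩ := hc.2.1
  exact hx' hx

theorem GeodesicallyConvex.inter {C D : Set V} (hC : GeodesicallyConvex Γ C)
    (hD : GeodesicallyConvex Γ D) : GeodesicallyConvex Γ (C ∩ D) :=
  fun x hx y hy e he => ⟨hC x hx.1 y hy.1 e he, hD x hx.2 y hy.2 e he⟩

theorem GeodesicallyConvex.biInter {S : Set (Set V)}
    (hS : ∀ s ∈ S, GeodesicallyConvex Γ s) : GeodesicallyConvex Γ (⋂ s ∈ S, s) := by
  intro x hx y hy e he
  simp only [Set.mem_iInter] at *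
  exact fun s hs => hS s hs x (hx s hs) y (hy s hs) e he

theorem mem_halfspace {a b v : V} : v ∈ halfspace Γ a b ↔ Γ.dist v b < Γ.dist v a :=
  Iff.rfl

theorem mem_halfspace_right {a b : V} (h : Γ.Adj a b) : b ∈ halfspace Γ a b := by
  rw [mem_halfspace, SimpleGraph.dist_self, SimpleGraph.dist_eq_one_iff_adj.2 h.symm]
  exact Nat.one_pos

theorem notMem_halfspace_left (a b : V) : a ∉ halfspace Γ a b := by
  rw [mem_halfspace, SimpleGraph.dist_self]
  exact Nat.not_lt_zero _

namespace SquareComplexGraph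

variable {Sq : V → V → V → V → Prop} (hG : SquareComplexGraph Γ Sq)
include hG

theorem dist_right_of_adj (v : V) {a b : V} (h : Γ.Adj a b) :
    Γ.dist v b = Γ.dist v a + 1 ∨ Γ.dist v b + 1 = Γ.dist v a := by
  have hne := hG.dist_ne v h
  have hab := hG.connected.dist_triangle (u := v) (v := a) (w := b)
  have hba := hG.connected.dist_triangle (u := v) (v := b) (w := a)
  rw [SimpleGraph.dist_eq_one_iff_adj.2 h] at hab
  rw [SimpleGraph.dist_eq_one_iff_adj.2 h.symm] at hba
  omega

theorem dist_left_of_adj (v : V) {a b : V} (h : Γ.Adj a b) :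
    Γ.dist b v = Γ.dist a v + 1 ∨ Γ.dist b v + 1 = Γ.dist a v := by
  rw [Γ.dist_comm (u := b), Γ.dist_comm (u := a)]
  exact hG.dist_right_of_adj v h

theorem exists_adj_closer {x y : V} (h : x ≠ y) :
    ∃ z, Γ.Adj x z ∧ Γ.dist z y + 1 = Γ.dist x y := by
  obtain ⟨p, hp⟩ := hG.connected.exists_walk_length_eq_dist x y
  cases p with
  | nil => exact absurd rfl h
  | @cons _ z _ hxz q =>
    refine ⟨z, hxz, ?_⟩
    have hzy := SimpleGraph.dist_le q
    have hstep := hG.dist_left_of_adj y hxz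
    rw [SimpleGraph.Walk.length_cons] at hp
    omega

theorem compl_halfspace {a b : V} (h : Γ.Adj a b) : (halfspace Γ a b)ᶜ = halfspace Γ b a := by
  ext v
  have := hG.dist_right_of_adj v h
  rw [Set.mem_compl_iff, mem_halfspace, mem_halfspace]
  omega

theorem compl_mem_halfspaces {h : Set V} (hh : h ∈ halfspaces Γ) : hᶜ ∈ halfspaces Γ := by
  obtain ⟨a, b, hab, rfl⟩ := hh
  exact ⟨b, a, hab.symm, hG.compl_halfspace hab⟩

theorem halfspace_eq_of_square {a b c d : V} (hs : Sq a b c d) :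
    halfspace Γ a b = halfspace Γ d c := by
  ext v
  have hab := hG.adj hs
  have hbc := hG.adj (hG.rotate hs)
  have hcd := hG.adj (hG.rotate (hG.rotate hs))
  have hda := hG.adj (hG.rotate (hG.rotate (hG.rotate hs)))
  have far_a : Γ.dist v b < Γ.dist v a → Γ.dist v d < Γ.dist v a →
      Γ.dist v c + 2 = Γ.dist v a := by
    intro hb hd
    obtain ⟨e, he, hve⟩ := hG.quadrangle v hab hda.symm (hG.ne (hG.rotate hs)) hb hd
    rwa [hG.unique hs he]
  have far_b : Γ.dist v a < Γ.dist v b → Γ.dist v c < Γ.dist v b →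
      Γ.dist v d + 2 = Γ.dist v b := by
    intro ha hc
    obtain ⟨e, he, hve⟩ := hG.quadrangle v hab.symm hbc (hG.ne hs) ha hc
    rwa [hG.unique (hG.reflect (hG.rotate hs)) he]
  have := hG.dist_right_of_adj v hab
  have := hG.dist_right_of_adj v hbc
  have := hG.dist_right_of_adj v hcd
  have := hG.dist_right_of_adj v hda
  rw [mem_halfspace, mem_halfspace]
  omega

theorem exists_square_of_crossing {a b p q : V} (hab : Γ.Adj a b) (hpq : Γ.Adj p q)
    (hp : p ∈ halfspace Γ a b) (hq : q ∉ halfspace Γ a b) (hpb : p ≠ b) :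
    ∃ p' q', Sq p q q' p' ∧ p' ∈ halfspace Γ a b ∧ q' ∉ halfspace Γ a b ∧
      Γ.dist p' b + 1 = Γ.dist p b := by
  obtain ⟨p', hpp', hp'⟩ := hG.exists_adj_closer hpb
  rw [mem_halfspace] at hp hq
  have := hG.dist_right_of_adj p hab
  have := hG.dist_right_of_adj q hab
  have := hG.dist_right_of_adj p' hab
  have := hG.dist_left_of_adj a hpq
  have := hG.dist_left_of_adj b hpq
  have := hG.dist_left_of_adj a hpp'
  have hqp' : q ≠ p' := by
    rintro rfl
    omega
  obtain ⟨q', hs, hq'⟩ := hG.quadrangle a hpq hpp' hqp'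
    (by rw [Γ.dist_comm (u := a), Γ.dist_comm (u := a)]; omega)
    (by rw [Γ.dist_comm (u := a), Γ.dist_comm (u := a)]; omega)
  rw [Γ.dist_comm (u := a), Γ.dist_comm (u := a)] at hq'
  have := hG.dist_left_of_adj b (hG.adj (hG.rotate hs))
  have := hG.dist_right_of_adj q' hab
  refine ⟨p', q', hs, ?_, ?_, hp'⟩ <;> rw [mem_halfspace] <;> omega

theorem halfspace_eq_of_crossing {a b p q : V} (hab : Γ.Adj a b) (hpq : Γ.Adj p q)
    (hp : p ∈ halfspace Γ a b) (hq : q ∉ halfspace Γ a b) :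
    halfspace Γ a b = halfspace Γ q p := by
  induction hn : Γ.dist p b generalizing p q with
  | zero =>
    obtain rfl : p = b := hG.connected.dist_eq_zero_iff.1 hn
    have hqa := hG.dist_right_of_adj q hab
    rw [mem_halfspace] at hq
    rw [SimpleGraph.dist_eq_one_iff_adj.2 hpq.symm] at hqa hq
    obtain rfl : q = a := hG.connected.dist_eq_zero_iff.1 (by omega)
    rfl
  | succ n ih =>
    have hpb : p ≠ b := by
      rintro rfl
      exact absurd (SimpleGraph.dist_self.symm.trans hn) (by omega)
    obtain ⟨p', q', hs, hp', hq', hd⟩ := hG.exists_square_of_crossing hab hpq hp hq hpb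
    rw [ih (hG.adj (hG.rotate (hG.rotate hs))).symm hp' hq' (by omega)]
    exact (hG.halfspace_eq_of_square (hG.reflect (hG.rotate hs))).symm

theorem eq_halfspace_of_crossing {h : Set V} (hh : h ∈ halfspaces Γ) {p q : V}
    (hpq : Γ.Adj p q) (hp : p ∈ h) (hq : q ∉ h) : h = halfspace Γ q p := by
  obtain ⟨a, b, hab, rfl⟩ := hh
  exact hG.halfspace_eq_of_crossing hab hpq hp hq

theorem exists_crossing_edge (h : Set V) {e x : V} (he : e ∉ h) (hx : x ∈ h) :
    ∃ q p, Γ.Adj q p ∧ q ∉ h ∧ p ∈ h ∧ Γ.dist e q + 1 + Γ.dist p x = Γ.dist e x := by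
  induction hn : Γ.dist e x generalizing e with
  | zero => exact absurd (hG.connected.dist_eq_zero_iff.1 hn ▸ hx) he
  | succ n ih =>
    have hex : e ≠ x := by
      rintro rfl
      exact he hx
    obtain ⟨z, hez, hz⟩ := hG.exists_adj_closer hex
    by_cases hzh : z ∈ h
    · exact ⟨e, z, hez, he, hzh, by rw [SimpleGraph.dist_self]; omega⟩
    · obtain ⟨q, p, hqp, hq, hp, hd⟩ := ih hzh (by omega)
      refine ⟨q, p, hqp, hq, hp, ?_⟩
      have := hG.dist_left_of_adj q hez
      have heqx := hG.connected.dist_triangle (u := e) (v := q) (w := x)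
      have hqpx := hG.connected.dist_triangle (u := q) (v := p) (w := x)
      rw [SimpleGraph.dist_eq_one_iff_adj.2 hqp] at hqpx
      omega

theorem convex_halfspace {h : Set V} (hh : h ∈ halfspaces Γ) : GeodesicallyConvex Γ h := by
  intro x hx y hy e he
  by_contra heh
  obtain ⟨q, p, hqp, hq, hp, hd⟩ := hG.exists_crossing_edge h heh hx
  rw [hG.eq_halfspace_of_crossing hh hqp.symm hp hq, mem_halfspace] at hy
  have := hG.connected.dist_triangle (u := y) (v := p) (w := x)
  have := hG.connected.dist_triangle (u := y) (v := e) (w := q)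
  have := Γ.dist_comm (u := x) (v := e)
  have := Γ.dist_comm (u := e) (v := y)
  have := Γ.dist_comm (u := x) (v := y)
  omega

theorem mem_of_square {C : Set V} (hC : GeodesicallyConvex Γ C) {a b c d : V}
    (hs : Sq a b c d) (hb : b ∈ C) (hd : d ∈ C) : c ∈ C := by
  have hcd := hG.adj (hG.rotate (hG.rotate hs))
  have hbc_one := SimpleGraph.dist_eq_one_iff_adj.2 (hG.adj (hG.rotate hs))
  have hcd_one := SimpleGraph.dist_eq_one_iff_adj.2 hcd
  refine hC b hb d hd c ?_
  have := hG.dist_right_of_adj b hcd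
  have := hG.connected.pos_dist_of_ne (hG.ne (hG.rotate hs))
  omega

theorem dist_eq_add_of_forall_dist_le {C : Set V} (hC : GeodesicallyConvex Γ C) {y z : V}
    (hz : z ∈ C) (hmin : ∀ w ∈ C, Γ.dist y z ≤ Γ.dist y w) {w : V} (hw : w ∈ C) :
    Γ.dist y w = Γ.dist y z + Γ.dist z w := by
  induction hn : Γ.dist z w using Nat.strong_induction_on generalizing w with
  | _ n ih =>
  rcases eq_or_ne w z with rfl | hwz
  · rw [← hn, SimpleGraph.dist_self, add_zero]
  have exists_next : ∀ {u : V}, u ∈ C → u ≠ z →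
      ∃ u' ∈ C, Γ.Adj u u' ∧ Γ.dist z u' + 1 = Γ.dist z u := by
    intro u hu huz
    obtain ⟨u', huu', hu'⟩ := hG.exists_adj_closer huz
    refine ⟨u', hC u hu z hz u' ?_, huu', by rwa [Γ.dist_comm, Γ.dist_comm (u := z)]⟩
    rw [SimpleGraph.dist_eq_one_iff_adj.2 huu', add_comm, hu']
  obtain ⟨a, haC, hwa, ha⟩ := exists_next hw hwz
  have hya := ih _ (by omega) haC rfl
  refine (hG.dist_right_of_adj y hwa.symm).elim (fun _ => by omega) fun hyw => ?_
  have := hmin w hw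
  have haz : a ≠ z := by
    rintro rfl
    omega
  obtain ⟨b, hbC, hab, hb⟩ := exists_next haC haz
  have hyb := ih _ (by omega) hbC rfl
  have hwb : w ≠ b := by
    rintro rfl
    omega
  obtain ⟨c, hs, hc⟩ := hG.quadrangle y hwa.symm hab hwb (by omega) (by omega)
  have hcC := hG.mem_of_square hC hs hw hbC
  have := hmin c hcC
  have := hG.dist_right_of_adj z (hG.adj (hG.rotate (hG.rotate hs))).symm
  have := hG.dist_right_of_adj z (hG.adj (hG.rotate hs))
  have := ih (Γ.dist z c) (by omega) hcC rfl
  omega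

theorem exists_gate {C : Set V} (hC : GeodesicallyConvex Γ C) (hne : C.Nonempty) (y : V) :
    ∃ z ∈ C, ∀ w ∈ C, Γ.dist y w = Γ.dist y z + Γ.dist z w := by
  obtain ⟨z, hz, hmin⟩ := exists_minimalFor_of_wellFoundedLT (· ∈ C) (Γ.dist y) hne
  refine ⟨z, hz, fun w => hG.dist_eq_add_of_forall_dist_le hC hz fun u hu => ?_⟩
  exact (le_total _ _).elim id (hmin hu)

theorem notMem_of_gate {C h : Set V} (hh : h ∈ halfspaces Γ) {y z : V}
    (hz : ∀ w ∈ C, Γ.dist y w = Γ.dist y z + Γ.dist z w) (hy : y ∈ h) (hzh : z ∉ h) :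
    ∀ w ∈ C, w ∉ h :=
  fun w hw hwh => hzh (hG.convex_halfspace hh y hy w hwh z (hz w hw).symm)

theorem finite_separating (x y : V) : {h ∈ halfspaces Γ | x ∈ h ∧ y ∉ h}.Finite := by
  induction hn : Γ.dist x y generalizing x with
  | zero =>
    obtain rfl := hG.connected.dist_eq_zero_iff.1 hn
    exact Set.finite_empty.subset fun h hh => hh.2.2 hh.2.1
  | succ n ih =>
    have hxy : x ≠ y := by
      rintro rfl
      exact absurd (SimpleGraph.dist_self.symm.trans hn) (by omega)
    obtain ⟨z, hxz, hz⟩ := hG.exists_adj_closer hxy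
    refine ((ih z (by omega)).union (Set.finite_singleton (halfspace Γ z x))).subset ?_
    rintro h ⟨hh, hx, hy⟩
    by_cases hzh : z ∈ h
    · exact .inl ⟨hh, hzh, hy⟩
    · exact .inr (hG.eq_halfspace_of_crossing hh hxz hx hzh)

theorem exists_separating {x y : V} (hxy : x ≠ y) : ∃ h ∈ halfspaces Γ, x ∉ h ∧ y ∈ h := by
  obtain ⟨z, hxz, hz⟩ := hG.exists_adj_closer hxy
  refine ⟨halfspace Γ x z, ⟨x, z, hxz, rfl⟩, notMem_halfspace_left _ _, ?_⟩
  rw [mem_halfspace, Γ.dist_comm, Γ.dist_comm (u := y)]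
  omega

theorem helly {C : Set V} (hC : GeodesicallyConvex Γ C) (hne : C.Nonempty) {S : Set (Set V)}
    (hS : S ⊆ halfspaces Γ) (hfin : ∀ y ∈ C, {h ∈ S | y ∈ h}.Finite)
    (hpair : ∀ h ∈ S, ∀ k ∈ S, (C ∩ (hᶜ ∩ kᶜ)).Nonempty) : ∃ y ∈ C, ∀ h ∈ S, y ∉ h := by
  obtain ⟨y, hy, hmin⟩ := exists_minimalFor_of_wellFoundedLT (· ∈ C)
    (fun y => {h ∈ S | y ∈ h}.ncard) hne
  refine ⟨y, hy, fun h hh hyh => ?_⟩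
  obtain ⟨w, hwC, hwh, -⟩ := hpair h hh h hh
  obtain ⟨z, hz, hgate⟩ := hG.exists_gate
    (hC.inter (hG.convex_halfspace (hG.compl_mem_halfspaces (hS hh)))) ⟨w, hwC, hwh⟩ y
  have hlt : {k ∈ S | z ∈ k} ⊂ {k ∈ S | y ∈ k} := by
    refine ⟨?_, fun hsub => hz.2 (hsub ⟨hh, hyh⟩ : h ∈ {k ∈ S | z ∈ k}).2⟩
    rintro k ⟨hk, hzk⟩
    refine ⟨hk, ?_⟩
    by_contra hyk
    obtain ⟨w, hwC, hwh, hwk⟩ := hpair h hh k hk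
    exact hG.notMem_of_gate (hG.compl_mem_halfspaces (hS hk)) hgate hyk
      (fun h => h hzk) w ⟨hwC, hwh⟩ hwk
  have hcard := Set.ncard_lt_ncard hlt (hfin y hy)
  exact hcard.not_ge (hmin hz.1 hcard.le)

theorem inter_inter_nonempty {C k l : Set V} (hC : GeodesicallyConvex Γ C)
    (hk : k ∈ halfspaces Γ) (hl : l ∈ halfspaces Γ) (hCk : (C ∩ k).Nonempty)
    (hCl : (C ∩ l).Nonempty) (hkl : (k ∩ l).Nonempty) : (C ∩ k ∩ l).Nonempty := by
  obtain ⟨a, ha, hak⟩ := hCk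
  obtain ⟨b, hb, hbl⟩ := hCl
  obtain ⟨v, hvk, hvl⟩ := hkl
  obtain ⟨z, hz, hgate⟩ := hG.exists_gate hC ⟨a, ha⟩ v
  refine ⟨z, ⟨hz, ?_⟩, ?_⟩
  · by_contra hzk
    exact hG.notMem_of_gate hk hgate hvk hzk a ha hak
  · by_contra hzl
    exact hG.notMem_of_gate hl hgate hvl hzl b hb hbl

theorem exists_edge_in {A : Set V} (hA : GeodesicallyConvex Γ A) (h : Set V)
    (hin : (A ∩ h).Nonempty) (hout : (A ∩ hᶜ).Nonempty) :
    ∃ q p, Γ.Adj q p ∧ q ∈ A ∧ p ∈ A ∧ q ∉ h ∧ p ∈ h := by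
  obtain ⟨x, hxA, hx⟩ := hin
  obtain ⟨e, heA, he⟩ := hout
  obtain ⟨q, p, hqp, hq, hp, hd⟩ := hG.exists_crossing_edge h he hx
  have hqpx := hG.connected.dist_triangle (u := q) (v := p) (w := x)
  have heqx := hG.connected.dist_triangle (u := e) (v := q) (w := x)
  have heqp := hG.connected.dist_triangle (u := e) (v := q) (w := p)
  have hepx := hG.connected.dist_triangle (u := e) (v := p) (w := x)
  rw [SimpleGraph.dist_eq_one_iff_adj.2 hqp] at hqpx heqp
  exact ⟨q, p, hqp, hA e heA x hxA q (by omega), hA e heA x hxA p (by omega), hq, hp⟩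

theorem exists_mem_outerBoundary {h A : Set V} (hA : GeodesicallyConvex Γ A)
    (hin : (A ∩ h).Nonempty) (hout : (A ∩ hᶜ).Nonempty) :
    (outerBoundary Γ h ∩ A).Nonempty := by
  obtain ⟨q, p, hqp, hqA, -, hq, hp⟩ := hG.exists_edge_in hA h hin hout
  exact ⟨q, ⟨hq, p, hp, hqp⟩, hqA⟩

theorem mem_outerBoundary_of_adj {h : Set V} (hh : h ∈ halfspaces Γ) {p p' e : V}
    (hp : p ∈ outerBoundary Γ h) (hp' : p' ∈ outerBoundary Γ h) (hpe : Γ.Adj p e)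
    (hd : Γ.dist e p' + 1 = Γ.dist p p') : e ∈ outerBoundary Γ h := by
  obtain ⟨hp, q, hq, hpq⟩ := hp
  obtain ⟨hp', q', hq', hpq'⟩ := hp'
  have heh : e ∉ h := hG.convex_halfspace (hG.compl_mem_halfspaces hh) p hp p' hp' e (by
    rw [SimpleGraph.dist_eq_one_iff_adj.2 hpe, add_comm, hd])
  have h_eq := hG.eq_halfspace_of_crossing hh hpq.symm hq hp
  have h_eq' := hG.eq_halfspace_of_crossing hh hpq'.symm hq' hp'
  have hp'_mem : p' ∈ halfspace Γ p e := by
    rw [mem_halfspace, Γ.dist_comm, Γ.dist_comm (u := p')]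
    omega
  have hq'_mem : q' ∈ halfspace Γ p e := by
    by_contra hq'_notMem
    have hpe_eq := hG.halfspace_eq_of_crossing hpe hpq' hp'_mem hq'_notMem
    have hp_compl : p ∈ hᶜ := hp
    rw [h_eq', hG.compl_halfspace hpq', ← hpe_eq] at hp_compl
    exact notMem_halfspace_left _ _ hp_compl
  have hqe : q ≠ e := by
    rintro rfl
    exact heh hq
  obtain ⟨f, hf, -⟩ := hG.quadrangle q' hpq hpe hqe (mem_halfspace.1 (h_eq ▸ hq')) hq'_mem
  have hef := (hG.adj (hG.rotate (hG.rotate hf))).symm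
  refine ⟨heh, f, ?_, hef⟩
  rw [h_eq, hG.halfspace_eq_of_square hf]
  exact mem_halfspace_right hef

theorem convex_outerBoundary {h : Set V} (hh : h ∈ halfspaces Γ) :
    GeodesicallyConvex Γ (outerBoundary Γ h) := by
  intro x hx y hy e he
  induction hn : Γ.dist x e generalizing x with
  | zero => exact hG.connected.dist_eq_zero_iff.1 hn ▸ hx
  | succ n ih =>
    have hxe : x ≠ e := by
      rintro rfl
      exact absurd (SimpleGraph.dist_self.symm.trans hn) (by omega)
    obtain ⟨z, hxz, hz⟩ := hG.exists_adj_closer hxe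
    have := hG.connected.dist_triangle (u := z) (v := e) (w := y)
    have := hG.dist_left_of_adj y hxz
    exact ih z (hG.mem_outerBoundary_of_adj hh hx hy hxz (by omega)) (by omega) (by omega)

theorem exists_square_of_mem_inter {h k : Set V} (hh : h ∈ halfspaces Γ)
    (hk : k ∈ halfspaces Γ) {p q r : V} (hpq : Γ.Adj p q) (hpr : Γ.Adj p r) (hph : p ∉ h)
    (hqh : q ∈ h) (hpk : p ∉ k) (hrk : r ∈ k) (hne : h ≠ k) (hhk : (h ∩ k).Nonempty) :
    ∃ e, Sq p q e r ∧ e ∈ h ∧ e ∈ k := by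
  obtain rfl := hG.eq_halfspace_of_crossing hh hpq.symm hqh hph
  obtain rfl := hG.eq_halfspace_of_crossing hk hpr.symm hrk hpk
  have hqr : q ≠ r := by
    rintro rfl
    exact hne rfl
  obtain ⟨v, hvh, hvk⟩ := hhk
  obtain ⟨e, he, -⟩ := hG.quadrangle v hpq hpr hqr hvh hvk
  refine ⟨e, he, ?_, ?_⟩
  · rw [hG.halfspace_eq_of_square he]
    exact mem_halfspace_right (hG.adj (hG.rotate (hG.rotate he))).symm
  · rw [hG.halfspace_eq_of_square (hG.reflect he)]
    exact mem_halfspace_right (hG.adj (hG.rotate he))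

theorem exists_mem_outerBoundary_three {h₁ h₂ h₃ : Set V} (m₁ : h₁ ∈ halfspaces Γ)
    (m₂ : h₂ ∈ halfspaces Γ) (m₃ : h₃ ∈ halfspaces Γ) (c₁₂ : Crosses h₁ h₂)
    (c₁₃ : Crosses h₁ h₃) (c₂₃ : Crosses h₂ h₃) :
    ∃ p, p ∈ outerBoundary Γ h₁ ∧ p ∈ outerBoundary Γ h₂ ∧ p ∈ outerBoundary Γ h₃ := by
  have hB := hG.convex_outerBoundary m₁
  have meets_of_crosses : ∀ {k : Set V}, k ∈ halfspaces Γ → (h₁ ∩ k).Nonempty →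
      (h₁ᶜ ∩ k).Nonempty → (outerBoundary Γ h₁ ∩ k).Nonempty := fun hk hin hout =>
    hG.exists_mem_outerBoundary (hG.convex_halfspace hk) (by rwa [Set.inter_comm])
      (by rwa [Set.inter_comm])
  have m₂' := hG.compl_mem_halfspaces m₂
  have m₃' := hG.compl_mem_halfspaces m₃
  have meets₂ := meets_of_crosses m₂ c₁₂.1 c₁₂.2.2.1
  have meets₂' := meets_of_crosses m₂' c₁₂.2.1 c₁₂.2.2.2
  have meets₃ := meets_of_crosses m₃ c₁₃.1 c₁₃.2.2.1
  have meets₃' := meets_of_crosses m₃' c₁₃.2.1 c₁₃.2.2.2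
  have boundary_meets : ∀ {k : Set V}, k ∈ halfspaces Γ → (outerBoundary Γ h₁ ∩ k).Nonempty →
      (h₂ ∩ k).Nonempty → (h₂ᶜ ∩ k).Nonempty →
      ((outerBoundary Γ h₂ ∩ outerBoundary Γ h₁) ∩ k).Nonempty := by
    intro k hk hBk hin hout
    rw [Set.inter_assoc]
    refine hG.exists_mem_outerBoundary (hB.inter (hG.convex_halfspace hk)) ?_ ?_
    · exact hG.inter_inter_nonempty hB hk m₂ hBk meets₂ (Set.inter_comm h₂ k ▸ hin)
    · exact hG.inter_inter_nonempty hB hk m₂' hBk meets₂' (Set.inter_comm h₂ᶜ k ▸ hout)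
  obtain ⟨p, hp₃, hp₂, hp₁⟩ := hG.exists_mem_outerBoundary ((hG.convex_outerBoundary m₂).inter hB)
    (boundary_meets m₃ meets₃ c₂₃.1 c₂₃.2.2.1) (boundary_meets m₃' meets₃' c₂₃.2.1 c₂₃.2.2.2)
  exact ⟨p, hp₁, hp₂, hp₃⟩

theorem not_three_crossing {h₁ h₂ h₃ : Set V} (m₁ : h₁ ∈ halfspaces Γ) (m₂ : h₂ ∈ halfspaces Γ)
    (m₃ : h₃ ∈ halfspaces Γ) (c₁₂ : Crosses h₁ h₂) (c₁₃ : Crosses h₁ h₃)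
    (c₂₃ : Crosses h₂ h₃) : False := by
  obtain ⟨p, ⟨p₁, q₁, hq₁, hpq₁⟩, ⟨p₂, q₂, hq₂, hpq₂⟩, p₃, q₃, hq₃, hpq₃⟩ :=
    hG.exists_mem_outerBoundary_three m₁ m₂ m₃ c₁₂ c₁₃ c₂₃
  obtain ⟨_, s₁₂, -⟩ :=
    hG.exists_square_of_mem_inter m₁ m₂ hpq₁ hpq₂ p₁ hq₁ p₂ hq₂ c₁₂.ne c₁₂.1
  obtain ⟨_, s₂₃, -⟩ :=
    hG.exists_square_of_mem_inter m₂ m₃ hpq₂ hpq₃ p₂ hq₂ p₃ hq₃ c₂₃.ne c₂₃.1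
  obtain ⟨_, s₁₃, -⟩ :=
    hG.exists_square_of_mem_inter m₁ m₃ hpq₁ hpq₃ p₁ hq₁ p₃ hq₃ c₁₃.ne c₁₃.1
  exact hG.not_triangle s₁₂ s₂₃ s₁₃

end SquareComplexGraph

end Halfspaces

/-! ## Invariant cubes -/

/-- The halfspaces which separate two points of `Y`. -/
def wallsOf {V : Type u} (Γ : SimpleGraph V) (Y : Set V) : Set (Set V) :=
  {h ∈ halfspaces Γ | (Y ∩ h).Nonempty ∧ (Y ∩ hᶜ).Nonempty}

/-- The trace of the halfspace `h` on `Y` is minimal among the traces of the walls of `Y`. -/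
def MinimalIn {V : Type u} (Γ : SimpleGraph V) (Y h : Set V) : Prop :=
  ∀ k ∈ wallsOf Γ Y, Y ∩ k ⊆ h → Y ∩ h ⊆ k

/-- Any two distinct walls of `Z` cross inside `Z`. Since the set of walls is closed under
complements, it is enough to ask for one of the four intersections. -/
def PairwiseCrossing {V : Type u} (Γ : SimpleGraph V) (Z : Set V) : Prop :=
  ∀ h ∈ wallsOf Γ Z, ∀ k ∈ wallsOf Γ Z, k ≠ hᶜ → (Z ∩ (h ∩ k)).Nonempty

/-- The intersection of all halfspaces containing `O`. -/
def halfspaceHull {V : Type u} (Γ : SimpleGraph V) (O : Set V) : Set V :=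
  ⋂ h ∈ {h ∈ halfspaces Γ | O ⊆ h}, h

section InvariantSets

open scoped Pointwise

variable {V : Type u} {Γ : SimpleGraph V}

theorem mem_halfspaceHull {O : Set V} {v : V} :
    v ∈ halfspaceHull Γ O ↔ ∀ h ∈ halfspaces Γ, O ⊆ h → v ∈ h := by
  simp only [halfspaceHull, Set.mem_iInter, Set.mem_ofPred_eq, and_imp]

theorem subset_halfspaceHull (O : Set V) : O ⊆ halfspaceHull Γ O :=
  fun _ hv => mem_halfspaceHull.2 fun _ _ hO => hO hv

theorem MinimalIn.inter_compl_nonempty {Y h k : Set V} (hk : MinimalIn Γ Y k)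
    (hh : ¬ MinimalIn Γ Y hᶜ) : (Y ∩ (hᶜ ∩ kᶜ)).Nonempty := by
  by_contra hempty
  have compl_subset : Y ∩ hᶜ ⊆ k := fun z hz => by
    by_contra hzk
    exact hempty ⟨z, hz.1, hz.2, hzk⟩
  refine hh fun l hl hlh z hz => ?_
  exact hk l hl (fun w hw => compl_subset ⟨hw.1, hlh hw⟩) ⟨hz.1, compl_subset hz⟩

section Action

variable {K : Type v} [Group K] [MulAction K V]

theorem dist_smul_of_adj (hc : Γ.Connected)
    (hadj : ∀ (g : K) (x y : V), Γ.Adj x y → Γ.Adj (g • x) (g • y)) (g : K) (x y : V) :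
    Γ.dist (g • x) (g • y) = Γ.dist x y := by
  have dist_le : ∀ (g : K) (x y : V), Γ.dist (g • x) (g • y) ≤ Γ.dist x y := by
    intro g x y
    obtain ⟨p, hp⟩ := hc.exists_walk_length_eq_dist x y
    let f : Γ →g Γ := ⟨fun v => g • v, hadj g _ _⟩
    rw [← hp, ← p.length_map f]
    exact SimpleGraph.dist_le _
  refine (dist_le g x y).antisymm ?_
  simpa only [inv_smul_smul] using dist_le g⁻¹ (g • x) (g • y)

variable (hc : Γ.Connected) (hadj : ∀ (g : K) (x y : V), Γ.Adj x y → Γ.Adj (g • x) (g • y))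
include hc hadj

theorem smul_mem_halfspaces (g : K) {h : Set V} (hh : h ∈ halfspaces Γ) :
    g • h ∈ halfspaces Γ := by
  obtain ⟨a, b, hab, rfl⟩ := hh
  refine ⟨g • a, g • b, hadj _ _ _ hab, ?_⟩
  ext v
  rw [Set.mem_smul_set_iff_inv_smul_mem, mem_halfspace, mem_halfspace,
    ← dist_smul_of_adj hc hadj g _ a, ← dist_smul_of_adj hc hadj g _ b, smul_inv_smul]

theorem smul_halfspaceHull {O : Set V} (hO : ∀ g : K, g • O = O) (g : K) :
    g • halfspaceHull Γ O = halfspaceHull Γ O := by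
  have smul_subset : ∀ g : K, g • halfspaceHull Γ O ⊆ halfspaceHull Γ O := by
    intro g v hv
    obtain ⟨w, hw, rfl⟩ := hv
    refine mem_halfspaceHull.2 fun h hh hOh => ?_
    rw [← Set.mem_inv_smul_set_iff]
    refine mem_halfspaceHull.1 hw _ (smul_mem_halfspaces hc hadj g⁻¹ hh) ?_
    rw [← hO g⁻¹]
    exact Set.smul_set_mono hOh
  refine (smul_subset g).antisymm ?_
  rw [Set.subset_smul_set_iff]
  exact smul_subset g⁻¹

variable {Y : Set V} (hY : ∀ g : K, g • Y = Y)
include hY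

theorem smul_mem_wallsOf (g : K) {h : Set V} (hh : h ∈ wallsOf Γ Y) : g • h ∈ wallsOf Γ Y := by
  refine ⟨smul_mem_halfspaces hc hadj g hh.1, ?_, ?_⟩
  · rw [← hY g, ← Set.smul_set_inter, Set.smul_set_nonempty]
    exact hh.2.1
  · rw [← hY g, ← Set.smul_set_compl, ← Set.smul_set_inter, Set.smul_set_nonempty]
    exact hh.2.2

theorem MinimalIn.smul (g : K) {h : Set V} (hh : MinimalIn Γ Y h) : MinimalIn Γ Y (g • h) := by
  intro k hk hkh
  have := hh _ (smul_mem_wallsOf hc hadj hY g⁻¹ hk) (by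
    rwa [← hY g⁻¹, ← Set.smul_set_inter, Set.smul_set_subset_iff_subset_inv_smul_set, inv_inv])
  rwa [← hY g, ← Set.smul_set_inter, Set.smul_set_subset_iff_subset_inv_smul_set]

end Action

namespace SquareComplexGraph

variable {Sq : V → V → V → V → Prop} (hG : SquareComplexGraph Γ Sq)
include hG

theorem convex_halfspaceHull (O : Set V) : GeodesicallyConvex Γ (halfspaceHull Γ O) :=
  .biInter fun _ hh => hG.convex_halfspace hh.1

theorem compl_mem_wallsOf {Y h : Set V} (hh : h ∈ wallsOf Γ Y) : hᶜ ∈ wallsOf Γ Y :=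
  ⟨hG.compl_mem_halfspaces hh.1, hh.2.2, by rw [compl_compl]; exact hh.2.1⟩

theorem finite_wallsOf_halfspaceHull {O : Set V} (hfin : O.Finite) :
    (wallsOf Γ (halfspaceHull Γ O)).Finite := by
  refine (hfin.biUnion fun x _ => hfin.biUnion fun y _ => hG.finite_separating x y).subset ?_
  rintro h ⟨hh, ⟨a, ha, hah⟩, ⟨b, hb, hbh⟩⟩
  obtain ⟨y, hy, hyh⟩ := Set.not_subset.1 fun hO => hbh (mem_halfspaceHull.1 hb h hh hO)
  obtain ⟨x, hx, hxh⟩ := Set.not_subset.1 fun hO =>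
    mem_halfspaceHull.1 ha hᶜ (hG.compl_mem_halfspaces hh) hO hah
  simp only [Set.mem_iUnion]
  exact ⟨x, hx, y, hy, hh, not_not.1 hxh, hyh⟩

theorem eq_of_forall_mem_wallsOf {Z : Set V} {x y : V} (hx : x ∈ Z) (hy : y ∈ Z)
    (H : ∀ h ∈ wallsOf Γ Z, x ∈ h → y ∈ h) : x = y := by
  by_contra hxy
  obtain ⟨h, hh, hyh, hxh⟩ := hG.exists_separating (Ne.symm hxy)
  exact hyh (H h ⟨hh, ⟨x, hx, hxh⟩, ⟨y, hy, hyh⟩⟩ hxh)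

variable {K : Type v} [Group K] [MulAction K V]

/-- The walls which are minimal only on one side are cut away: by the Helly property their
complements have a common point in `Y`, and the intersection of `Y` with these complements has
fewer walls. -/
theorem exists_minimal_invariant
    (hadj : ∀ (g : K) (x y : V), Γ.Adj x y → Γ.Adj (g • x) (g • y)) {Y : Set V}
    (hY : ∀ g : K, g • Y = Y) (hC : GeodesicallyConvex Γ Y) (hne : Y.Nonempty)
    (hfin : (wallsOf Γ Y).Finite) :
    ∃ Z : Set V, (∀ g : K, g • Z = Z) ∧ GeodesicallyConvex Γ Z ∧ Z.Nonempty ∧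
      (wallsOf Γ Z).Finite ∧ ∀ h ∈ wallsOf Γ Z, MinimalIn Γ Z h → MinimalIn Γ Z hᶜ := by
  have hc := hG.connected
  induction hn : (wallsOf Γ Y).ncard using Nat.strong_induction_on generalizing Y with
  | _ n ih =>
  by_cases hall : ∀ h ∈ wallsOf Γ Y, MinimalIn Γ Y h → MinimalIn Γ Y hᶜ
  · exact ⟨Y, hY, hC, hne, hfin, hall⟩
  push Not at hall
  obtain ⟨h₀, hw₀, hm₀, hm₀'⟩ := hall
  set S : Set (Set V) := {h ∈ wallsOf Γ Y | MinimalIn Γ Y h ∧ ¬ MinimalIn Γ Y hᶜ}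
  have hSw : S ⊆ wallsOf Γ Y := fun h hh => hh.1
  have smul_mem_S : ∀ (g : K), ∀ h ∈ S, g • h ∈ S := fun g h hh =>
    ⟨smul_mem_wallsOf hc hadj hY g hh.1, hh.2.1.smul hc hadj hY g, fun hm => hh.2.2 (by
      simpa only [← Set.smul_set_compl, inv_smul_smul] using hm.smul hc hadj hY g⁻¹)⟩
  obtain ⟨y, hyY, hy⟩ := hG.helly hC hne (fun h hh => (hSw hh).1)
    (fun y _ => hfin.subset fun h hh => hSw hh.1)
    (fun h hh k hk => hk.2.1.inter_compl_nonempty hh.2.2)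
  set Z : Set V := {y ∈ Y | ∀ h ∈ S, y ∉ h}
  have hZC : GeodesicallyConvex Γ Z := fun a ha b hb e he =>
    ⟨hC a ha.1 b hb.1 e he, fun h hh => hG.convex_halfspace
      (hG.compl_mem_halfspaces (hSw hh).1) a (ha.2 h hh) b (hb.2 h hh) e he⟩
  have hZY : Z ⊆ Y := fun y hy => hy.1
  have walls_ssubset : wallsOf Γ Z ⊂ wallsOf Γ Y := by
    refine ⟨fun h hh => ⟨hh.1, hh.2.1.mono (Set.inter_subset_inter_left h hZY),
      hh.2.2.mono (Set.inter_subset_inter_left hᶜ hZY)⟩, fun hsub => ?_⟩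
    obtain ⟨x, hx, hxh⟩ := (hsub hw₀).2.1
    exact hx.2 h₀ ⟨hw₀, hm₀, hm₀'⟩ hxh
  have smul_subset : ∀ g : K, g • Z ⊆ Z := by
    rintro g - ⟨z, ⟨hzY, hz⟩, rfl⟩
    refine ⟨hY g ▸ Set.smul_mem_smul_set hzY, fun h hh hgz => ?_⟩
    exact hz _ (smul_mem_S g⁻¹ h hh) (Set.mem_inv_smul_set_iff.2 hgz)
  refine ih _ (hn ▸ Set.ncard_lt_ncard walls_ssubset hfin) (fun g => ?_) hZC ⟨y, hyY, hy⟩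
    (hfin.subset walls_ssubset.1) rfl
  exact (smul_subset g).antisymm (Set.subset_smul_set_iff.2 (smul_subset g⁻¹))

variable {Z : Set V}

theorem minimalIn_of_mem_wallsOf (hfin : (wallsOf Γ Z).Finite)
    (hmin : ∀ h ∈ wallsOf Γ Z, MinimalIn Γ Z h → MinimalIn Γ Z hᶜ) {h : Set V}
    (hh : h ∈ wallsOf Γ Z) : MinimalIn Γ Z h := by
  obtain ⟨k, ⟨hk, hkh⟩, hk_le⟩ := Set.Finite.exists_minimalFor (fun k => Z ∩ k)
    {k ∈ wallsOf Γ Z | Z ∩ k ⊆ h} (hfin.subset fun k hk => hk.1)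
    ⟨h, hh, Set.inter_subset_right⟩
  have hk_min : MinimalIn Γ Z k := fun l hl hlk x hx =>
    (hk_le ⟨hl, fun z hz => hkh ⟨hz.1, hlk hz⟩⟩ (fun z hz => ⟨hz.1, hlk hz⟩) hx).2
  have compl_subset : Z ∩ kᶜ ⊆ hᶜ := hmin k hk hk_min _ (hG.compl_mem_wallsOf hh)
    fun z hz hzk => hz.2 (hkh ⟨hz.1, hzk⟩)
  intro l hl hlh x hx
  have hxk : x ∈ k := by
    by_contra hxk
    exact compl_subset ⟨hx.1, hxk⟩ hx.2
  refine hk_min l hl (fun z hz => ?_) ⟨hx.1, hxk⟩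
  by_contra hzk
  exact compl_subset ⟨hz.1, hzk⟩ (hlh hz)

theorem eq_of_mem_wallsOf (hC : GeodesicallyConvex Γ Z) {k l : Set V} (hk : k ∈ wallsOf Γ Z)
    (hl : l ∈ wallsOf Γ Z) (hkl : Z ∩ k ⊆ l) (hlk : Z ∩ l ⊆ k) : k = l := by
  obtain ⟨q, p, hqp, hqZ, hpZ, hq, hp⟩ := hG.exists_edge_in hC k hk.2.1 hk.2.2
  rw [hG.eq_halfspace_of_crossing hk.1 hqp.symm hp hq,
    hG.eq_halfspace_of_crossing hl.1 hqp.symm (hkl ⟨hpZ, hp⟩) fun hql => hq (hlk ⟨hqZ, hql⟩)]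

theorem pairwiseCrossing_of_minimalIn (hC : GeodesicallyConvex Γ Z)
    (hfin : (wallsOf Γ Z).Finite)
    (hmin : ∀ h ∈ wallsOf Γ Z, MinimalIn Γ Z h → MinimalIn Γ Z hᶜ) :
    PairwiseCrossing Γ Z := by
  intro h hh k hk hkh
  by_contra hempty
  have hh' := hG.compl_mem_wallsOf hh
  have k_subset : Z ∩ k ⊆ hᶜ := fun z hz hzh => hempty ⟨z, hz.1, hzh, hz.2⟩
  exact hkh (hG.eq_of_mem_wallsOf hC hk hh' k_subset
    (hG.minimalIn_of_mem_wallsOf hfin hmin hh' k hk k_subset))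

section TwoWalls

variable (hZ : PairwiseCrossing Γ Z) {h k : Set V} (hh : h ∈ wallsOf Γ Z)
  (hk : k ∈ wallsOf Γ Z) (hkh : k ≠ h) (hkh' : k ≠ hᶜ)
include hZ hh hk hkh hkh'

theorem inter_nonempty_of_pairwiseCrossing :
    (Z ∩ (h ∩ k)).Nonempty ∧ (Z ∩ (h ∩ kᶜ)).Nonempty ∧ (Z ∩ (hᶜ ∩ k)).Nonempty ∧
      (Z ∩ (hᶜ ∩ kᶜ)).Nonempty := by
  have hh_compl := hG.compl_mem_wallsOf hh
  have hk_compl := hG.compl_mem_wallsOf hk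
  refine ⟨hZ h hh k hk hkh', hZ h hh _ hk_compl (compl_injective.ne hkh),
    hZ _ hh_compl k hk (by rwa [compl_compl]), hZ _ hh_compl _ hk_compl ?_⟩
  rw [compl_compl]
  exact fun h_eq => hkh' (compl_eq_comm.1 h_eq).symm

theorem crosses_of_pairwiseCrossing : Crosses h k := by
  obtain ⟨hin_in, hin_out, hout_in, hout_out⟩ :=
    hG.inter_nonempty_of_pairwiseCrossing hZ hh hk hkh hkh'
  exact ⟨hin_in.right, hin_out.right, hout_in.right, hout_out.right⟩

theorem eq_of_agree_on_crossing {x y : V} (hx : x ∈ Z) (hy : y ∈ Z) (hxy : x ∈ h ↔ y ∈ h)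
    (hxy' : x ∈ k ↔ y ∈ k) : x = y := by
  refine hG.eq_of_forall_mem_wallsOf hx hy fun l hl hxl => ?_
  by_contra hyl
  have ne_of_iff : ∀ m : Set V, (x ∈ m ↔ y ∈ m) → l ≠ m := by
    rintro m hm rfl
    exact hyl (hm.1 hxl)
  exact hG.not_three_crossing hh.1 hk.1 hl.1
    (hG.crosses_of_pairwiseCrossing hZ hh hk hkh hkh')
    (hG.crosses_of_pairwiseCrossing hZ hh hl (ne_of_iff h hxy) (ne_of_iff hᶜ hxy.not))
    (hG.crosses_of_pairwiseCrossing hZ hk hl (ne_of_iff k hxy') (ne_of_iff kᶜ hxy'.not))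

theorem exists_square_of_pairwiseCrossing (hC : GeodesicallyConvex Γ Z) :
    ∃ p q e r, Sq p q e r ∧ p ∈ Z ∩ (hᶜ ∩ kᶜ) ∧ q ∈ Z ∩ (h ∩ kᶜ) ∧ e ∈ Z ∩ (h ∩ k) ∧
      r ∈ Z ∩ (hᶜ ∩ k) := by
  obtain ⟨-, hin_out, hout_in, hout_out⟩ :=
    hG.inter_nonempty_of_pairwiseCrossing hZ hh hk hkh hkh'
  obtain ⟨p, q, hpq, hp, hq, hph, hqh⟩ := hG.exists_edge_in
    (hC.inter (hG.convex_halfspace (hG.compl_mem_wallsOf hk).1)) h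
    (by rwa [Set.inter_assoc, Set.inter_comm kᶜ]) (by rwa [Set.inter_assoc, Set.inter_comm kᶜ])
  obtain ⟨p', r, hpr, hp', hr, hpk, hrk⟩ := hG.exists_edge_in
    (hC.inter (hG.convex_halfspace (hG.compl_mem_wallsOf hh).1)) k
    (by rwa [Set.inter_assoc]) (by rwa [Set.inter_assoc])
  obtain rfl : p' = p := hG.eq_of_agree_on_crossing hZ hh hk hkh hkh' hp'.1 hp.1
    (iff_of_false hp'.2 hph) (iff_of_false hpk hp.2)
  obtain ⟨e, he, heh, hek⟩ := hG.exists_square_of_mem_inter hh.1 hk.1 hpq hpr hph hqh hpk hrk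
    hkh.symm (hG.crosses_of_pairwiseCrossing hZ hh hk hkh hkh').1
  exact ⟨p', q, e, r, he, ⟨hp.1, hph, hpk⟩, ⟨hq.1, hqh, hq.2⟩,
    ⟨hG.mem_of_square hC he hq.1 hr.1, heh, hek⟩, hr.1, hr.2, hrk⟩

end TwoWalls

end SquareComplexGraph

namespace CubeComplex

variable {X : CubeComplex V} (hG : SquareComplexGraph X.graph X.IsSquare) {Z : Set V}
include hG

theorem mem_cubes_of_wallsOf_eq_empty (hne : Z.Nonempty) (hw : wallsOf X.graph Z = ∅) :
    Z ∈ X.cubes := by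
  obtain ⟨z, hz⟩ := hne
  have hZ : Z = {z} := Set.eq_singleton_iff_unique_mem.2
    ⟨hz, fun y hy => hG.eq_of_forall_mem_wallsOf hy hz (by simp only [hw, Set.mem_empty_iff_false,
      false_imp_iff, implies_true])⟩
  exact hZ ▸ X.singleton_mem z

theorem mem_cubes_of_unique_wall (hC : GeodesicallyConvex X.graph Z) {h : Set V}
    (hh : h ∈ wallsOf X.graph Z) (hall : ∀ k ∈ wallsOf X.graph Z, k ≠ h → k = hᶜ) :
    Z ∈ X.cubes := by
  obtain ⟨q, p, hqp, hqZ, hpZ, hq, hp⟩ := hG.exists_edge_in hC h hh.2.1 hh.2.2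
  have eq_of_agree : ∀ {x y}, x ∈ Z → y ∈ Z → (x ∈ h ↔ y ∈ h) → x = y := by
    intro x y hx hy hxy
    refine hG.eq_of_forall_mem_wallsOf hx hy fun k hk => ?_
    rcases eq_or_ne k h with rfl | hkh
    · exact hxy.1
    · rw [hall k hk hkh]
      exact hxy.not.1
  have hZ : Z = {q, p} := by
    refine Set.Subset.antisymm (fun z hz => ?_) (Set.pair_subset hqZ hpZ)
    by_cases hzh : z ∈ h
    · exact .inr (eq_of_agree hz hpZ (iff_of_true hzh hp))
    · exact .inl (eq_of_agree hz hqZ (iff_of_false hzh hq))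
  exact hZ ▸ hqp.2

theorem mem_cubes_of_two_walls (hC : GeodesicallyConvex X.graph Z)
    (hZ : PairwiseCrossing X.graph Z) {h k : Set V} (hh : h ∈ wallsOf X.graph Z)
    (hk : k ∈ wallsOf X.graph Z) (hkh : k ≠ h) (hkh' : k ≠ hᶜ) : Z ∈ X.cubes := by
  obtain ⟨p, q, e, r, hs, ⟨hpZ, hph, hpk⟩, ⟨hqZ, hqh, hqk⟩, ⟨heZ, heh, hek⟩, hrZ, hrh, hrk⟩ :=
    hG.exists_square_of_pairwiseCrossing hZ hh hk hkh hkh' hC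
  have eq_of_agree : ∀ {x y}, x ∈ Z → y ∈ Z → (x ∈ h ↔ y ∈ h) → (x ∈ k ↔ y ∈ k) → x = y :=
    hG.eq_of_agree_on_crossing hZ hh hk hkh hkh'
  have hZ_eq : Z = {p, q, e, r} := by
    refine Set.Subset.antisymm (fun z hz => ?_) ?_
    · by_cases hzh : z ∈ h <;> by_cases hzk : z ∈ k
      · exact .inr (.inr (.inl (eq_of_agree hz heZ (iff_of_true hzh heh) (iff_of_true hzk hek))))
      · exact .inr (.inl (eq_of_agree hz hqZ (iff_of_true hzh hqh) (iff_of_false hzk hqk)))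
      · exact .inr (.inr (.inr (eq_of_agree hz hrZ (iff_of_false hzh hrh)
          (iff_of_true hzk hrk))))
      · exact .inl (eq_of_agree hz hpZ (iff_of_false hzh hph) (iff_of_false hzk hpk))
    · rintro z (rfl | rfl | rfl | rfl) <;> assumption
  exact hZ_eq ▸ hs.2.2.2.2.2.2

theorem mem_cubes_of_pairwiseCrossing (hC : GeodesicallyConvex X.graph Z) (hne : Z.Nonempty)
    (hZ : PairwiseCrossing X.graph Z) : Z ∈ X.cubes := by
  rcases (wallsOf X.graph Z).eq_empty_or_nonempty with hw | ⟨h, hh⟩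
  · exact mem_cubes_of_wallsOf_eq_empty hG hne hw
  by_cases hall : ∀ k ∈ wallsOf X.graph Z, k ≠ h → k = hᶜ
  · exact mem_cubes_of_unique_wall hG hC hh hall
  push Not at hall
  obtain ⟨k, hk, hkh, hkh'⟩ := hall
  exact mem_cubes_of_two_walls hG hC hZ hh hk hkh hkh'

theorem exists_invariant_cube {K : Type v} [Group K] [MulAction K V]
    (hadj : ∀ (g : K) (x y : V), X.graph.Adj x y → X.graph.Adj (g • x) (g • y)) {O : Set V}
    (hO : ∀ g : K, g • O = O) (hne : O.Nonempty) (hfin : O.Finite) :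
    ∃ c ∈ X.cubes, ∀ g : K, g • c = c := by
  obtain ⟨Z, hZ, hC, hZne, hZfin, hmin⟩ := hG.exists_minimal_invariant hadj
    (smul_halfspaceHull hG.connected hadj hO) (hG.convex_halfspaceHull O)
    (hne.mono (subset_halfspaceHull O)) (hG.finite_wallsOf_halfspaceHull hfin)
  exact ⟨Z, mem_cubes_of_pairwiseCrossing hG hC hZne
    (hG.pairwiseCrossing_of_minimalIn hC hZfin hmin), hZ⟩

end CubeComplex

end InvariantSets

/-! ## Combinatorics of reduced words -/

section Words

open FreeGroup

variable {S : Type v}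

/-- The inverse of a letter. -/
def invLetter (a : S × Bool) : S × Bool := (a.1, !a.2)

theorem invLetter_invLetter (a : S × Bool) : invLetter (invLetter a) = a := by
  simp [invLetter]

theorem ne_invLetter_comm {a b : S × Bool} : a ≠ invLetter b ↔ b ≠ invLetter a := by
  rw [not_iff_not]
  constructor <;> rintro rfl <;> rw [invLetter_invLetter]

theorem mk_invLetter (a : S × Bool) : mk [invLetter a] = (mk [a])⁻¹ := by
  simp [invLetter, inv_mk, invRev]

theorem freeGroup_mk_cons (a : S × Bool) (w : List (S × Bool)) : mk (a :: w) = mk [a] * mk w := by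
  simp [mul_mk]

theorem isReduced_pair_iff {a b : S × Bool} : IsReduced [a, b] ↔ b ≠ invLetter a := by
  obtain ⟨a, x⟩ := a
  obtain ⟨b, y⟩ := b
  cases x <;> cases y <;> simp [isReduced_cons_cons, invLetter, eq_comm]

theorem isReduced_append_cons {c : S × Bool} {l₁ l₂ : List (S × Bool)} :
    IsReduced (l₁ ++ c :: l₂) ↔ IsReduced (l₁ ++ [c]) ∧ IsReduced (c :: l₂) :=
  List.isChain_split

theorem isReduced_cons_cons_iff {a b : S × Bool} {l : List (S × Bool)} :
    IsReduced (a :: b :: l) ↔ b ≠ invLetter a ∧ IsReduced (b :: l) := by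
  rw [← isReduced_pair_iff]
  exact isReduced_append_cons (l₁ := [a])

theorem isReduced_cons_of_head? {a b : S × Bool} {l : List (S × Bool)} (hl : l.head? = some a)
    (h : IsReduced l) (hb : b ≠ invLetter a) : IsReduced (b :: l) := by
  obtain ⟨l, rfl⟩ := List.head?_eq_some_iff.1 hl
  exact isReduced_cons_cons_iff.2 ⟨ne_invLetter_comm.1 hb, h⟩

theorem exists_letter_notMem [Fintype S] {A : Finset (S × Bool)}
    (hA : A.card < 2 * Fintype.card S) : ∃ c, c ∉ A := by
  by_contra! h
  rw [Finset.eq_univ_iff_forall.2 h, Finset.card_univ, Fintype.card_prod, Fintype.card_bool] at hA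
  omega

/-- A block of `s` is a word which starts with `s` and may be followed by `s`, so that blocks can
be concatenated. The empty word is a block. -/
def IsBlock (s : S × Bool) (w : List (S × Bool)) : Prop :=
  IsReduced (w ++ [s]) ∧ (w ++ [s]).head? = some s

/-- A word is framed by `s` if it is reduced, starts with `s` and ends with `s`. -/
def IsFramed (s : S × Bool) (w : List (S × Bool)) : Prop :=
  IsReduced w ∧ w.head? = some s ∧ w.getLast? = some s

/-- The blocks of `s` of length `ℓ`. -/
def blocks (s : S × Bool) (ℓ : ℕ) : Set (List (S × Bool)) := {w | w.length = ℓ ∧ IsBlock s w}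

/-- The words of length `ℓ` framed by `s`. -/
def frames (s : S × Bool) (ℓ : ℕ) : Set (List (S × Bool)) := {w | w.length = ℓ ∧ IsFramed s w}

theorem blocks_finite [Finite S] (s : S × Bool) (ℓ : ℕ) : (blocks s ℓ).Finite :=
  (List.finite_length_eq _ ℓ).subset fun _ h => h.1

theorem frames_finite [Finite S] (s : S × Bool) (ℓ : ℕ) : (frames s ℓ).Finite :=
  (List.finite_length_eq _ ℓ).subset fun _ h => h.1

theorem IsBlock.append {s : S × Bool} {u v : List (S × Bool)} (hu : IsBlock s u)
    (hv : IsBlock s v) : IsBlock s (u ++ v) := by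
  obtain ⟨v', hv'⟩ : ∃ v', v ++ [s] = s :: v' := List.head?_eq_some_iff.1 hv.2
  unfold IsBlock
  rw [List.append_assoc, hv']
  exact ⟨isReduced_append_cons.2 ⟨hu.1, hv' ▸ hv.1⟩, by
    simpa only [List.head?_append, List.head?_cons] using hu.2⟩

theorem IsFramed.append_isBlock {s : S × Bool} {w y : List (S × Bool)} (h : IsFramed s w)
    (hy : IsReduced (s :: y ++ [s])) : IsBlock s (w ++ y) := by
  refine ⟨?_, by rw [List.append_assoc, List.head?_append, h.2.1, Option.some_or]⟩
  obtain ⟨v, rfl⟩ : ∃ v, w = v ++ [s] := List.getLast?_eq_some_iff.1 h.2.2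
  rw [List.append_assoc, List.append_assoc]
  exact isReduced_append_cons.2 ⟨h.1, hy⟩

theorem IsFramed.isBlock {s : S × Bool} {w : List (S × Bool)} (h : IsFramed s w) :
    IsBlock s w := by
  simpa using h.append_isBlock (y := []) (by simp [isReduced_cons_cons])

theorem IsBlock.append_isFramed {s : S × Bool} {x w : List (S × Bool)} (hx : IsBlock s x)
    (hw : IsFramed s w) : IsFramed s (x ++ w) := by
  refine ⟨?_, ?_, by rw [List.getLast?_append, hw.2.2, Option.some_or]⟩ <;>
    obtain ⟨w', rfl⟩ : ∃ w', w = s :: w' := List.head?_eq_some_iff.1 hw.2.1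
  · exact isReduced_append_cons.2 ⟨hx.1, hw.1⟩
  · simpa only [List.head?_append, List.head?_cons] using hx.2

open Classical in
/-- The words `w` of length `k` such that `s :: w` is reduced. -/
noncomputable def continuations [Fintype S] : ℕ → S × Bool → Finset (List (S × Bool))
  | 0, _ => {[]}
  | k + 1, s => (Finset.univ.erase (invLetter s)).biUnion fun a =>
      (continuations k a).image (List.cons a)

theorem mem_continuations [Fintype S] {k : ℕ} {s : S × Bool} {w : List (S × Bool)} :
    w ∈ continuations k s ↔ w.length = k ∧ IsReduced (s :: w) := by
  induction k generalizing s w with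
  | zero =>
    simp only [continuations, Finset.mem_singleton, List.length_eq_zero_iff]
    exact ⟨by rintro rfl; simp, And.left⟩
  | succ k ih =>
    cases w with
    | nil => simp [continuations]
    | cons a w =>
      simp only [continuations, Finset.mem_biUnion, Finset.mem_erase, Finset.mem_univ, and_true,
        Finset.mem_image, ih, List.cons.injEq, List.length_cons, isReduced_cons_cons_iff,
        Nat.add_right_cancel_iff]
      constructor
      · rintro ⟨b, hb, w', ⟨hlen, hw⟩, rfl, rfl⟩
        exact ⟨hlen, hb, hw⟩
      · rintro ⟨hlen, hb, hw⟩
        exact ⟨a, hb, w, ⟨hlen, hw⟩, rfl, rfl⟩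

theorem card_continuations [Fintype S] (k : ℕ) (s : S × Bool) :
    (continuations k s).card = (2 * Fintype.card S - 1) ^ k := by
  classical
  induction k generalizing s with
  | zero => simp [continuations]
  | succ k ih =>
    rw [continuations, Finset.card_biUnion]
    · rw [Finset.sum_congr rfl fun a _ => by
        rw [Finset.card_image_of_injective _ List.cons_injective, ih], Finset.sum_const,
        Finset.card_erase_of_mem (Finset.mem_univ _), Finset.card_univ, Fintype.card_prod,
        Fintype.card_bool, smul_eq_mul, pow_succ, mul_comm, mul_comm 2]
    · intro a _ b _ hab
      rw [Function.onFun, Finset.disjoint_left]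
      simp only [Finset.mem_image]
      rintro _ ⟨x, _, rfl⟩ ⟨y, _, h⟩
      exact hab (List.cons.inj h).1.symm

theorem exists_isFramed_append [Fintype S] (hS : 2 ≤ Fintype.card S) {s : S × Bool}
    {r : List (S × Bool)} (hr : IsReduced (s :: r)) : ∃ e, IsFramed s (s :: r ++ [e, s]) := by
  classical
  obtain ⟨v, a, hv⟩ : ∃ v a, s :: r = v ++ [a] :=
    ⟨_, _, (List.dropLast_append_getLast (List.cons_ne_nil s r)).symm⟩
  obtain ⟨e, he⟩ := exists_letter_notMem (A := {invLetter a, invLetter s})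
    (Finset.card_le_two.trans_lt (by omega))
  simp only [Finset.mem_insert, Finset.mem_singleton, not_or] at he
  refine ⟨e, ?_, rfl, List.getLast?_eq_some_iff.2 ⟨s :: r ++ [e], by simp⟩⟩
  rw [hv] at hr ⊢
  rw [List.append_assoc]
  refine isReduced_append_cons.2 ⟨hr, isReduced_cons_cons_iff.2 ⟨he.1, ?_⟩⟩
  exact isReduced_pair_iff.2 (ne_invLetter_comm.1 he.2)

theorem pow_le_ncard_frames [Fintype S] (hS : 2 ≤ Fintype.card S) (s : S × Bool) (k : ℕ) :
    (2 * Fintype.card S - 1) ^ k ≤ (frames s (k + 3)).ncard := by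
  have : Nonempty (S × Bool) := ⟨s⟩
  choose! e he using fun r (hr : IsReduced (s :: r)) => exists_isFramed_append hS hr
  rw [← card_continuations k s, ← Set.ncard_coe_finset]
  refine Set.ncard_le_ncard_of_injOn (fun r => s :: r ++ [e r, s]) (fun r hr => ?_) ?_
    (frames_finite s _)
  · obtain ⟨hlen, hr⟩ := mem_continuations.1 hr
    exact ⟨by simp [hlen], he r hr⟩
  · intro r hr r' hr' h
    have hlen : (s :: r).length = (s :: r').length := by
      simp [(mem_continuations.1 hr).1, (mem_continuations.1 hr').1]
    exact (List.cons.inj (List.append_inj h hlen).1).2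

theorem ncard_mul_le_ncard_of_append_mem {α : Type*} {A : Set (List α)} {a : ℕ}
    (hA : ∀ w ∈ A, w.length = a) (hfin : A.Finite) {B : List α → Set (List α)}
    {C : Set (List α)} (hC : C.Finite) (hsub : ∀ w ∈ A, ∀ v ∈ B w, w ++ v ∈ C) {c : ℝ}
    (hB : ∀ w ∈ A, c ≤ (B w).ncard) : A.ncard * c ≤ C.ncard := by
  classical
  have hfiber : ∀ w ∈ A, (B w).ncard ≤ (hC.toFinset.filter fun x => x.take a = w).card := by
    intro w hw
    rw [← Set.ncard_coe_finset]
    refine Set.ncard_le_ncard_of_injOn (fun v => w ++ v) (fun v hv => ?_)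
      (fun _ _ _ _ => List.append_cancel_left) (Finset.finite_toSet _)
    simpa [← hA w hw] using hsub w hw v hv
  have hdisjoint : ∑ w ∈ hfin.toFinset, (hC.toFinset.filter fun x => x.take a = w).card
      ≤ hC.toFinset.card := by
    rw [← Finset.card_biUnion]
    · exact Finset.card_le_card (Finset.biUnion_subset.2 fun w _ => Finset.filter_subset _ _)
    · intro x _ y _ hxy
      rw [Function.onFun, Finset.disjoint_left]
      simp only [Finset.mem_filter]
      rintro z ⟨_, hx⟩ ⟨_, hy⟩
      exact hxy (hx.symm.trans hy)
  rw [Set.ncard_eq_toFinset_card _ hfin, Set.ncard_eq_toFinset_card _ hC, ← nsmul_eq_mul,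
    ← Finset.sum_const]
  refine le_trans ?_ (Nat.cast_le.2 hdisjoint)
  rw [Nat.cast_sum]
  refine Finset.sum_le_sum fun w hw => ?_
  rw [hfin.mem_toFinset] at hw
  exact (hB w hw).trans (Nat.cast_le.2 (hfiber w hw))

end Words

/-! ## Walls moved to crossing walls by most words -/

section Walls

open FreeGroup

variable {S : Type v} {W : Type u} [MulAction (FreeGroup S) W]

theorem isReduced_replicate_append {c a : S × Bool} {l : List (S × Bool)} (hl : IsReduced l)
    (ha : l.head? = some a) (hca : c ≠ invLetter a) (m : ℕ) :
    IsReduced (List.replicate (m + 1) c ++ l) := by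
  induction m with
  | zero => exact isReduced_cons_of_head? ha hl hca
  | succ m ih =>
    refine isReduced_cons_cons_iff.2 ⟨fun h => ?_, ih⟩
    exact (Bool.not_ne_self c.2) (congrArg Prod.snd h).symm

/-- The words of length `i` which may be followed by the letter `s`. -/
def precursors (s : S × Bool) (i : ℕ) : Set (List (S × Bool)) :=
  {u | u.length = i ∧ IsReduced (u ++ [s])}

theorem exists_append_mem_blocks [Fintype S] (hS : 3 ≤ Fintype.card S) {s : S × Bool} {i m : ℕ}
    {u₁ u₂ u₃ : List (S × Bool)} (h₁ : u₁ ∈ precursors s i) (h₂ : u₂ ∈ precursors s i)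
    (h₃ : u₃ ∈ precursors s i) :
    ∃ z, ∀ u ∈ [u₁, u₂, u₃], z ++ u ∈ blocks s (i + m + 2) := by
  classical
  have exists_head : ∀ u : List (S × Bool), ∃ a, (u ++ [s]).head? = some a := fun u => by
    cases u <;> simp
  choose a ha using exists_head
  obtain ⟨c, hc⟩ := exists_letter_notMem (S := S)
    (A := {invLetter s, invLetter (a u₁), invLetter (a u₂), invLetter (a u₃)})
    (Finset.card_le_four.trans_lt (by omega))
  simp only [Finset.mem_insert, Finset.mem_singleton, not_or] at hc
  refine ⟨s :: List.replicate (m + 1) c, ?_⟩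
  have mem_blocks : ∀ u ∈ precursors s i, c ≠ invLetter (a u) →
      s :: List.replicate (m + 1) c ++ u ∈ blocks s (i + m + 2) := by
    rintro u ⟨hlen, hu⟩ hcu
    refine ⟨by simp [hlen]; omega, ?_, rfl⟩
    rw [List.cons_append, List.cons_append, List.append_assoc]
    exact isReduced_cons_cons_iff.2 ⟨hc.1, isReduced_replicate_append hu (ha u) hcu m⟩
  simp only [List.mem_cons, List.not_mem_nil, or_false]
  rintro u (rfl | rfl | rfl)
  exacts [mem_blocks _ h₁ hc.2.1, mem_blocks _ h₂ hc.2.2.1, mem_blocks _ h₃ hc.2.2.2]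

/-- The images of `J` under the words of length `i` which may be followed by `s`. -/
def wordValues (s : S × Bool) (J : W) (i : ℕ) : Set W := (fun u => mk u • J) '' precursors s i

theorem wordValues_finite [Finite S] (s : S × Bool) (J : W) (i : ℕ) :
    (wordValues s J i).Finite :=
  ((List.finite_length_eq (S × Bool) i).subset fun _ hu => hu.1).image _

theorem mem_wordValues_zero (s : S × Bool) (J : W) : J ∈ wordValues s J 0 :=
  ⟨[], ⟨rfl, by simp⟩, one_smul _ J⟩

theorem ncard_wordValues_le_two [Fintype S] (hS : 3 ≤ Fintype.card S) {s : S × Bool} {J H K : W}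
    {i m : ℕ} (h : ∀ x ∈ blocks s (i + m + 2), mk x • J = H ∨ mk x • J = K) :
    (wordValues s J i).ncard ≤ 2 := by
  by_contra! hlt
  obtain ⟨_, _, _, ⟨u₁, h₁, rfl⟩, ⟨u₂, h₂, rfl⟩, ⟨u₃, h₃, rfl⟩, ne₁₂, ne₁₃, ne₂₃⟩ :=
    (Set.two_lt_ncard_iff (wordValues_finite s J i)).1 hlt
  obtain ⟨z, hz⟩ := exists_append_mem_blocks hS (m := m) h₁ h₂ h₃
  have smul_eq : ∀ u ∈ [u₁, u₂, u₃], mk z • mk u • J = H ∨ mk z • mk u • J = K := by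
    intro u hu
    rw [← mul_smul, mul_mk]
    exact h _ (hz u hu)
  have hinj := MulAction.injective (β := W) (mk z)
  rcases smul_eq u₁ (by simp) with e₁ | e₁ <;> rcases smul_eq u₂ (by simp) with e₂ | e₂ <;>
    rcases smul_eq u₃ (by simp) with e₃ | e₃ <;>
    first
    | exact ne₁₂ (hinj (e₁.trans e₂.symm))
    | exact ne₁₃ (hinj (e₁.trans e₃.symm))
    | exact ne₂₃ (hinj (e₂.trans e₃.symm))

/-- Two letters `c ≠ d` in front of `u` lead to the same value, so that `u` may be replaced by
`c⁻¹du`. -/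
theorem exists_cons_mem_precursors [Fintype S] (hS : 3 ≤ Fintype.card S) {s : S × Bool} {J : W}
    {i : ℕ} (hcard : (wordValues s J (i + 1)).ncard ≤ 2) {v : W} (hv : v ∈ wordValues s J i)
    (a : S × Bool) : ∃ b u, b ≠ a ∧ b :: u ∈ precursors s (i + 2) ∧ mk (b :: u) • J = v := by
  classical
  obtain ⟨u, ⟨hlen, hu⟩, rfl⟩ := hv
  obtain ⟨t, ht⟩ : ∃ t, (u ++ [s]).head? = some t := by cases u <;> simp
  have cons_mem : ∀ c, c ≠ invLetter t → c :: u ∈ precursors s (i + 1) := fun c hc =>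
    ⟨by rw [List.length_cons, hlen], isReduced_cons_of_head? ht hu hc⟩
  have many_letters : 2 < (Finset.univ \ {invLetter a, invLetter t} : Finset (S × Bool)).card := by
    have := Finset.le_card_sdiff {invLetter a, invLetter t} (Finset.univ : Finset (S × Bool))
    have := Finset.card_le_two (a := invLetter a) (b := invLetter t)
    rw [Finset.card_univ, Fintype.card_prod, Fintype.card_bool] at *
    omega
  rw [Set.ncard_eq_toFinset_card _ (wordValues_finite s J _)] at hcard
  obtain ⟨c, hc, d, hd, hcd, e⟩ := Finset.exists_ne_map_eq_of_card_lt_of_maps_to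
    (hcard.trans_lt many_letters) (f := fun c => mk (c :: u) • J) (fun c hc => by
      have hc : c ≠ invLetter a ∧ c ≠ invLetter t := by simpa using hc
      exact (wordValues_finite s J _).mem_toFinset.2 ⟨_, cons_mem c hc.2, rfl⟩)
  have hc : c ≠ invLetter a ∧ c ≠ invLetter t := by simpa using hc
  have hd : d ≠ invLetter a ∧ d ≠ invLetter t := by simpa using hd
  refine ⟨invLetter c, d :: u, (ne_invLetter_comm.1 hc.1).symm,
    ⟨by rw [List.length_cons, (cons_mem d hd.2).1], isReduced_cons_cons_iff.2
      ⟨by rw [invLetter_invLetter]; exact hcd.symm, (cons_mem d hd.2).2⟩⟩, ?_⟩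
  dsimp only at e ⊢
  rw [freeGroup_mk_cons, mul_smul, ← e, freeGroup_mk_cons c, mul_smul, mk_invLetter, inv_smul_smul]

theorem wordValues_subset_add_two [Fintype S] (hS : 3 ≤ Fintype.card S) {s : S × Bool} {J : W}
    {i : ℕ} (hcard : (wordValues s J (i + 1)).ncard ≤ 2) :
    wordValues s J i ⊆ wordValues s J (i + 2) := by
  intro v hv
  obtain ⟨b, u, -, hu, rfl⟩ := exists_cons_mem_precursors hS hcard hv s
  exact ⟨b :: u, hu, rfl⟩

theorem smul_mem_wordValues_add_three [Fintype S] (hS : 3 ≤ Fintype.card S) {s : S × Bool} {J : W}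
    {i : ℕ} (hcard : (wordValues s J (i + 1)).ncard ≤ 2) (a : S × Bool) {v : W}
    (hv : v ∈ wordValues s J i) : mk [a] • v ∈ wordValues s J (i + 3) := by
  obtain ⟨b, u, hb, ⟨hlen, hu⟩, rfl⟩ := exists_cons_mem_precursors hS hcard hv (invLetter a)
  refine ⟨a :: b :: u, ⟨by rw [List.length_cons, hlen], isReduced_cons_cons_iff.2 ⟨hb, hu⟩⟩, ?_⟩
  dsimp only
  rw [freeGroup_mk_cons, mul_smul]

theorem exists_eq_succ_of_ncard_le {α : Type*} {f : ℕ → Set α} {n : ℕ}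
    (hfin : ∀ m, (f m).Finite) (hmono : ∀ m ≤ n, f m ⊆ f (m + 1)) (hne : (f 0).Nonempty)
    (hcard : (f (n + 1)).ncard ≤ n + 1) : ∃ m ≤ n, f (m + 1) = f m := by
  by_contra! hstrict
  have lt_ncard : ∀ m ≤ n + 1, m < (f m).ncard := by
    intro m
    induction m with
    | zero => exact fun _ => (Set.ncard_pos (hfin 0)).2 hne
    | succ m ih =>
      intro hm
      have := Set.ncard_lt_ncard ((hmono m (by omega)).ssubset_of_ne
        (hstrict m (by omega)).symm) (hfin _)
      have := ih (by omega)
      omega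
  exact (lt_ncard (n + 1) le_rfl).not_ge hcard

theorem smul_mem_of_forall_letter {Y : Type*} [MulAction (FreeGroup S) Y] {Ω : Set Y}
    (hmul : ∀ a : S × Bool, ∀ v ∈ Ω, mk [a] • v ∈ Ω) (g : FreeGroup S) :
    ∀ v ∈ Ω, g • v ∈ Ω := by
  induction g using Quot.inductionOn with
  | h w =>
  change ∀ v ∈ Ω, mk w • v ∈ Ω
  induction w with
  | nil => exact fun v hv => (one_smul (FreeGroup S) v).symm ▸ hv
  | cons a w ih =>
    intro v hv
    rw [freeGroup_mk_cons, mul_smul]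
    exact hmul a _ (ih v hv)

/-- The set of values of words of length `4m` or `4m + 1` grows with `m` and has at most four
elements, so it stabilizes at some `m ≤ 3`; being then closed under all letters, it contains the
orbit. -/
theorem orbit_finite_of_ncard_wordValues_le_two [Fintype S] (hS : 3 ≤ Fintype.card S)
    {s : S × Bool} {J : W} (hcard : ∀ i ≤ 17, (wordValues s J i).ncard ≤ 2) :
    (MulAction.orbit (FreeGroup S) J).Finite := by
  have subset_add_two : ∀ i ≤ 16, wordValues s J i ⊆ wordValues s J (i + 2) := fun i hi =>
    wordValues_subset_add_two hS (hcard _ (by omega))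
  have subset_add_four : ∀ i ≤ 14, wordValues s J i ⊆ wordValues s J (i + 4) := fun i hi =>
    (subset_add_two i (by omega)).trans (subset_add_two (i + 2) (by omega))
  let f : ℕ → Set W := fun m => wordValues s J (4 * m) ∪ wordValues s J (4 * m + 1)
  have f_finite : ∀ m, (f m).Finite := fun m =>
    (wordValues_finite s J _).union (wordValues_finite s J _)
  have f_card : (f 4).ncard ≤ 2 + 2 := (Set.ncard_union_le _ _).trans
    (Nat.add_le_add (hcard 16 (by omega)) (hcard 17 (by omega)))
  obtain ⟨m, hm, hf⟩ := exists_eq_succ_of_ncard_le (n := 3) f_finite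
    (fun m hm => Set.union_subset_union (subset_add_four _ (by omega))
      (subset_add_four _ (by omega)))
    ⟨J, .inl (mem_wordValues_zero s J)⟩ f_card
  have J_mem : ∀ l ≤ 3, J ∈ wordValues s J (4 * l) := by
    intro l
    induction l with
    | zero => exact fun _ => mem_wordValues_zero s J
    | succ l ih => exact fun hl => subset_add_four (4 * l) (by omega) (ih (by omega))
  have smul_letter_mem : ∀ a : S × Bool, ∀ v ∈ f m, mk [a] • v ∈ f m := by
    rintro a v (hv | hv) <;> rw [← hf]
    · exact .inr (subset_add_two (4 * m + 3) (by omega)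
        (smul_mem_wordValues_add_three hS (hcard _ (by omega)) a hv))
    · exact .inl (smul_mem_wordValues_add_three hS (hcard (4 * m + 2) (by omega)) a hv)
  refine (f_finite m).subset ?_
  rintro _ ⟨g, rfl⟩
  exact smul_mem_of_forall_letter smul_letter_mem g J (.inl (J_mem m hm))

theorem orbit_finite_of_two_values [Fintype S] (hS : 3 ≤ Fintype.card S) {s : S × Bool}
    {J H K : W} (h : ∀ x ∈ blocks s 21, mk x • J = H ∨ mk x • J = K) :
    (MulAction.orbit (FreeGroup S) J).Finite := by
  refine orbit_finite_of_ncard_wordValues_le_two hS (s := s) fun i hi => ?_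
  refine ncard_wordValues_le_two hS (m := 19 - i) (H := H) (K := K) ?_
  rwa [show i + (19 - i) + 2 = 21 by omega]

/-- The framed words of length `ℓ` which move the wall `H` to a different wall not crossing it. -/
def strayFrames (Cr : W → W → Prop) (s : S × Bool) (H : W) (ℓ : ℕ) : Set (List (S × Bool)) :=
  {w ∈ frames s ℓ | mk w • H ≠ H ∧ ¬ Cr H (mk w • H)}

theorem sep_frames_finite [Finite S] {s : S × Bool} {ℓ : ℕ} (p : List (S × Bool) → Prop) :
    {w ∈ frames s ℓ | p w}.Finite :=
  (frames_finite s ℓ).subset fun _ hw => hw.1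

theorem ncard_le_add_of_subset_union {α : Type*} {A B C : Set α} (h : A ⊆ B ∪ C) (hB : B.Finite)
    (hC : C.Finite) : (A.ncard : ℝ) ≤ B.ncard + C.ncard := by
  exact_mod_cast (Set.ncard_le_ncard h (hB.union hC)).trans (Set.ncard_union_le B C)

section Crossing

variable {s : S × Bool} {H : W} {Cr : W → W → Prop} {b : ℕ}

/-- If `wH` and `w₁H` cross `H`, then `w₁wH` crosses `w₁H`, and therefore does not cross `H`. -/
theorem frames_subset_strayFrames_union
    (hCr : ∀ (g : FreeGroup S) (A B : W), Cr A B → Cr (g • A) (g • B))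
    (hrank : ∀ A B C, Cr A B → Cr A C → Cr B C → False) {w₁ : List (S × Bool)}
    (hw₁ : w₁ ∈ frames s b) (hcross : Cr H (mk w₁ • H)) :
    {w ∈ frames s b | mk w • H ≠ H ∧ mk w • H ≠ (mk w₁)⁻¹ • H} ⊆
      strayFrames Cr s H b ∪ {w ∈ frames s b | w₁ ++ w ∈ strayFrames Cr s H (2 * b)} := by
  rintro w ⟨hw, hne, hne'⟩
  by_cases hc : Cr H (mk w • H)
  · right
    have smul_append : mk (w₁ ++ w) • H = mk w₁ • mk w • H := by rw [← mul_smul, mul_mk]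
    refine ⟨hw, ⟨?_, hw₁.2.isBlock.append_isFramed hw.2⟩, ?_, fun hc' => ?_⟩
    · rw [List.length_append, hw.1, hw₁.1, two_mul]
    · rw [smul_append]
      exact fun e => hne' (eq_inv_smul_iff.2 e)
    · rw [smul_append] at hc'
      exact hrank _ _ _ hcross hc' (hCr _ _ _ hc)
  · exact .inl ⟨hw, hne, hc⟩

theorem exists_crossing_frame [Finite S] {τ : ℝ} (hτ : 0 < τ)
    (hmany : τ ^ (b + 3) ≤ {w ∈ frames s b | mk w • H ≠ H ∧ Cr H (mk w • H)}.ncard)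
    (hfew : ((strayFrames Cr s H (2 * b)).ncard : ℝ) < 4 * τ ^ (2 * b + 3)) :
    ∃ w₁ ∈ frames s b, Cr H (mk w₁ • H) ∧
      ({w ∈ frames s b | w₁ ++ w ∈ strayFrames Cr s H (2 * b)}.ncard : ℝ) < 4 * τ ^ b := by
  set M := {w ∈ frames s b | mk w • H ≠ H ∧ Cr H (mk w • H)}
  by_contra! hall
  have hprod : M.ncard * (4 * τ ^ b) ≤ ((strayFrames Cr s H (2 * b)).ncard : ℝ) :=
    ncard_mul_le_ncard_of_append_mem (fun w (hw : w ∈ M) => hw.1.1) (sep_frames_finite _)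
      (B := fun w₁ => {w ∈ frames s b | w₁ ++ w ∈ strayFrames Cr s H (2 * b)})
      (sep_frames_finite _) (fun w _ v hv => hv.2) fun w hw => hall w hw.1 hw.2.2
  refine absurd (hprod.trans_lt hfew) (not_lt.2 ?_)
  calc 4 * τ ^ (2 * b + 3) = τ ^ (b + 3) * (4 * τ ^ b) := by ring
    _ ≤ M.ncard * (4 * τ ^ b) := by gcongr

theorem exists_second_value [Finite S] {τ : ℝ} (hτ : 1 ≤ τ)
    (hCr : ∀ (g : FreeGroup S) (A B : W), Cr A B → Cr (g • A) (g • B))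
    (hrank : ∀ A B C, Cr A B → Cr A C → Cr B C → False)
    (hfew : ((strayFrames Cr s H b).ncard : ℝ) < 4 * τ ^ (b + 3))
    (hfew' : ((strayFrames Cr s H (2 * b)).ncard : ℝ) < 4 * τ ^ (2 * b + 3)) :
    ∃ K : W, ({w ∈ frames s b | mk w • H ≠ H ∧ mk w • H ≠ K}.ncard : ℝ) < 8 * τ ^ (b + 3) := by
  have hτ0 : 0 < τ ^ (b + 3) := by positivity
  by_cases hmany : τ ^ (b + 3) ≤ {w ∈ frames s b | mk w • H ≠ H ∧ Cr H (mk w • H)}.ncard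
  · obtain ⟨w₁, hw₁, hcross, hlt⟩ := exists_crossing_frame (by positivity) hmany hfew'
    refine ⟨(mk w₁)⁻¹ • H, (ncard_le_add_of_subset_union
      (frames_subset_strayFrames_union hCr hrank hw₁ hcross) (sep_frames_finite _)
      (sep_frames_finite _)).trans_lt ?_⟩
    have : τ ^ b ≤ τ ^ (b + 3) := pow_le_pow_right₀ hτ (by omega)
    linarith
  · refine ⟨H, (ncard_le_add_of_subset_union (B := strayFrames Cr s H b)
      (C := {w ∈ frames s b | mk w • H ≠ H ∧ Cr H (mk w • H)}) ?_ (sep_frames_finite _)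
      (sep_frames_finite _)).trans_lt (by linarith)⟩
    rintro w ⟨hw, hne, -⟩
    by_cases hc : Cr H (mk w • H)
    exacts [.inr ⟨hw, hne, hc⟩, .inl ⟨hw, hne, hc⟩]

end Crossing

/-- A block of length `21` followed by a framed word of length `k + 3` is framed. Since there are at
least `(2n - 1) ^ k` framed words of length `k + 3`, one of them has no exceptional extension. -/
theorem orbit_finite_of_second_value [Fintype S] (hS : 3 ≤ Fintype.card S) {s : S × Bool} {k : ℕ}
    {H K : W} (hK : {w ∈ frames s (k + 24) | mk w • H ≠ H ∧ mk w • H ≠ K}.ncard <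
      (2 * Fintype.card S - 1) ^ k) : (MulAction.orbit (FreeGroup S) H).Finite := by
  set E := {w ∈ frames s (k + 24) | mk w • H ≠ H ∧ mk w • H ≠ K}
  obtain ⟨w', hw', hgood⟩ : ∃ w' ∈ frames s (k + 3), ∀ x ∈ blocks s 21, x ++ w' ∉ E := by
    by_contra! hall
    choose! x hx hxE using hall
    refine hK.not_ge ((pow_le_ncard_frames (by omega) s k).trans
      (Set.ncard_le_ncard_of_injOn (fun w => x w ++ w) hxE (fun w hw v hv e => ?_)
        (sep_frames_finite _)))
    exact (List.append_inj e ((hx w hw).1.trans (hx v hv).1.symm)).2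
  rw [← MulAction.orbit_smul (mk w')]
  refine orbit_finite_of_two_values hS (s := s) (H := H) (K := K) fun x hx => ?_
  by_contra! hne
  refine hgood x hx ⟨⟨?_, hx.2.append_isFramed hw'.2⟩, by rwa [← mul_mk, mul_smul]⟩
  rw [List.length_append, hx.1, hw'.1]
  omega

theorem orbit_finite_of_few_strayFrames [Fintype S] (hS : 3 ≤ Fintype.card S) {s : S × Bool}
    {τ : ℝ} (hτ : 1 ≤ τ) {k : ℕ} (hk : 8 * τ ^ (k + 27) ≤ ((2 * Fintype.card S - 1 : ℕ) : ℝ) ^ k)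
    {H : W} {Cr : W → W → Prop} (hCr : ∀ (g : FreeGroup S) (A B : W), Cr A B → Cr (g • A) (g • B))
    (hrank : ∀ A B C, Cr A B → Cr A C → Cr B C → False)
    (hfew : ∀ ℓ, (ℓ = k + 24 ∨ ℓ = 2 * (k + 24)) →
      ((strayFrames Cr s H ℓ).ncard : ℝ) < 4 * τ ^ (ℓ + 3)) :
    (MulAction.orbit (FreeGroup S) H).Finite := by
  obtain ⟨K, hK⟩ := exists_second_value hτ hCr hrank (hfew _ (.inl rfl)) (hfew _ (.inr rfl))
  refine orbit_finite_of_second_value hS (s := s) (k := k) (K := K) ?_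
  exact_mod_cast hK.trans_le hk

end Walls

/-! ## Finite orbits for actions on halfspaces of rank two -/

section HalfspaceSystems

open FreeGroup

open scoped Pointwise

/-- The properties of the halfspaces of a two-dimensional `CAT(0)` cube complex needed to find
a finite orbit. -/
structure HalfspaceSystem (G : Type v) {V : Type u} [Group G] [MulAction G V]
    (ℋ : Set (Set V)) : Prop where
  compl_mem : ∀ h ∈ ℋ, hᶜ ∈ ℋ
  smul_mem : ∀ (g : G), ∀ h ∈ ℋ, g • h ∈ ℋ
  finite_separating : ∀ x y, {h ∈ ℋ | x ∈ h ∧ y ∉ h}.Finite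
  exists_separating : ∀ x y, x ≠ y → ∃ h ∈ ℋ, x ∉ h ∧ y ∈ h
  not_three_crossing : ∀ h₁ ∈ ℋ, ∀ h₂ ∈ ℋ, ∀ h₃ ∈ ℋ,
    Crosses h₁ h₂ → Crosses h₁ h₃ → Crosses h₂ h₃ → False
  helly : ∀ T ⊆ ℋ, (∀ y, {h ∈ T | y ∈ h}.Finite) →
    (∀ h ∈ T, ∀ k ∈ T, (hᶜ ∩ kᶜ).Nonempty) → ∃ y, ∀ h ∈ T, y ∉ h

theorem smul_ssubset_smul {G V : Type*} [Group G] [MulAction G V] {h k : Set V} (hk : h ⊂ k)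
    (g : G) : g • h ⊂ g • k :=
  ⟨Set.smul_set_mono hk.1, fun e => hk.2 (Set.smul_set_subset_smul_set_iff.1 e)⟩

section Walls

variable {V : Type u} {h k : Set V}

theorem Crosses.compl_left (hc : Crosses h k) : Crosses hᶜ k := by
  unfold Crosses at *
  rw [compl_compl]
  tauto

theorem Crosses.symm (hc : Crosses h k) : Crosses k h := by
  unfold Crosses at *
  rw [Set.inter_comm k h, Set.inter_comm k, Set.inter_comm kᶜ, Set.inter_comm kᶜ]
  tauto

theorem Crosses.smul {G : Type*} [Group G] [MulAction G V] (hc : Crosses h k) (g : G) :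
    Crosses (g • h) (g • k) := by
  unfold Crosses at *
  simp only [← Set.smul_set_compl, ← Set.smul_set_inter, Set.smul_set_nonempty]
  exact hc

theorem crosses_of_not_ssubset (hne : k ≠ h) (hne' : k ≠ hᶜ) (h₁ : ¬ k ⊂ hᶜ) (h₂ : ¬ kᶜ ⊂ h)
    (h₃ : ¬ k ⊂ h) (h₄ : ¬ kᶜ ⊂ hᶜ) : Crosses h k := by
  have inter_nonempty : ∀ {p r : Set V}, p ≠ r → ¬ p ⊂ r → (rᶜ ∩ p).Nonempty :=
    fun {p r} hpr hss => by
      rw [Set.inter_comm, Set.inter_compl_nonempty_iff]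
      exact fun hs => hss (hs.ssubset_of_ne hpr)
  refine ⟨?_, ?_, inter_nonempty hne h₃, ?_⟩
  · simpa using inter_nonempty hne' h₁
  · simpa using inter_nonempty (fun e => hne (compl_injective e)) h₄
  · exact inter_nonempty (fun e => hne' (compl_eq_comm.1 e).symm) h₂

/-- The wall bounding a halfspace: the halfspace together with its complement. -/
def wall (h : Set V) : Set (Set V) := {h, hᶜ}

theorem wall_compl (h : Set V) : wall hᶜ = wall h := by
  rw [wall, compl_compl, Set.pair_comm, wall]

theorem smul_wall {G : Type*} [Group G] [MulAction G V] (g : G) (h : Set V) :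
    g • wall h = wall (g • h) := by
  rw [wall, wall, ← Set.image_smul, Set.image_pair, Set.smul_set_compl]

theorem eq_or_eq_compl_of_wall_eq (e : wall h = wall k) : k = h ∨ k = hᶜ := by
  have : k ∈ wall h := e ▸ Set.mem_insert _ _
  simpa [wall] using this

theorem orbit_finite_of_orbit_wall_finite {G : Type*} [Group G] [MulAction G V]
    (hfin : (MulAction.orbit G (wall h)).Finite) : (MulAction.orbit G h).Finite := by
  refine (Set.Finite.sUnion hfin ?_).subset ?_
  · rintro _ ⟨g, rfl⟩
    dsimp only
    rw [smul_wall]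
    exact (Set.finite_singleton _).insert _
  · rintro _ ⟨g, rfl⟩
    refine ⟨g • wall h, ⟨g, rfl⟩, ?_⟩
    rw [smul_wall]
    exact Set.mem_insert _ _

theorem orbit_compl_finite {G : Type*} [Group G] [MulAction G V]
    (hfin : (MulAction.orbit G h).Finite) : (MulAction.orbit G hᶜ).Finite := by
  refine (hfin.image compl).subset ?_
  rintro _ ⟨g, rfl⟩
  exact ⟨g • h, ⟨g, rfl⟩, Set.smul_set_compl.symm⟩

/-- Two walls cross if they bound crossing halfspaces of the family `ℋ`. -/
def WallsCross (ℋ : Set (Set V)) (A B : Set (Set V)) : Prop :=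
  ∃ h ∈ ℋ, ∃ k ∈ ℋ, A = wall h ∧ B = wall k ∧ Crosses h k

variable {ℋ : Set (Set V)}

theorem WallsCross.crosses (hc : WallsCross ℋ (wall h) (wall k)) : Crosses h k := by
  obtain ⟨h', -, k', -, e, e', hc⟩ := hc
  rcases eq_or_eq_compl_of_wall_eq e with rfl | rfl <;>
    rcases eq_or_eq_compl_of_wall_eq e' with rfl | rfl
  · exact hc
  · simpa using hc.symm.compl_left.symm
  · simpa using hc.compl_left
  · simpa using hc.compl_left.symm.compl_left.symm

variable {G : Type v} [Group G] [MulAction G V]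

theorem HalfspaceSystem.wallsCross_smul (hH : HalfspaceSystem G ℋ) (g : G) {A B : Set (Set V)}
    (hc : WallsCross ℋ A B) : WallsCross ℋ (g • A) (g • B) := by
  obtain ⟨h, hh, k, hk, rfl, rfl, hc⟩ := hc
  exact ⟨g • h, hH.smul_mem g h hh, g • k, hH.smul_mem g k hk, smul_wall _ _, smul_wall _ _,
    hc.smul g⟩

theorem HalfspaceSystem.not_three_wallsCross (hH : HalfspaceSystem G ℋ) {A B C : Set (Set V)}
    (hAB : WallsCross ℋ A B) (hAC : WallsCross ℋ A C) (hBC : WallsCross ℋ B C) : False := by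
  obtain ⟨h, hh, k, hk, rfl, rfl, hhk⟩ := hAB
  have hAC' := hAC
  obtain ⟨-, -, l, hl, -, rfl, -⟩ := hAC'
  exact hH.not_three_crossing h hh k hk l hl hhk hAC.crosses hBC.crosses

end Walls

variable {S : Type v} {V : Type u} [MulAction (FreeGroup S) V]

/-- Many framed words of length `b` or `2 * b` map `h` into its complement. Two such words, joined
by connectors of length at most `3`, give many blocks: this is what the `+ 3` pays for. -/
def IsReversed (s : S × Bool) (τ : ℝ) (b : ℕ) (h : Set V) : Prop :=
  ∃ ℓ, (ℓ = b ∨ ℓ = 2 * b) ∧ τ ^ (ℓ + 3) ≤ ({w ∈ frames s ℓ | mk w • h ⊂ hᶜ}.ncard : ℝ)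

/-- Few blocks of length at most `Λ` shrink `h`. -/
def FewContractions (s : S × Bool) (τ : ℝ) (Λ : ℕ) (h : Set V) : Prop :=
  ∀ ℓ, 1 ≤ ℓ → ℓ ≤ Λ → ({w ∈ blocks s ℓ | mk w • h ⊂ h}.ncard : ℝ) < τ ^ ℓ

/-- Words which may be inserted, together with their inverses, between two letters `s`. -/
def IsConnector (s : S × Bool) (y : List (S × Bool)) : Prop :=
  IsReduced (s :: y ++ [s]) ∧ IsReduced (s :: invRev y ++ [s]) ∧ y.length ≤ 3

theorem isConnector_nil (s : S × Bool) : IsConnector s [] := by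
  simp [IsConnector, isReduced_cons_cons]

theorem isConnector_singleton {s t : S × Bool} (h : s.1 ≠ t.1) : IsConnector s [t] := by
  simp [IsConnector, isReduced_cons_cons, invRev, h, h.symm]

theorem isConnector_conj {s t : S × Bool} (h : s.1 ≠ t.1) : IsConnector s [t, s, t] := by
  simp [IsConnector, isReduced_cons_cons, invRev, h, h.symm]

theorem isConnector_invRev {s : S × Bool} {y : List (S × Bool)} (h : IsConnector s y) :
    IsConnector s (invRev y) :=
  ⟨h.2.1, by rw [invRev_invRev]; exact h.1, by rw [invRev_length]; exact h.2.2⟩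

theorem eq_or_eq_invLetter {a b : S × Bool} (h : a.1 = b.1) : a = b ∨ a = invLetter b := by
  rcases Bool.eq_or_eq_not a.2 b.2 with h' | h'
  exacts [.inl (Prod.ext h h'), .inr (Prod.ext h h')]

theorem smul_mem_of_forall_connector {Y : Type*} [MulAction (FreeGroup S) Y] [Nontrivial S]
    {s : S × Bool} {T : Set Y} (hT : ∀ y, IsConnector s y → ∀ h ∈ T, mk y • h ∈ T)
    (g : FreeGroup S) : ∀ h ∈ T, g • h ∈ T := by
  obtain ⟨t₁, ht₁⟩ := exists_ne s.1
  let t : S × Bool := (t₁, true)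
  have hst : s.1 ≠ t.1 := ht₁.symm
  let M : Submonoid (FreeGroup S) :=
    { carrier := {g | ∀ h ∈ T, g • h ∈ T}
      one_mem' := fun h hh => (one_smul (FreeGroup S) h).symm ▸ hh
      mul_mem' := fun {g g'} hg hg' h hh => mul_smul g g' h ▸ hg _ (hg' h hh) }
  have connector_mem : ∀ y, IsConnector s y → mk y ∈ M := hT
  have mk_conj : mk [t, s, t] = mk [t] * mk [s] * mk [t] := by simp only [mul_mk]; rfl
  have t_mem : mk [t] ∈ M := connector_mem _ (isConnector_singleton hst)
  have t_inv_mem : (mk [t])⁻¹ ∈ M :=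
    mk_invLetter t ▸ connector_mem [invLetter t] (isConnector_singleton hst)
  refine smul_mem_of_forall_letter (fun a => show mk [a] ∈ M from ?_) g
  by_cases has : a.1 = s.1
  · rcases eq_or_eq_invLetter has with rfl | rfl
    · have := M.mul_mem (M.mul_mem t_inv_mem (connector_mem _ (isConnector_conj hst))) t_inv_mem
      rw [mk_conj] at this
      convert this using 1
      group
    · have := M.mul_mem (M.mul_mem t_mem
        (connector_mem _ (isConnector_invRev (isConnector_conj hst)))) t_mem
      rw [← inv_mk, mk_conj] at this
      rw [mk_invLetter]
      convert this using 1
      group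
  · exact connector_mem _ (isConnector_singleton (Ne.symm has))

section Reversed

variable [Finite S] {s : S × Bool} {τ : ℝ} {b : ℕ} {h k : Set V}

theorem FewContractions.ncard_frames_lt {Λ ℓ : ℕ} (hN : FewContractions s τ Λ h) (hℓ : 1 ≤ ℓ)
    (hℓ' : ℓ ≤ Λ) : ({w ∈ frames s ℓ | mk w • h ⊂ h}.ncard : ℝ) < τ ^ ℓ := by
  refine lt_of_le_of_lt (Nat.cast_le.2 (Set.ncard_le_ncard ?_ ?_)) (hN ℓ hℓ hℓ')
  · exact fun w hw => ⟨⟨hw.1.1, hw.1.2.isBlock⟩, hw.2⟩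
  · exact (blocks_finite s ℓ).subset fun _ hw => hw.1

theorem FewContractions.not_forall_smul_ssubset (hτ : 1 ≤ τ) (hb : 1 ≤ b)
    (hN : FewContractions s τ (4 * b + 6) h) {y : List (S × Bool)} (hy : IsConnector s y)
    {ℓ₁ ℓ₂ : ℕ} (hℓ₁ : ℓ₁ = b ∨ ℓ₁ = 2 * b) (hℓ₂ : ℓ₂ = b ∨ ℓ₂ = 2 * b)
    {A B : Set (List (S × Bool))} (hA : A ⊆ frames s ℓ₁) (hB : B ⊆ frames s ℓ₂)
    (hAcard : τ ^ (ℓ₁ + 3) ≤ (A.ncard : ℝ)) (hBcard : τ ^ (ℓ₂ + 3) ≤ (B.ncard : ℝ)) :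
    ¬ ∀ w₁ ∈ A, ∀ w₂ ∈ B, mk (w₁ ++ invRev y ++ (w₂ ++ y)) • h ⊂ h := by
  intro hall
  have hlen := hy.2.2
  set C := {w ∈ blocks s (ℓ₁ + ℓ₂ + 2 * y.length) | mk w • h ⊂ h}
  have append_mem : ∀ w ∈ (· ++ invRev y) '' A, ∀ v ∈ (· ++ y) '' B, w ++ v ∈ C := by
    rintro _ ⟨w, hw, rfl⟩ _ ⟨v, hv, rfl⟩
    refine ⟨⟨?_, ((hA hw).2.append_isBlock hy.2.1).append ((hB hv).2.append_isBlock hy.1)⟩,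
      hall w hw v hv⟩
    simp only [List.length_append, invRev_length, (hA hw).1, (hB hv).1]
    omega
  have ncard_mul_le : (A.ncard : ℝ) * B.ncard ≤ C.ncard := by
    have := ncard_mul_le_ncard_of_append_mem (a := ℓ₁ + y.length)
      (by rintro _ ⟨w, hw, rfl⟩; simp [(hA hw).1]) (((frames_finite s ℓ₁).subset hA).image _)
      ((blocks_finite s _).subset fun _ hw => hw.1) append_mem fun _ _ => le_rfl
    rwa [Set.ncard_image_of_injective _ (List.append_left_injective _),
      Set.ncard_image_of_injective _ (List.append_left_injective _)] at this
  refine (hN (ℓ₁ + ℓ₂ + 2 * y.length) (by omega) (by omega)).not_ge ?_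
  calc τ ^ (ℓ₁ + ℓ₂ + 2 * y.length) ≤ τ ^ (ℓ₁ + 3 + (ℓ₂ + 3)) :=
        pow_le_pow_right₀ hτ (by omega)
    _ = τ ^ (ℓ₁ + 3) * τ ^ (ℓ₂ + 3) := pow_add _ _ _
    _ ≤ A.ncard * B.ncard := by gcongr
    _ ≤ C.ncard := ncard_mul_le

theorem IsReversed.not_isReversed_smul_compl (hτ : 1 ≤ τ) (hb : 1 ≤ b)
    (hN : FewContractions s τ (4 * b + 6) hᶜ) {y : List (S × Bool)} (hy : IsConnector s y)
    (hr : IsReversed s τ b h) : ¬ IsReversed s τ b (mk y • hᶜ) := by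
  obtain ⟨ℓ₁, hℓ₁, hc₁⟩ := hr
  rintro ⟨ℓ₂, hℓ₂, hc₂⟩
  refine hN.not_forall_smul_ssubset hτ hb hy hℓ₁ hℓ₂ (fun _ hw => hw.1) (fun _ hw => hw.1)
    hc₁ hc₂ ?_
  rintro w₁ ⟨-, hw₁⟩ w₂ ⟨-, hw₂⟩
  simp only [← mul_mk, ← inv_mk, mul_smul]
  rw [← Set.smul_set_compl, compl_compl] at hw₂
  have hss := smul_ssubset_smul (smul_ssubset_smul hw₂ (mk y)⁻¹) (mk w₁)
  rw [inv_smul_smul] at hss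
  exact hss.trans hw₁

theorem IsReversed.compl_inter_compl_nonempty (hτ : 1 ≤ τ) (hb : 1 ≤ b)
    (hN : FewContractions s τ (4 * b + 6) h) (hh : IsReversed s τ b h)
    (hk : IsReversed s τ b k) : (hᶜ ∩ kᶜ).Nonempty := by
  obtain ⟨ℓ₁, hℓ₁, hc₁⟩ := hh
  obtain ⟨ℓ₂, hℓ₂, hc₂⟩ := hk
  rw [Set.inter_compl_nonempty_iff]
  intro hhk
  refine hN.not_forall_smul_ssubset hτ hb (isConnector_nil s) hℓ₂ hℓ₁ (fun _ hw => hw.1)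
    (fun _ hw => hw.1) hc₂ hc₁ ?_
  rintro w₁ ⟨-, hw₁⟩ w₂ ⟨-, hw₂⟩
  simp only [invRev_empty, List.append_nil, ← mul_mk, mul_smul]
  exact (smul_ssubset_smul (hw₂.trans_subset hhk) (mk w₁)).trans
    (hw₁.trans_subset (Set.compl_subset_comm.1 hhk))

end Reversed

variable {ℋ : Set (Set V)}

theorem HalfspaceSystem.strayFrames_wall_subset (hH : HalfspaceSystem (FreeGroup S) ℋ)
    {h : Set V} (hh : h ∈ ℋ) (s : S × Bool) (ℓ : ℕ) :
    strayFrames (WallsCross ℋ) s (wall h) ℓ ⊆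
      ({w ∈ frames s ℓ | FreeGroup.mk w • h ⊂ hᶜ} ∪
        {w ∈ frames s ℓ | FreeGroup.mk w • hᶜ ⊂ hᶜᶜ}) ∪
      ({w ∈ frames s ℓ | FreeGroup.mk w • h ⊂ h} ∪
        {w ∈ frames s ℓ | FreeGroup.mk w • hᶜ ⊂ hᶜ}) := by
  rintro w ⟨hw, hne, hnc⟩
  rw [smul_wall] at hne hnc
  by_contra hn
  simp only [Set.mem_union, Set.mem_ofPred_eq, not_or, hw, true_and, Set.smul_set_compl,
    compl_compl] at hn
  obtain ⟨⟨h₁, h₂⟩, h₃, h₄⟩ := hn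
  refine hnc ⟨h, hh, FreeGroup.mk w • h, hH.smul_mem _ h hh, rfl, rfl, crosses_of_not_ssubset ?_ ?_
    h₁ h₂ h₃ h₄⟩
  · exact fun e => hne (by rw [e])
  · exact fun e => hne (by rw [e, wall_compl])

theorem HalfspaceSystem.orbit_finite_of_not_isReversed [Fintype S] (hS : 3 ≤ Fintype.card S)
    {s : S × Bool} {τ : ℝ} (hτ : 1 ≤ τ) {k : ℕ}
    (hk : 8 * τ ^ (k + 27) ≤ ((2 * Fintype.card S - 1 : ℕ) : ℝ) ^ k)
    (hH : HalfspaceSystem (FreeGroup S) ℋ)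
    (hN : ∀ h ∈ ℋ, FewContractions s τ (4 * (k + 24) + 6) h) {h : Set V} (hh : h ∈ ℋ)
    (hr : ¬ IsReversed s τ (k + 24) h) (hr' : ¬ IsReversed s τ (k + 24) hᶜ) :
    (MulAction.orbit (FreeGroup S) h).Finite := by
  refine orbit_finite_of_orbit_wall_finite (orbit_finite_of_few_strayFrames hS (s := s) hτ hk
    (fun g _ _ hAB => hH.wallsCross_smul g hAB)
    (fun _ _ _ hAB => hH.not_three_wallsCross hAB) fun ℓ hℓ => ?_)
  have few_reversing : ({w ∈ frames s ℓ | FreeGroup.mk w • h ⊂ hᶜ}.ncard : ℝ) < τ ^ (ℓ + 3) :=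
    not_le.1 fun hc => hr ⟨ℓ, hℓ, hc⟩
  have few_reversing' : ({w ∈ frames s ℓ | FreeGroup.mk w • hᶜ ⊂ hᶜᶜ}.ncard : ℝ) < τ ^ (ℓ + 3) :=
    not_le.1 fun hc => hr' ⟨ℓ, hℓ, hc⟩
  have few_contracting : ∀ h' ∈ ℋ,
      ({w ∈ frames s ℓ | FreeGroup.mk w • h' ⊂ h'}.ncard : ℝ) < τ ^ (ℓ + 3) := fun h' hh' =>
    ((hN h' hh').ncard_frames_lt (by omega) (by omega)).trans_le
      (pow_le_pow_right₀ hτ (by omega))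
  have hcard := ncard_le_add_of_subset_union (hH.strayFrames_wall_subset hh s ℓ)
    ((sep_frames_finite _).union (sep_frames_finite _))
    ((sep_frames_finite _).union (sep_frames_finite _))
  have hcard_left := ncard_le_add_of_subset_union Set.Subset.rfl
    (sep_frames_finite (s := s) (ℓ := ℓ) fun w => FreeGroup.mk w • h ⊂ hᶜ)
    (sep_frames_finite (s := s) (ℓ := ℓ) fun w => FreeGroup.mk w • hᶜ ⊂ hᶜᶜ)
  have hcard_right := ncard_le_add_of_subset_union Set.Subset.rfl
    (sep_frames_finite (s := s) (ℓ := ℓ) fun w => FreeGroup.mk w • h ⊂ h)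
    (sep_frames_finite (s := s) (ℓ := ℓ) fun w => FreeGroup.mk w • hᶜ ⊂ hᶜ)
  linarith [few_contracting h hh, few_contracting hᶜ (hH.compl_mem h hh)]

section FiniteOrbit

theorem HalfspaceSystem.orbit_finite_of_separating_mem {G V : Type*} [Group G] [MulAction G V]
    {ℋ C : Set (Set V)} (hH : HalfspaceSystem G ℋ) (hC : C.Finite)
    (hsmul : ∀ g : G, ∀ h ∈ C, g • h ∈ C) {y : V}
    (hsep : ∀ g : G, ∀ h ∈ ℋ, y ∈ h → g • y ∉ h → h ∈ C) : (MulAction.orbit G y).Finite := by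
  refine Set.Finite.of_finite_image (f := fun z => {h ∈ C | z ∈ h})
    (hC.finite_subsets.subset ?_) ?_
  · rintro _ ⟨z, -, rfl⟩
    exact fun h hh => hh.1
  rintro _ ⟨g, rfl⟩ _ ⟨g', rfl⟩ heq
  by_contra hne
  dsimp only at hne heq
  obtain ⟨h, hh, hgy, hg'y⟩ := hH.exists_separating _ _ hne
  have compl_mem : hᶜ ∈ C := by
    have := hsmul g _ (hsep (g⁻¹ * g') (g⁻¹ • hᶜ) (hH.smul_mem _ _ (hH.compl_mem h hh))
      (Set.mem_inv_smul_set_iff.2 hgy) fun hmem => by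
        rw [mul_smul, Set.smul_mem_smul_set_iff] at hmem
        exact hmem hg'y)
    rwa [smul_inv_smul] at this
  have : hᶜ ∈ {h ∈ C | g • y ∈ h} := ⟨compl_mem, hgy⟩
  rw [heq] at this
  exact this.2 hg'y

theorem HalfspaceSystem.separating_mem_of_forall_letter {C : Set (Set V)}
    (hH : HalfspaceSystem (FreeGroup S) ℋ) (hsmul : ∀ g : FreeGroup S, ∀ h ∈ C, g • h ∈ C) {y : V}
    (hletter : ∀ a : S × Bool, ∀ h ∈ ℋ, y ∈ h → FreeGroup.mk [a] • y ∉ h → h ∈ C)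
    (g : FreeGroup S) : ∀ h ∈ ℋ, y ∈ h → g • y ∉ h → h ∈ C := by
  induction g using Quot.inductionOn with
  | h w =>
  change ∀ h ∈ ℋ, y ∈ h → FreeGroup.mk w • y ∉ h → h ∈ C
  induction w with
  | nil => exact fun h _ hy hy' => absurd hy (one_smul (FreeGroup S) y ▸ hy')
  | cons a w ih =>
    intro h hh hy hwy
    rw [freeGroup_mk_cons, mul_smul] at hwy
    by_cases hay : FreeGroup.mk [a] • y ∈ h
    · have := hsmul (FreeGroup.mk [a]) _ (ih ((FreeGroup.mk [a])⁻¹ • h) (hH.smul_mem _ h hh)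
        (Set.mem_inv_smul_set_iff.2 hay) fun hmem => hwy (Set.mem_inv_smul_set_iff.1 hmem))
      rwa [smul_inv_smul] at this
    · exact hletter a h hh hy hay

theorem HalfspaceSystem.orbit_finite_of_separating_orbits_finite [Finite S]
    (hH : HalfspaceSystem (FreeGroup S) ℋ) {y : V}
    (hy : ∀ h ∈ ℋ, ∀ g : FreeGroup S, y ∈ h → g • y ∉ h →
      (MulAction.orbit (FreeGroup S) h).Finite) :
    (MulAction.orbit (FreeGroup S) y).Finite := by
  let C₀ : Set (Set V) := ⋃ a : S × Bool, {h ∈ ℋ | y ∈ h ∧ FreeGroup.mk [a] • y ∉ h}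
  let C : Set (Set V) := ⋃ h ∈ C₀, MulAction.orbit (FreeGroup S) h
  have C_finite : C.Finite := by
    refine (Set.finite_iUnion fun a => hH.finite_separating _ _).biUnion fun h hh => ?_
    obtain ⟨a, hℋ, hyh, hayh⟩ := Set.mem_iUnion.1 hh
    exact hy h hℋ _ hyh hayh
  have smul_mem_C : ∀ g : FreeGroup S, ∀ h ∈ C, g • h ∈ C := by
    intro g h hh
    obtain ⟨k, hk, hkh⟩ := Set.mem_iUnion₂.1 hh
    exact Set.mem_biUnion hk (MulAction.mem_orbit_of_mem_orbit g hkh)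
  exact hH.orbit_finite_of_separating_mem C_finite smul_mem_C
    (hH.separating_mem_of_forall_letter smul_mem_C fun a h hh hyh hayh =>
      Set.mem_biUnion (Set.mem_iUnion.2 ⟨a, hh, hyh, hayh⟩) (MulAction.mem_orbit_self h))

/-- The reversed halfspaces with infinite orbit; a vertex outside all of them has a finite
orbit. -/
def reversedHalfspaces (ℋ : Set (Set V)) (s : S × Bool) (τ : ℝ) (b : ℕ) : Set (Set V) :=
  {h ∈ ℋ | IsReversed s τ b h ∧ (MulAction.orbit (FreeGroup S) h).Infinite}

variable {s : S × Bool} {τ : ℝ}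

theorem HalfspaceSystem.reversedHalfspaces_finite_of_mem [Finite S] (hτ : 0 < τ) {b : ℕ}
    (hH : HalfspaceSystem (FreeGroup S) ℋ) (x : V) :
    {h ∈ reversedHalfspaces ℋ s τ b | x ∈ h}.Finite := by
  refine (((frames_finite s b).union (frames_finite s (2 * b))).biUnion
    fun w _ => hH.finite_separating x (FreeGroup.mk w • x)).subset ?_
  rintro h ⟨⟨hh, ⟨ℓ, hℓ, hc⟩, -⟩, hx⟩
  have ncard_pos : 0 < {w ∈ frames s ℓ | FreeGroup.mk w • h ⊂ hᶜ}.ncard :=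
    Nat.cast_pos.1 ((pow_pos hτ _).trans_le hc)
  obtain ⟨w, hw, hwh⟩ := (Set.ncard_pos (sep_frames_finite _)).1 ncard_pos
  refine Set.mem_biUnion (x := w) ?_ ⟨hh, hx, hwh.1 (Set.smul_mem_smul_set hx)⟩
  rcases hℓ with rfl | rfl
  exacts [.inl hw, .inr hw]

variable [Fintype S] {k : ℕ}

theorem HalfspaceSystem.mem_or_compl_mem_reversedHalfspaces (hS : 3 ≤ Fintype.card S)
    (hτ : 1 ≤ τ) (hk : 8 * τ ^ (k + 27) ≤ ((2 * Fintype.card S - 1 : ℕ) : ℝ) ^ k)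
    (hH : HalfspaceSystem (FreeGroup S) ℋ)
    (hN : ∀ h ∈ ℋ, FewContractions s τ (4 * (k + 24) + 6) h) {h : Set V} (hh : h ∈ ℋ)
    (hinf : (MulAction.orbit (FreeGroup S) h).Infinite) :
    h ∈ reversedHalfspaces ℋ s τ (k + 24) ∨ hᶜ ∈ reversedHalfspaces ℋ s τ (k + 24) := by
  by_cases hr : IsReversed s τ (k + 24) h
  · exact .inl ⟨hh, hr, hinf⟩
  by_cases hr' : IsReversed s τ (k + 24) hᶜ
  · refine .inr ⟨hH.compl_mem h hh, hr', fun hfin => hinf ?_⟩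
    simpa only [compl_compl] using orbit_compl_finite hfin
  · exact absurd (hH.orbit_finite_of_not_isReversed hS hτ hk hN hh hr hr') hinf

theorem HalfspaceSystem.smul_mem_reversedHalfspaces (hS : 3 ≤ Fintype.card S) (hτ : 1 ≤ τ)
    (hk : 8 * τ ^ (k + 27) ≤ ((2 * Fintype.card S - 1 : ℕ) : ℝ) ^ k)
    (hH : HalfspaceSystem (FreeGroup S) ℋ)
    (hN : ∀ h ∈ ℋ, FewContractions s τ (4 * (k + 24) + 6) h) (g : FreeGroup S) :
    ∀ h ∈ reversedHalfspaces ℋ s τ (k + 24), g • h ∈ reversedHalfspaces ℋ s τ (k + 24) := by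
  have : Nontrivial S := Fintype.one_lt_card_iff_nontrivial.1 (by omega)
  refine smul_mem_of_forall_connector (s := s) ?_ g
  rintro y hy h ⟨hh, hr, hinf⟩
  rw [← MulAction.orbit_smul (FreeGroup.mk y)] at hinf
  refine (hH.mem_or_compl_mem_reversedHalfspaces hS hτ hk hN (hH.smul_mem _ h hh)
    hinf).resolve_right fun hmem => ?_
  rw [← Set.smul_set_compl] at hmem
  exact hr.not_isReversed_smul_compl hτ (by omega) (hN _ (hH.compl_mem h hh)) hy hmem.2.1

theorem HalfspaceSystem.exists_orbit_finite (hS : 3 ≤ Fintype.card S) (hτ : 1 ≤ τ)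
    (hk : 8 * τ ^ (k + 27) ≤ ((2 * Fintype.card S - 1 : ℕ) : ℝ) ^ k)
    (hH : HalfspaceSystem (FreeGroup S) ℋ)
    (hN : ∀ h ∈ ℋ, FewContractions s τ (4 * (k + 24) + 6) h) :
    ∃ y : V, (MulAction.orbit (FreeGroup S) y).Finite := by
  obtain ⟨y, hy⟩ := hH.helly (reversedHalfspaces ℋ s τ (k + 24)) (fun h hh => hh.1)
    (hH.reversedHalfspaces_finite_of_mem (by positivity)) fun h hh k hk =>
      hh.2.1.compl_inter_compl_nonempty hτ (by omega) (hN h hh.1) hk.2.1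
  refine ⟨y, hH.orbit_finite_of_separating_orbits_finite fun h hh g hyh hgyh => ?_⟩
  by_contra hinf
  rcases hH.mem_or_compl_mem_reversedHalfspaces hS hτ hk hN hh hinf with hmem | hmem
  · exact hy h hmem hyh
  · refine hy _ (hH.smul_mem_reversedHalfspaces hS hτ hk hN g⁻¹ _ hmem) ?_
    rw [Set.mem_inv_smul_set_iff]
    exact hgyh

end FiniteOrbit

end HalfspaceSystems

/-! ## Relators containing many blocks -/

section Relators

open FreeGroup

open scoped Pointwise

/-- Concatenations of `m` members of `C`. -/
def blockProducts {α : Type*} (C : Set (List α)) : ℕ → Set (List α)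
  | 0 => {[]}
  | m + 1 => {w | ∃ u ∈ C, ∃ v ∈ blockProducts C m, w = u ++ v}

theorem length_of_mem_blockProducts {α : Type*} {C : Set (List α)} {ℓ : ℕ}
    (hC : ∀ w ∈ C, w.length = ℓ) {m : ℕ} {w : List α} (hw : w ∈ blockProducts C m) :
    w.length = ℓ * m := by
  induction m generalizing w with
  | zero =>
    obtain rfl : w = [] := hw
    rfl
  | succ m ih =>
    obtain ⟨u, hu, v, hv, rfl⟩ := hw
    rw [List.length_append, hC u hu, ih hv, mul_add, mul_one, add_comm]

theorem pow_le_ncard_blockProducts {α : Type*} [Finite α] {C : Set (List α)} {ℓ : ℕ}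
    (hC : ∀ w ∈ C, w.length = ℓ) {c : ℝ} (hc₀ : 0 ≤ c) (hc : c ≤ C.ncard) (m : ℕ) :
    c ^ m ≤ (blockProducts C m).ncard := by
  induction m with
  | zero => simp [blockProducts]
  | succ m ih =>
    have blockProducts_finite : (blockProducts C (m + 1)).Finite :=
      (List.finite_length_eq α _).subset fun w hw => length_of_mem_blockProducts hC hw
    calc c ^ (m + 1) = c * c ^ m := pow_succ' c m
      _ ≤ C.ncard * c ^ m := by gcongr
      _ ≤ (blockProducts C (m + 1)).ncard :=
        ncard_mul_le_ncard_of_append_mem hC ((List.finite_length_eq α ℓ).subset hC)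
          blockProducts_finite (fun w hw v hv => ⟨w, hw, v, hv, rfl⟩) fun _ _ => ih

variable {S : Type v}

theorem isBlock_of_mem_blockProducts {s : S × Bool} {C : Set (List (S × Bool))}
    (hC : ∀ w ∈ C, IsBlock s w) {m : ℕ} {w : List (S × Bool)} (hw : w ∈ blockProducts C m) :
    IsBlock s w := by
  induction m generalizing w with
  | zero =>
    obtain rfl : w = [] := hw
    exact ⟨by simp, rfl⟩
  | succ m ih =>
    obtain ⟨u, hu, v, hv, rfl⟩ := hw
    exact (hC u hu).append (ih hv)

section Action

variable {V : Type u} [MulAction (FreeGroup S) V] {h : Set V} {C : Set (List (S × Bool))} {m : ℕ}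
  {w : List (S × Bool)}

theorem smul_subset_of_mem_blockProducts (hC : ∀ w ∈ C, mk w • h ⊆ h)
    (hw : w ∈ blockProducts C m) : mk w • h ⊆ h := by
  induction m generalizing w with
  | zero =>
    obtain rfl : w = [] := hw
    exact (one_smul (FreeGroup S) h).subset
  | succ m ih =>
    obtain ⟨u, hu, v, hv, rfl⟩ := hw
    rw [← mul_mk, mul_smul]
    exact (Set.smul_set_mono (ih hv)).trans (hC u hu)

theorem smul_ssubset_of_mem_blockProducts (hC : ∀ w ∈ C, mk w • h ⊂ h) (hm : m ≠ 0)
    (hw : w ∈ blockProducts C m) : mk w • h ⊂ h := by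
  obtain ⟨m, rfl⟩ := Nat.exists_eq_succ_of_ne_zero hm
  obtain ⟨u, hu, v, hv, rfl⟩ := hw
  rw [← mul_mk, mul_smul]
  exact (Set.smul_set_mono (smul_subset_of_mem_blockProducts (fun w hw => (hC w hw).1)
    hv)).trans_ssubset (hC u hu)

end Action

/-- Words of length `L` consisting of fewer than `ℓ` letters `t`, followed by words of length `ℓ`
from `C`. -/
def paddedProducts (t : S × Bool) (C : Set (List (S × Bool))) (ℓ L : ℕ) :
    Set (List (S × Bool)) :=
  (fun v => List.replicate (L % ℓ) t ++ v) '' blockProducts C (L / ℓ)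

theorem length_of_mem_paddedProducts {t : S × Bool} {C : Set (List (S × Bool))} {ℓ L : ℕ}
    (hC : ∀ w ∈ C, w.length = ℓ) {w : List (S × Bool)} (hw : w ∈ paddedProducts t C ℓ L) :
    w.length = L := by
  obtain ⟨v, hv, rfl⟩ := hw
  rw [List.length_append, List.length_replicate, length_of_mem_blockProducts hC hv]
  exact Nat.mod_add_div L ℓ

theorem isReduced_of_mem_paddedProducts {s t : S × Bool} (hst : s.1 ≠ t.1)
    {C : Set (List (S × Bool))} {ℓ L : ℕ} (hC : ∀ w ∈ C, IsBlock s w) {w : List (S × Bool)}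
    (hw : w ∈ paddedProducts t C ℓ L) : IsReduced w := by
  obtain ⟨v, hv, rfl⟩ := hw
  have hv' := isBlock_of_mem_blockProducts hC hv
  refine IsReduced.infix (L₂ := List.replicate (L % ℓ) t ++ (v ++ [s])) ?_
    ⟨[], [s], by simp⟩
  cases L % ℓ with
  | zero => exact hv'.1
  | succ r => exact isReduced_replicate_append hv'.1 hv'.2 (fun e => hst (by rw [e]; rfl)) r

theorem pow_le_ncard_paddedProducts [Finite S] (t : S × Bool) {C : Set (List (S × Bool))}
    {ℓ Λ L : ℕ} (hℓ : 1 ≤ ℓ) (hℓΛ : ℓ ≤ Λ) (hC : ∀ w ∈ C, w.length = ℓ) {τ : ℝ} (hτ : 1 ≤ τ)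
    (hcard : τ ^ ℓ ≤ C.ncard) : τ ^ L ≤ τ ^ Λ * (paddedProducts t C ℓ L).ncard := by
  have hprod := pow_le_ncard_blockProducts hC (by positivity) hcard (L / ℓ)
  rw [paddedProducts, Set.ncard_image_of_injective _ (List.append_right_injective _)]
  have hmod := Nat.mod_lt L hℓ
  calc τ ^ L = τ ^ (L % ℓ) * (τ ^ ℓ) ^ (L / ℓ) := by
        rw [← pow_mul, ← pow_add, Nat.mod_add_div]
    _ ≤ τ ^ Λ * (blockProducts C (L / ℓ)).ncard := by
        gcongr
        omega

/-- The sets of at least `τ ^ ℓ` blocks of length `ℓ`, for `1 ≤ ℓ ≤ Λ`, paired with `ℓ`. -/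
def largeBlockSets (s : S × Bool) (τ : ℝ) (Λ : ℕ) : Set (ℕ × Set (List (S × Bool))) :=
  {x | (1 ≤ x.1 ∧ x.1 ≤ Λ) ∧ x.2 ⊆ blocks s x.1 ∧ τ ^ x.1 ≤ x.2.ncard}

theorem largeBlockSets_finite [Finite S] (s : S × Bool) (τ : ℝ) (Λ : ℕ) :
    (largeBlockSets s τ Λ).Finite := by
  refine ((Set.finite_Iic Λ).biUnion fun ℓ _ =>
    (Set.finite_singleton ℓ).prod (blocks_finite s ℓ).finite_subsets).subset ?_
  rintro ⟨ℓ, C⟩ ⟨⟨-, hℓ⟩, hC, -⟩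
  exact Set.mem_biUnion (x := ℓ) hℓ ⟨rfl, hC⟩

/-- A relator `tʳv` with `v` a product of contractions of `h` makes `t⁻ʳ` a contraction of `h`. With
`t⁻¹` in place of `t` the inverse of that element is a contraction as well, which is absurd. -/
theorem fewContractions_of_relators {s : S × Bool} {t : S} {τ : ℝ} {Λ L : ℕ} (hL : Λ ≤ L)
    {ι : Type*} {R : ι → List (S × Bool)}
    (hR : ∀ x ∈ largeBlockSets s τ Λ, ∀ e : Bool, ∃ i, R i ∈ paddedProducts (t, e) x.2 x.1 L)
    {V : Type u} [MulAction (FreeGroup S) V] (hact : ∀ i, ∀ x : V, mk (R i) • x = x)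
    (h : Set V) : FewContractions s τ Λ h := by
  intro ℓ hℓ hℓΛ
  by_contra! hcard
  have padding_inv_smul_ssubset : ∀ e, (mk (List.replicate (L % ℓ) (t, e)))⁻¹ • h ⊂ h := by
    intro e
    obtain ⟨i, v, hv, hRi⟩ := hR (ℓ, {w ∈ blocks s ℓ | mk w • h ⊂ h})
      ⟨⟨hℓ, hℓΛ⟩, fun w hw => hw.1, hcard⟩ e
    have smul_eq : mk (List.replicate (L % ℓ) (t, e)) • mk v • h = h := by
      rw [← mul_smul, mul_mk, show List.replicate (L % ℓ) (t, e) ++ v = R i from hRi,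
        ← Set.image_smul, Set.image_congr fun x _ => hact i x, Set.image_id']
    rw [← eq_inv_smul_iff.2 smul_eq]
    exact smul_ssubset_of_mem_blockProducts (fun w hw => hw.2)
      (Nat.div_pos (hℓΛ.trans hL) hℓ).ne' hv
  have inv_padding : (mk (List.replicate (L % ℓ) (t, true)))⁻¹ =
      mk (List.replicate (L % ℓ) (t, false)) := by
    simp [inv_mk, invRev]
  have hss := smul_ssubset_smul (padding_inv_smul_ssubset false)
    (mk (List.replicate (L % ℓ) (t, false)))
  rw [smul_inv_smul, ← inv_padding] at hss
  exact (hss.trans (padding_inv_smul_ssubset true)).ne rfl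

end Relators

/-! ## Counting tuples of relators -/

section Counting

open FreeGroup

section Tuples

variable {A κ : Type*} [Finite A] [Finite κ]

theorem ncard_forall_notMem_le {B : Set A} {p : ℝ} (hB : p * Nat.card A ≤ B.ncard) :
    ({R : κ → A | ∀ j, R j ∉ B}.ncard : ℝ) ≤
      Real.exp (-(p * Nat.card κ)) * Nat.card (κ → A) := by
  have hpi : {R : κ → A | ∀ j, R j ∉ B}.ncard = Bᶜ.ncard ^ Nat.card κ := by
    rw [← Nat.card_coe_set_eq, ← Nat.card_coe_set_eq, ← Nat.card_fun]
    exact Nat.card_congr (Equiv.subtypePiEquivPi (p := fun _ a => a ∉ B))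
  have hsum : (B.ncard : ℝ) + Bᶜ.ncard = Nat.card A := by
    exact_mod_cast Set.ncard_add_ncard_compl B
  have hcompl : (Bᶜ.ncard : ℝ) ≤ Real.exp (-p) * Nat.card A :=
    calc (Bᶜ.ncard : ℝ) ≤ (1 - p) * Nat.card A := by linarith
      _ ≤ Real.exp (-p) * Nat.card A := by
        gcongr
        exact Real.one_sub_le_exp_neg p
  rw [hpi, Nat.card_fun, Nat.cast_pow, Nat.cast_pow]
  calc (Bᶜ.ncard : ℝ) ^ Nat.card κ ≤ (Real.exp (-p) * Nat.card A) ^ Nat.card κ := by gcongr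
    _ = Real.exp (-(p * Nat.card κ)) * (Nat.card A : ℝ) ^ Nat.card κ := by
      rw [mul_pow, ← Real.exp_nat_mul, mul_neg, mul_comm p]

theorem one_sub_mul_exp_le_card_div [Nonempty A] {ι : Type*} {I : Set ι} (hI : I.Finite)
    (B : ι → Set A) {p : ℝ} (hB : ∀ i ∈ I, p * Nat.card A ≤ (B i).ncard) {Q : (κ → A) → Prop}
    (hQ : ∀ R, (∀ i ∈ I, ∃ j, R j ∈ B i) → Q R) :
    1 - I.ncard * Real.exp (-(p * Nat.card κ)) ≤
      (Nat.card {R // Q R} : ℝ) / Nat.card (κ → A) := by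
  have hsplit : (Nat.card {R // Q R} : ℝ) + {R | Q R}ᶜ.ncard = Nat.card (κ → A) := by
    exact_mod_cast Set.ncard_add_ncard_compl {R | Q R}
  have compl_subset : {R | Q R}ᶜ ⊆ ⋃ i ∈ hI.toFinset, {R : κ → A | ∀ j, R j ∉ B i} := by
    intro R hR
    by_contra hn
    refine hR (hQ R fun i hi => ?_)
    by_contra! hj
    exact hn (Set.mem_biUnion (hI.mem_toFinset.2 hi) hj)
  have hbad : ({R | Q R}ᶜ.ncard : ℝ) ≤
      I.ncard * (Real.exp (-(p * Nat.card κ)) * Nat.card (κ → A)) :=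
    calc ({R | Q R}ᶜ.ncard : ℝ) ≤
          ∑ i ∈ hI.toFinset, ({R : κ → A | ∀ j, R j ∉ B i}.ncard : ℝ) := by
          exact_mod_cast (Set.ncard_le_ncard compl_subset).trans
            (Finset.set_ncard_biUnion_le _ _)
      _ ≤ ∑ _i ∈ hI.toFinset, Real.exp (-(p * Nat.card κ)) * Nat.card (κ → A) :=
        Finset.sum_le_sum fun i hi => ncard_forall_notMem_le (hB i (hI.mem_toFinset.1 hi))
      _ = I.ncard * (Real.exp (-(p * Nat.card κ)) * Nat.card (κ → A)) := by
        rw [Finset.sum_const, nsmul_eq_mul, Set.ncard_eq_toFinset_card _ hI]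
  have card_pos : (0 : ℝ) < Nat.card (κ → A) := Nat.cast_pos.2 Nat.card_pos
  rw [le_div_iff₀ card_pos]
  linarith

end Tuples

variable {S : Type v}

theorem reducedWord_finite [Finite S] (L : ℕ) : Finite (ReducedWord S L) :=
  ((List.finite_length_eq (S × Bool) L).subset fun _ hw => hw.1 :
    {w : List (S × Bool) | w.length = L ∧ IsReduced w}.Finite)

theorem reducedWord_nonempty [Nonempty S] (L : ℕ) : Nonempty (ReducedWord S L) := by
  obtain ⟨t⟩ := ‹Nonempty S›
  exact ⟨List.replicate L (t, true), List.length_replicate,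
    List.isChain_replicate_of_rel L fun _ => rfl⟩

variable [Fintype S] [Nonempty S]

theorem cast_two_mul_card_sub_one :
    ((2 * Fintype.card S - 1 : ℕ) : ℝ) = 2 * (Fintype.card S : ℝ) - 1 := by
  have : 0 < Fintype.card S := Fintype.card_pos
  rw [Nat.cast_sub (by omega), Nat.cast_mul, Nat.cast_ofNat, Nat.cast_one]

theorem card_reducedWord_le (L : ℕ) : (Nat.card (ReducedWord S L) : ℝ) ≤
    2 * Fintype.card S * (2 * (Fintype.card S : ℝ) - 1) ^ L := by
  classical
  have subset_continuations : {w : List (S × Bool) | w.length = L ∧ IsReduced w} ⊆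
      (Finset.univ.biUnion (continuations L) : Finset (List (S × Bool))) := by
    rintro w ⟨hlen, hw⟩
    simp only [Finset.coe_biUnion, Set.mem_iUnion, Finset.mem_coe, mem_continuations]
    cases w with
    | nil =>
      obtain ⟨t⟩ := ‹Nonempty S›
      exact ⟨(t, true), Finset.mem_univ _, hlen, IsReduced.singleton⟩
    | cons a w =>
      exact ⟨a, Finset.mem_univ _, hlen, isReduced_cons_cons.2 ⟨fun _ => rfl, hw⟩⟩
  have hcard : Nat.card (ReducedWord S L) ≤
      2 * Fintype.card S * (2 * Fintype.card S - 1) ^ L :=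
    calc Nat.card (ReducedWord S L)
        ≤ (Finset.univ.biUnion (continuations L) : Finset (List (S × Bool))).card := by
          rw [← Set.ncard_coe_finset]
          exact Set.ncard_le_ncard subset_continuations (Finset.finite_toSet _)
      _ ≤ ∑ a : S × Bool, (continuations L a).card := Finset.card_biUnion_le
      _ = 2 * Fintype.card S * (2 * Fintype.card S - 1) ^ L := by
        simp only [card_continuations, Finset.sum_const, Finset.card_univ, Fintype.card_prod,
          Fintype.card_bool, smul_eq_mul, mul_comm (Fintype.card S) 2]
  rw [← cast_two_mul_card_sub_one]
  exact_mod_cast hcard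

theorem mul_card_reducedWord_le_ncard {s t : S × Bool} (hst : s.1 ≠ t.1) {τ : ℝ} (hτ : 1 ≤ τ)
    {Λ : ℕ} {x : ℕ × Set (List (S × Bool))} (hx : x ∈ largeBlockSets s τ Λ) (L : ℕ) :
    1 / (τ ^ Λ * (2 * Fintype.card S)) * (τ / (2 * (Fintype.card S : ℝ) - 1)) ^ L *
      Nat.card (ReducedWord S L) ≤
        {w : ReducedWord S L | w.1 ∈ paddedProducts t x.2 x.1 L}.ncard := by
  obtain ⟨ℓ, C⟩ := x
  obtain ⟨⟨hℓ, hℓΛ⟩, hC, hcard⟩ := hx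
  have := reducedWord_finite (S := S) L
  have hfin : {w : ReducedWord S L | w.1 ∈ paddedProducts t C ℓ L}.Finite :=
    Set.finite_univ.subset (Set.subset_univ _)
  have hS : (1 : ℝ) ≤ Fintype.card S := by exact_mod_cast Fintype.card_pos
  have hq : 0 < 2 * (Fintype.card S : ℝ) - 1 := by linarith
  have paddedProducts_subset : paddedProducts t C ℓ L ⊆
      Subtype.val '' {w : ReducedWord S L | w.1 ∈ paddedProducts t C ℓ L} := fun w hw =>
    ⟨⟨w, length_of_mem_paddedProducts (fun w hw => (hC hw).1) hw,
      isReduced_of_mem_paddedProducts hst (fun w hw => (hC hw).2) hw⟩, hw, rfl⟩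
  have ncard_le : (paddedProducts t C ℓ L).ncard ≤
      {w : ReducedWord S L | w.1 ∈ paddedProducts t C ℓ L}.ncard :=
    (Set.ncard_le_ncard paddedProducts_subset (hfin.image _)).trans
      (Set.ncard_image_le hfin)
  calc 1 / (τ ^ Λ * (2 * Fintype.card S)) * (τ / (2 * (Fintype.card S : ℝ) - 1)) ^ L *
        Nat.card (ReducedWord S L)
      ≤ 1 / (τ ^ Λ * (2 * Fintype.card S)) * (τ / (2 * (Fintype.card S : ℝ) - 1)) ^ L *
        (2 * Fintype.card S * (2 * (Fintype.card S : ℝ) - 1) ^ L) := by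
        gcongr
        exact card_reducedWord_le L
    _ = τ ^ L / τ ^ Λ := by
        rw [div_pow]
        field_simp
    _ ≤ (paddedProducts t C ℓ L).ncard := by
        rw [div_le_iff₀' (by positivity)]
        exact pow_le_ncard_paddedProducts t hℓ hℓΛ (fun w hw => (hC hw).1) hτ hcard
    _ ≤ {w : ReducedWord S L | w.1 ∈ paddedProducts t C ℓ L}.ncard := by exact_mod_cast ncard_le

end Counting

/-! ## Fixed points and random groups -/

section Final

open FreeGroup Filter

open scoped Pointwise Topology

section FixedPoints

variable {V : Type u}

theorem point_half_apply {k : ℕ} {φ : (Fin k → Bool) → V} (hφ : Function.Injective φ) (x : V)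
    [Decidable (x ∈ Set.range φ)] :
    CubeComplex.point φ (fun _ => 1 / 2) x = if x ∈ Set.range φ then (1 / 2 : ℝ) ^ k else 0 := by
  classical
  have weight_eq : ∀ ε : Fin k → Bool,
      ∏ i, (if ε i then (1 / 2 : ℝ) else 1 - 1 / 2) = (1 / 2) ^ k := by
    intro ε
    rw [sub_half, Finset.prod_congr rfl fun i _ => ite_self _, Finset.prod_const,
      Finset.card_univ, Fintype.card_fin]
  simp only [CubeComplex.point, weight_eq]
  split_ifs with hx
  · obtain ⟨ε, rfl⟩ := hx
    rw [Finset.sum_eq_single ε (fun ε' _ hne => if_neg fun e => hne (hφ e))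
      (fun hε => absurd (Finset.mem_univ _) hε), if_pos rfl]
  · exact Finset.sum_eq_zero fun ε _ => if_neg fun e => hx ⟨ε, e⟩

theorem CubeComplex.exists_fixed_point {X : CubeComplex V} {K : Type*} [Group K] (f : K →* X.Aut)
    {c : Set V} (hc : c ∈ X.cubes) (hinv : ∀ g : K, ((f g : X.Aut) : Equiv.Perm V) '' c = c) :
    ∃ p : X.Realization, ∀ g : K, f g • p = p := by
  classical
  obtain ⟨k, φ, hφ, rfl⟩ := X.exists_chart c hc
  have inv_mem_iff : ∀ g x,
      ((f g : X.Aut) : Equiv.Perm V)⁻¹ x ∈ Set.range φ ↔ x ∈ Set.range φ := by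
    intro g x
    conv_rhs => rw [← hinv g]
    exact Set.mem_image_equiv.symm
  -- The fixed point is the barycenter of the cube.
  refine ⟨⟨point φ fun _ => 1 / 2, k, φ, fun _ => 1 / 2, hφ, fun _ => by norm_num, rfl⟩,
    fun g => Subtype.ext (funext fun x => ?_)⟩
  change point φ (fun _ => 1 / 2) (((f g : X.Aut) : Equiv.Perm V)⁻¹ x) = point φ (fun _ => 1 / 2) x
  simp only [point_half_apply hφ.1, inv_mem_iff]

theorem SquareComplexGraph.halfspaceSystem {K : Type v} [Group K] [MulAction K V]
    {Γ : SimpleGraph V} {Sq : V → V → V → V → Prop} (hG : SquareComplexGraph Γ Sq)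
    (hadj : ∀ (g : K) (x y : V), Γ.Adj x y → Γ.Adj (g • x) (g • y)) :
    HalfspaceSystem K (halfspaces Γ) where
  compl_mem _ hh := hG.compl_mem_halfspaces hh
  smul_mem g _ hh := smul_mem_halfspaces hG.connected hadj g hh
  finite_separating := hG.finite_separating
  exists_separating _ _ := hG.exists_separating
  not_three_crossing _ m₁ _ m₂ _ m₃ := hG.not_three_crossing m₁ m₂ m₃
  helly T hT hfin hpair := by
    have := hG.connected.nonempty
    obtain ⟨y, -, hy⟩ := hG.helly (C := Set.univ) (fun _ _ _ _ _ _ => Set.mem_univ _)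
      Set.univ_nonempty hT (fun y _ => hfin y)
      fun h hh k hk => (Set.univ_inter _).symm ▸ hpair h hh k hk
    exact ⟨y, hy⟩

end FixedPoints

variable {S : Type v} [Fintype S]

theorem propertyFC_of_relators (hS : 3 ≤ Fintype.card S) {s : S × Bool} {t : S} {τ : ℝ}
    (hτ : 1 ≤ τ) {k : ℕ} (hk : 8 * τ ^ (k + 27) ≤ (2 * (Fintype.card S : ℝ) - 1) ^ k) {L : ℕ}
    (hL : 4 * (k + 24) + 6 ≤ L) {ι : Type*} {R : ι → List (S × Bool)}
    (hR : ∀ x ∈ largeBlockSets s τ (4 * (k + 24) + 6), ∀ e : Bool,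
      ∃ i, R i ∈ paddedProducts (t, e) x.2 x.1 L) :
    PropertyFC.{u, v} 2 (PresentedGroup (Set.range fun i => FreeGroup.mk (R i))) := by
  intro V X hX hd ρ
  have : Nonempty S := ⟨t⟩
  let f : FreeGroup S →* X.Aut := ρ.comp (PresentedGroup.mk _)
  let _ : MulAction (FreeGroup S) V := MulAction.compHom V f
  have hG := hX.squareComplexGraph hd
  have hadj : ∀ (g : FreeGroup S) (x y : V), X.graph.Adj x y → X.graph.Adj (g • x) (g • y) := by
    rintro g x y ⟨hne, hxy⟩
    have image_pair_mem := ((f g).2 {x, y}).2 hxy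
    rw [Set.image_pair] at image_pair_mem
    exact ⟨fun e => hne (MulAction.injective g e), image_pair_mem⟩
  have hact : ∀ i, ∀ x : V, FreeGroup.mk (R i) • x = x := by
    intro i x
    have hf : f (FreeGroup.mk (R i)) = 1 := by
      rw [MonoidHom.comp_apply, PresentedGroup.one_of_mem (Set.mem_range_self i), _root_.map_one]
    change ((f (FreeGroup.mk (R i)) : X.Aut) : Equiv.Perm V) x = x
    rw [hf]
    rfl
  obtain ⟨y, hy⟩ := (hG.halfspaceSystem hadj).exists_orbit_finite hS hτ
    (by rwa [cast_two_mul_card_sub_one]) fun h _ => fewContractions_of_relators hL hR hact h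
  obtain ⟨c, hc, hinv⟩ := CubeComplex.exists_invariant_cube hG hadj
    (fun g => MulAction.smul_orbit g y) ⟨y, MulAction.mem_orbit_self y⟩ hy
  obtain ⟨p, hp⟩ := CubeComplex.exists_fixed_point f hc hinv
  refine ⟨p, fun g => ?_⟩
  obtain ⟨g, rfl⟩ := PresentedGroup.mk_surjective _ g
  exact hp g

theorem exists_const_mul_pow_le {τ q : ℝ} (hτ : 0 < τ) (hq : τ < q) (c : ℝ) (m : ℕ) :
    ∃ k : ℕ, c * τ ^ (k + m) ≤ q ^ k := by
  obtain ⟨k, hk⟩ := pow_unbounded_of_one_lt (c * τ ^ m) ((one_lt_div hτ).2 hq)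
  refine ⟨k, ?_⟩
  rw [div_pow, lt_div_iff₀ (by positivity)] at hk
  calc c * τ ^ (k + m) = c * τ ^ m * τ ^ k := by ring
    _ ≤ q ^ k := hk.le

theorem tendsto_const_mul_pow_mul_floor {q δ d c : ℝ} (hq : 1 < q) (hd : 0 ≤ d) (hδ : δ < d)
    (hc : 0 < c) :
    Tendsto (fun L : ℕ => c * (q ^ (1 - δ) / q) ^ L * (⌊q ^ (d * (L : ℝ))⌋₊ : ℝ))
      atTop atTop := by
  have q_pos : 0 < q := by linarith
  have base_eq : q ^ (1 - δ) / q = q ^ (-δ) := by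
    rw [← Real.rpow_sub_one q_pos.ne', sub_sub_cancel_left]
  have pow_eq (L : ℕ) : (q ^ (d - δ)) ^ L = (q ^ (-δ)) ^ L * q ^ (d * (L : ℝ)) := by
    rw [Real.rpow_mul q_pos.le, Real.rpow_natCast, ← mul_pow, ← Real.rpow_add q_pos,
      neg_add_eq_sub]
  have half_le_floor (L : ℕ) : q ^ (d * (L : ℝ)) / 2 ≤ (⌊q ^ (d * (L : ℝ))⌋₊ : ℝ) :=
    (Nat.div_two_lt_floor (Real.one_le_rpow hq.le (by positivity))).le
  refine tendsto_atTop_mono (fun L => ?_) ((tendsto_pow_atTop_atTop_of_one_lt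
    (Real.one_lt_rpow hq (sub_pos.2 hδ))).const_mul_atTop (half_pos hc))
  calc c / 2 * (q ^ (d - δ)) ^ L = c * (q ^ (-δ)) ^ L * (q ^ (d * (L : ℝ)) / 2) := by
        rw [pow_eq]
        ring
    _ ≤ c * (q ^ (1 - δ) / q) ^ L * ⌊q ^ (d * (L : ℝ))⌋₊ := by
        rw [base_eq]
        gcongr
        exact half_le_floor L

theorem randomGroupProb_le_one (d : ℝ) (L : ℕ) (Q : ∀ (G : Type v) [Group G], Prop) :
    randomGroupProb S d L Q ≤ 1 := by
  have := reducedWord_finite (S := S) L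
  refine div_le_one_of_le₀ ?_ (Nat.cast_nonneg _)
  exact_mod_cast Nat.card_le_card_of_injective _ Subtype.val_injective

theorem one_sub_le_randomGroupProb {s : S × Bool} {t : S} (hst : s.1 ≠ t) {τ : ℝ} (hτ : 1 ≤ τ)
    {Λ L : ℕ} {d : ℝ} {Q : ∀ (G : Type v) [Group G], Prop}
    (hQ : ∀ R : Relators S d L, (∀ x ∈ largeBlockSets s τ Λ, ∀ e : Bool,
      ∃ j, (R j).1 ∈ paddedProducts (t, e) x.2 x.1 L) → Q (groupOfRelators R)) :
    1 - (largeBlockSets s τ Λ ×ˢ (Set.univ : Set Bool)).ncard *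
      Real.exp (-(1 / (τ ^ Λ * (2 * Fintype.card S)) *
        (τ / (2 * (Fintype.card S : ℝ) - 1)) ^ L * numRelators S d L)) ≤
      randomGroupProb S d L Q := by
  have : Nonempty S := ⟨t⟩
  have := reducedWord_finite (S := S) L
  have := reducedWord_nonempty (S := S) L
  have hprob := one_sub_mul_exp_le_card_div (κ := Fin (numRelators S d L))
    ((largeBlockSets_finite s τ Λ).prod Set.finite_univ)
    (fun x : (ℕ × Set (List (S × Bool))) × Bool =>
      {w : ReducedWord S L | w.1 ∈ paddedProducts (t, x.2) x.1.2 x.1.1 L})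
    (fun x hx => mul_card_reducedWord_le_ncard hst hτ hx.1 L)
    (Q := fun R : Relators S d L => Q (groupOfRelators R))
    fun R hR => hQ R fun x hx e => hR (x, e) ⟨hx, Set.mem_univ e⟩
  rwa [Nat.card_fin] at hprob

theorem withOverwhelmingProbability_of_paddedProducts {s : S × Bool} {t : S} (hst : s.1 ≠ t)
    {δ d : ℝ} (hδ : δ ≤ 1) (hd : 0 ≤ d) (hδd : δ < d) {Λ : ℕ}
    {Q : ∀ (G : Type v) [Group G], Prop}
    (hQ : ∀ L, Λ ≤ L → ∀ R : Relators S d L,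
      (∀ x ∈ largeBlockSets s ((2 * (Fintype.card S : ℝ) - 1) ^ (1 - δ)) Λ, ∀ e : Bool,
        ∃ j, (R j).1 ∈ paddedProducts (t, e) x.2 x.1 L) → Q (groupOfRelators R)) :
    WithOverwhelmingProbability S d Q := by
  have one_lt_card : (1 : ℝ) < Fintype.card S := by
    exact_mod_cast Fintype.one_lt_card_iff.2 ⟨_, _, hst⟩
  have hq : 1 < 2 * (Fintype.card S : ℝ) - 1 := by linarith
  set q := 2 * (Fintype.card S : ℝ) - 1
  set τ := q ^ (1 - δ)
  have hτ : 1 ≤ τ := Real.one_le_rpow hq.le (sub_nonneg.2 hδ)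
  have expected_hits := tendsto_const_mul_pow_mul_floor hq hd hδd
    (c := 1 / (τ ^ Λ * (2 * Fintype.card S))) (by positivity)
  have lower_bound := ((Real.tendsto_exp_neg_atTop_nhds_zero.comp expected_hits).const_mul
    ((largeBlockSets s τ Λ ×ˢ (Set.univ : Set Bool)).ncard : ℝ)).const_sub 1
  rw [mul_zero, sub_zero] at lower_bound
  exact tendsto_of_tendsto_of_tendsto_of_le_of_le' lower_bound tendsto_const_nhds
    ((eventually_ge_atTop Λ).mono fun L hL => one_sub_le_randomGroupProb hst hτ (hQ L hL))
    (Eventually.of_forall fun L => randomGroupProb_le_one d L Q)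

end Final

theorem mainTheorem1_general {S : Type v} [Fintype S] (hS : 3 ≤ Fintype.card S)
    {d : ℝ} (hd : 0 < d) :
    WithOverwhelmingProbability S d (fun G [Group G] => PropertyFC.{u, v} 2 G) := by
  have : Nontrivial S := Fintype.one_lt_card_iff_nontrivial.1 (by omega)
  obtain ⟨s, t, hst⟩ := exists_pair_ne S
  obtain ⟨δ, δ_pos, hδ⟩ := exists_between (lt_min hd one_pos)
  obtain ⟨hδd, hδ_one⟩ := lt_min_iff.1 hδ
  have hq : 1 < 2 * (Fintype.card S : ℝ) - 1 := by
    have : (3 : ℝ) ≤ Fintype.card S := by exact_mod_cast hS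
    linarith
  have one_le_pow := Real.one_le_rpow hq.le (sub_nonneg.2 hδ_one.le)
  have pow_lt : (2 * (Fintype.card S : ℝ) - 1) ^ (1 - δ) < 2 * (Fintype.card S : ℝ) - 1 :=
    Real.rpow_lt_self_of_one_lt hq (sub_lt_self 1 δ_pos)
  obtain ⟨k, hk⟩ := exists_const_mul_pow_le (one_pos.trans_le one_le_pow) pow_lt 8 27
  exact withOverwhelmingProbability_of_paddedProducts (s := (s, true)) hst hδ_one.le hd.le hδd
    fun L hL R hR => propertyFC_of_relators hS one_le_pow hk hL hR

theorem mainTheorem1 {S : Type v} [Fintype S] (hS : 7 ≤ Fintype.card S)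
    (d : ℝ) (hd : d ∈ Set.Ioo (0 : ℝ) 1) :
    WithOverwhelmingProbability S d (fun G [Group G] => PropertyFC.{u, v} 2 G) :=
  mainTheorem1_general (by omega) hd.1
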